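/- For a permutation $\pi$ of $[n]=\{1,\dots,n\}$ and a permutation $\tau\in\mathbb S_5$ of $\{1,\dots,5\}$, let $\#\tau(\pi)$ be the number of tuples $1\le i_1<\dots<i_5\le n$ such that, for all $a,b$, $\pi(i_a)<\pi(i_b)$ if and only if $\tau(a)<\tau(b)$. The $5$-profile of $\pi$ is the vector $(\#\tau(\pi))_{\tau\in\mathbb S_5}$. Theorem. The $5$-profile of an $n$-element permutation can be computed in $\widetilde{\mathcal O}(n^{7/4})$ time. That is, there are a single (deterministic) word-RAM program, a constant $c\ge 1$, and a function $T:\mathbb N\to\mathbb N$ satisfying $T(n)=\mathcal O\big(n^{7/4}(\log n)^d\big)$ as $n\to\infty$ for some constant $d$, such that for every $n$, every permutation $\pi$ of $[n]$ given by its one-line notation (a vector of length $n$), and every word size of at least $c(\lfloor\log_2 n\rfloor+1)$ bits (at least $c$ bits when $n=0$), the program halts after at most $T(n)$ steps and outputs the $5$-profile of $\pi$. -/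

import Mathlib

open Filter Asymptotics

/-! ### Pattern counts and profiles -/

/-- The number of occurrences of the pattern `τ` in the permutation `π`: the number of index tuples
`i₀ < ⋯ < i_{k-1}` such that `π (i_a) < π (i_b)` if and only if `τ a < τ b`.
The set `[n]` is represented by `Fin n`. -/
noncomputable def patternCount {k n : ℕ} (τ : Equiv.Perm (Fin k)) (π : Equiv.Perm (Fin n)) : ℕ :=
  Nat.card {i : Fin k ↪o Fin n // ∀ a b : Fin k, π (i a) < π (i b) ↔ τ a < τ b}

/-- The `k`-profile of `π`: the vector of all counts of patterns of size `k`. -/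
noncomputable def profile (k : ℕ) {n : ℕ} (π : Equiv.Perm (Fin n)) : Equiv.Perm (Fin k) → ℕ :=
  fun τ => patternCount τ π

/-! ### The word-RAM

A word of a machine with word size `w` is a natural number below `2 ^ w`; every value that an
instruction writes is reduced modulo `2 ^ w`. -/

namespace WordRAM

/-- The binary operations that are available as unit-cost instructions. -/
inductive BinOp
  | add | sub | mul | div | mod | and | or | xor | shl | shr

/-- The result of an operation on two words. Addition, subtraction, multiplication and left shift
are modulo `2 ^ w`; division rounds down and division by zero gives zero. -/
def BinOp.eval (w : ℕ) : BinOp → ℕ → ℕ → ℕ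
  | add, x, y => (x + y) % 2 ^ w
  | sub, x, y => (x + 2 ^ w - y) % 2 ^ w
  | mul, x, y => (x * y) % 2 ^ w
  | div, x, y => (x / y) % 2 ^ w
  | mod, x, y => (x % y) % 2 ^ w
  | and, x, y => (x &&& y) % 2 ^ w
  | or, x, y => (x ||| y) % 2 ^ w
  | xor, x, y => (x ^^^ y) % 2 ^ w
  | shl, x, y => (x <<< y) % 2 ^ w
  | shr, x, y => (x >>> y) % 2 ^ w

/-- A configuration: the registers and the random access memory, whose cells are indexed by
words. -/
structure State where
  /-- The contents of the registers. -/
  reg : ℕ → ℕ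
  /-- The contents of the memory cells. -/
  mem : ℕ → ℕ

/-- An operand is a register or a constant written in the program. -/
inductive Operand
  | reg (r : ℕ)
  | const (c : ℕ)

/-- The word denoted by an operand. -/
def Operand.eval (w : ℕ) (s : State) : Operand → ℕ
  | reg r => s.reg r
  | const c => c % 2 ^ w

/-- The straight-line instructions. -/
inductive Instr
  /-- Write an operand to a register. -/
  | set (dst : ℕ) (a : Operand)
  /-- Write the result of an operation to a register. -/
  | op (o : BinOp) (dst : ℕ) (a b : Operand)
  /-- Read the memory cell with address `addr` into a register. -/
  | load (dst : ℕ) (addr : Operand)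
  /-- Write `a` to the memory cell with address `addr`. -/
  | store (addr a : Operand)

/-- The effect of an instruction. -/
def Instr.exec (w : ℕ) (s : State) : Instr → State
  | set dst a => { s with reg := Function.update s.reg dst (a.eval w s) }
  | op o dst a b =>
      { s with reg := Function.update s.reg dst (o.eval w (a.eval w s) (b.eval w s)) }
  | load dst addr => { s with reg := Function.update s.reg dst (s.mem (addr.eval w s)) }
  | store addr a => { s with mem := Function.update s.mem (addr.eval w s) (a.eval w s) }

/-- The comparisons on which a program can branch. -/
inductive Test
  | lt (a b : Operand)
  | le (a b : Operand)
  | eq (a b : Operand)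
  | ne (a b : Operand)

/-- The truth of a comparison. -/
def Test.holds (w : ℕ) (s : State) : Test → Prop
  | lt a b => a.eval w s < b.eval w s
  | le a b => a.eval w s ≤ b.eval w s
  | eq a b => a.eval w s = b.eval w s
  | ne a b => a.eval w s ≠ b.eval w s

/-- Programs, with structured control flow. -/
inductive Program
  | skip
  | instr (i : Instr)
  | seq (p q : Program)
  | ite (c : Test) (p q : Program)
  | while (c : Test) (p : Program)

/-- `Runs w p s t s'`: on a machine with word size `w`, the program `p` started in the
configuration `s` halts in the configuration `s'` after exactly `t` steps. Every `skip`,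
every instruction and every evaluation of a test is one step. -/
inductive Runs (w : ℕ) : Program → State → ℕ → State → Prop
  | skip (s : State) : Runs w .skip s 1 s
  | instr (i : Instr) (s : State) : Runs w (.instr i) s 1 (i.exec w s)
  | seq {p q : Program} {s s₁ s₂ : State} {t₁ t₂ : ℕ} :
      Runs w p s t₁ s₁ → Runs w q s₁ t₂ s₂ → Runs w (.seq p q) s (t₁ + t₂) s₂
  | ite_true {c : Test} {p q : Program} {s s₁ : State} {t : ℕ} :
      c.holds w s → Runs w p s t s₁ → Runs w (.ite c p q) s (1 + t) s₁
  | ite_false {c : Test} {p q : Program} {s s₁ : State} {t : ℕ} :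
      ¬ c.holds w s → Runs w q s t s₁ → Runs w (.ite c p q) s (1 + t) s₁
  | while_true {c : Test} {p : Program} {s s₁ s₂ : State} {t₁ t₂ : ℕ} :
      c.holds w s → Runs w p s t₁ s₁ → Runs w (.while c p) s₁ t₂ s₂ →
        Runs w (.while c p) s (1 + t₁ + t₂) s₂
  | while_false {c : Test} {p : Program} {s : State} :
      ¬ c.holds w s → Runs w (.while c p) s 1 s

/-- The initial configuration for the input `π`: the size `n` is in register `0`, the one-line
notation of `π` is in the memory cells `0, …, n - 1`, and everything else is zero. -/
def inputState {n : ℕ} (π : Equiv.Perm (Fin n)) : State where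
  reg := fun r => if r = 0 then n else 0
  mem := fun a => if h : a < n then (π ⟨a, h⟩ : ℕ) else 0

/-- The memory cell that holds the coordinate `τ` of an output vector indexed by the permutations
of size `k`: the number whose base-`k` digits are `τ 0, …, τ (k - 1)`, least significant first. -/
def outputCell {k : ℕ} (τ : Equiv.Perm (Fin k)) : ℕ :=
  ∑ j : Fin k, (τ j : ℕ) * k ^ (j : ℕ)

end WordRAM

/-- `T` is `Õ(f)`: it is `O(f(n) (log n) ^ d)` as `n → ∞`, for some exponent `d`. -/
def IsSoftO (T : ℕ → ℕ) (f : ℕ → ℝ) : Prop :=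
  ∃ d : ℕ, (fun n => (T n : ℝ)) =O[atTop] fun n => f n * Real.log n ^ d

/-- The `k`-profile of an `n`-element permutation can be computed in time `Õ(f n)`: there is one
word-RAM program that does so for all `n`, all `n`-element permutations and every word size of at
least `c (⌊log₂ n⌋ + 1)` bits, where `c` is a constant. -/
def ProfileComputableInTime (k : ℕ) (f : ℕ → ℝ) : Prop :=
  ∃ (p : WordRAM.Program) (c : ℕ) (T : ℕ → ℕ), 0 < c ∧ IsSoftO T f ∧
    ∀ (n : ℕ) (π : Equiv.Perm (Fin n)) (w : ℕ), c * (Nat.log 2 n + 1) ≤ w →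
      ∃ (t : ℕ) (s : WordRAM.State), t ≤ T n ∧
        WordRAM.Runs w p (WordRAM.inputState π) t s ∧
        ∀ τ : Equiv.Perm (Fin k), s.mem (WordRAM.outputCell τ) = profile k π τ

namespace WordRAM

/-! ### Partial total correctness with a time bound -/

/-- The program `p`, started in `s`, halts within `T` steps in a configuration satisfying `Q`. -/
def Halts (w : ℕ) (p : Program) (s : State) (T : ℕ) (Q : State → Prop) : Prop :=
  ∃ t s', t ≤ T ∧ Runs w p s t s' ∧ Q s'

theorem Halts.mono {w p s T T'} {Q Q' : State → Prop} (h : Halts w p s T Q) (hT : T ≤ T')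
    (hQ : ∀ s, Q s → Q' s) : Halts w p s T' Q' := by
  obtain ⟨t, s', ht, hr, hq⟩ := h
  exact ⟨t, s', ht.trans hT, hr, hQ _ hq⟩

theorem Halts.instr {w i s} {Q : State → Prop} (h : Q (i.exec w s)) :
    Halts w (.instr i) s 1 Q :=
  ⟨1, _, le_rfl, .instr i s, h⟩

theorem Halts.seq {w p q s T₁ T₂} {Q R : State → Prop} (hp : Halts w p s T₁ R)
    (hq : ∀ s', R s' → Halts w q s' T₂ Q) : Halts w (.seq p q) s (T₁ + T₂) Q := by
  obtain ⟨t, s', ht, hr, h⟩ := hp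
  obtain ⟨t', s'', ht', hr', h'⟩ := hq s' h
  exact ⟨t + t', s'', by omega, .seq hr hr', h'⟩

theorem Halts.ite {w c p q s T₁ T₂} {Q : State → Prop}
    (hp : c.holds w s → Halts w p s T₁ Q) (hq : ¬ c.holds w s → Halts w q s T₂ Q) :
    Halts w (.ite c p q) s (1 + T₁ + T₂) Q := by
  by_cases hc : c.holds w s
  · obtain ⟨t, s', ht, hr, h⟩ := hp hc
    exact ⟨1 + t, s', by omega, .ite_true hc hr, h⟩
  · obtain ⟨t, s', ht, hr, h⟩ := hq hc
    exact ⟨1 + t, s', by omega, .ite_false hc hr, h⟩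

/-- The rule for a counting loop with `N` rounds and invariant `I`. -/
theorem Halts.while_count {w c p T} (N : ℕ) {I : ℕ → State → Prop}
    (hI : ∀ i < N, ∀ s, I i s → c.holds w s ∧ Halts w p s T (I (i + 1)))
    (hN : ∀ s, I N s → ¬ c.holds w s) :
    ∀ d i, i + d = N → ∀ s, I i s → Halts w (.while c p) s (d * (T + 1) + 1) (I N) := by
  intro d
  induction d with
  | zero =>
    intro i hi s hs
    obtain rfl : i = N := by omega
    exact ⟨1, s, by omega, .while_false (hN s hs), hs⟩
  | succ d ih =>
    intro i hi s hs
    obtain ⟨hc, t, s', ht, hr, h⟩ := hI i (by omega) s hs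
    obtain ⟨t', s'', ht', hr', h'⟩ := ih (i + 1) (by omega) s' h
    exact ⟨1 + t + t', s'', by rw [Nat.succ_mul]; omega, .while_true hc hr hr', h'⟩

/-! ### A language of expressions and array programs

Arrays are interleaved: entry `i` of array `k` is the memory cell `2 ^ κ * i + k`, with `k < 2 ^ κ`.
Registers are split into parameters, loop variables and temporaries. -/

/-- Expressions. `ite a b x y` is `x` if `a < b` and `y` otherwise; `sum r j e` is the sum of `e`
over all values of the variable `r` below the parameter `j`. -/
inductive Ex
  | lit (c : ℕ)
  | var (r : ℕ)
  | par (j : ℕ)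
  | op (o : BinOp) (a b : Ex)
  | rd (k : ℕ) (i : Ex)
  | ite (a b x y : Ex)
  | sum (r j : ℕ) (e : Ex)

/-- The value of an expression on a machine with word size `w`. -/
def Ex.eval (w κ : ℕ) (P : ℕ → ℕ) (A : ℕ → ℕ → ℕ) : (ℕ → ℕ) → Ex → ℕ
  | _, lit c => c % 2 ^ w
  | V, var r => V r
  | _, par j => P j
  | V, op o a b => o.eval w (a.eval w κ P A V) (b.eval w κ P A V)
  | V, rd k i => A k (i.eval w κ P A V % 2 ^ (w - κ))
  | V, ite a b x y =>
      if a.eval w κ P A V < b.eval w κ P A V then x.eval w κ P A V else y.eval w κ P A V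
  | V, sum r j e => (∑ i ∈ Finset.range (P j), e.eval w κ P A (Function.update V r i)) % 2 ^ w

/-- All arrays that an expression reads satisfy `R`. -/
def Ex.Reads (R : ℕ → Prop) : Ex → Prop
  | lit _ | var _ | par _ => True
  | op _ a b => a.Reads R ∧ b.Reads R
  | rd k i => R k ∧ i.Reads R
  | ite a b x y => a.Reads R ∧ b.Reads R ∧ x.Reads R ∧ y.Reads R
  | sum _ _ e => e.Reads R

/-- A bound for the time to evaluate an expression. -/
def Ex.cost (P : ℕ → ℕ) : Ex → ℕ
  | lit _ | var _ | par _ => 1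
  | op _ a b => a.cost P + b.cost P + 1
  | rd _ i => i.cost P + 3
  | ite a b x y => a.cost P + b.cost P + (1 + x.cost P + y.cost P)
  | sum _ j e => P j * (e.cost P + 3) + 5

/-- The register of a parameter. -/
abbrev pReg (j : ℕ) : ℕ := 3 * j
/-- The register of a variable. -/
abbrev vReg (r : ℕ) : ℕ := 3 * r + 1
/-- The register of a temporary. -/
abbrev tReg (d : ℕ) : ℕ := 3 * d + 2

/-- The loop over the values of the variable `r` below the parameter `j`, with the temporary `d`
for the old value of `r`. -/
def forLoop (r j d : ℕ) (body : Program) : Program :=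
  .seq (.instr (.set (tReg d) (.reg (vReg r)))) <|
  .seq (.instr (.set (vReg r) (.const 0))) <|
  .seq (.while (.lt (.reg (vReg r)) (.reg (pReg j))) <|
    .seq body (.instr (.op .add (vReg r) (.reg (vReg r)) (.const 1)))) <|
  .instr (.set (vReg r) (.reg (tReg d)))

/-- Code that evaluates an expression to the temporary `d`, with the help of later temporaries. -/
def Ex.compile (κ : ℕ) : ℕ → Ex → Program
  | d, lit c => .instr (.set (tReg d) (.const c))
  | d, var r => .instr (.set (tReg d) (.reg (vReg r)))
  | d, par j => .instr (.set (tReg d) (.reg (pReg j)))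
  | d, op o a b =>
      .seq (a.compile κ d) <| .seq (b.compile κ (d + 1)) <|
        .instr (.op o (tReg d) (.reg (tReg d)) (.reg (tReg (d + 1))))
  | d, rd k i =>
      .seq (i.compile κ d) <|
      .seq (.instr (.op .mul (tReg d) (.reg (tReg d)) (.const (2 ^ κ)))) <|
      .seq (.instr (.op .add (tReg d) (.reg (tReg d)) (.const k))) <|
      .instr (.load (tReg d) (.reg (tReg d)))
  | d, ite a b x y =>
      .seq (a.compile κ d) <| .seq (b.compile κ (d + 1)) <|
        .ite (.lt (.reg (tReg d)) (.reg (tReg (d + 1)))) (x.compile κ d) (y.compile κ d)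
  | d, sum r j e =>
      .seq (.instr (.set (tReg d) (.const 0))) <|
      forLoop r j (d + 1) <|
        .seq (e.compile κ (d + 2)) <|
        .instr (.op .add (tReg d) (.reg (tReg d)) (.reg (tReg (d + 2))))

/-- The configuration `s` represents parameters, arrays and variables. -/
structure Rep (w κ : ℕ) (P : ℕ → ℕ) (A : ℕ → ℕ → ℕ) (V : ℕ → ℕ) (s : State) : Prop where
  mem : ∀ k < 2 ^ κ, ∀ i < 2 ^ (w - κ), s.mem (2 ^ κ * i + k) = A k i
  par : ∀ j, s.reg (pReg j) = P j
  var : ∀ r, s.reg (vReg r) = V r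

theorem address_eq {w κ k x : ℕ} (hκ : κ ≤ w) (hk : k < 2 ^ κ) :
    (x * (2 ^ κ % 2 ^ w) % 2 ^ w + k % 2 ^ w) % 2 ^ w = 2 ^ κ * (x % 2 ^ (w - κ)) + k := by
  have hw : 2 ^ w = 2 ^ κ * 2 ^ (w - κ) := by rw [← pow_add]; congr 1; omega
  rw [Nat.mul_mod_mod, Nat.mod_add_mod, Nat.add_mod_mod, hw, Nat.mod_mul,
    Nat.mul_comm x, Nat.mul_add_mod, Nat.mod_eq_of_lt hk, Nat.mul_add_div (by positivity),
    Nat.div_eq_of_lt hk, add_zero, add_comm]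

theorem Rep.update_temp {w κ P A V s} (h : Rep w κ P A V s) (d x : ℕ) :
    Rep w κ P A V { s with reg := Function.update s.reg (tReg d) x } := by
  refine ⟨h.mem, fun j => ?_, fun r => ?_⟩
  · rw [← h.par j]; exact Function.update_of_ne (by simp only [tReg, pReg]; omega) _ _
  · rw [← h.var r]; exact Function.update_of_ne (by simp only [tReg, vReg]; omega) _ _

theorem Rep.update_var {w κ P A V s} (h : Rep w κ P A V s) (r x : ℕ) :
    Rep w κ P A (Function.update V r x) { s with reg := Function.update s.reg (vReg r) x } := by
  refine ⟨h.mem, fun j => ?_, fun r' => ?_⟩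
  · rw [← h.par j]; exact Function.update_of_ne (by simp only [vReg, pReg]; omega) _ _
  · by_cases hr : r' = r
    · subst hr; simp
    · rw [Function.update_of_ne hr, ← h.var r']
      exact Function.update_of_ne (by simp only [vReg]; omega) _ _

/-- The temporaries below `d` agree. -/
def TempsEq (d : ℕ) (s s' : State) : Prop := ∀ d' < d, s'.reg (tReg d') = s.reg (tReg d')

theorem TempsEq.trans {d s s' s''} (h : TempsEq d s s') (h' : TempsEq d s' s'') :
    TempsEq d s s'' := fun d' hd => (h' d' hd).trans (h d' hd)

theorem TempsEq.mono {d d' s s'} (h : TempsEq d s s') (hd : d' ≤ d) : TempsEq d' s s' :=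
  fun e he => h e (he.trans_le hd)

theorem TempsEq.refl (d s) : TempsEq d s s := fun _ _ => rfl

theorem TempsEq.update_temp {d s s'} (h : TempsEq d s s') {e : ℕ} (he : d ≤ e) (x : ℕ) :
    TempsEq d s { s' with reg := Function.update s'.reg (tReg e) x } := fun d' hd =>
  (Function.update_of_ne (by simp only [tReg]; omega) _ _).trans (h d' hd)

theorem TempsEq.update_var {d s s'} (h : TempsEq d s s') (r x : ℕ) :
    TempsEq d s { s' with reg := Function.update s'.reg (vReg r) x } := fun d' hd =>
  (Function.update_of_ne (by simp only [tReg, vReg]; omega) _ _).trans (h d' hd)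

/-- The rule for `forLoop`: the state is described by an invariant `I` on the memory. -/
theorem Halts.forLoop {w κ r j d e T} {body : Program} {P V : ℕ → ℕ} {A : ℕ → ℕ → ℕ → ℕ} {s : State}
    (I : ℕ → State → Prop) (hP : P j < 2 ^ w) (hs : Rep w κ P (A 0) V s)
    (he : e ≤ d)
    (hI0 : ∀ s', Rep w κ P (A 0) (Function.update V r 0) s' → s'.mem = s.mem → TempsEq d s s' →
      I 0 s')
    (hI : ∀ i < P j, ∀ s', Rep w κ P (A i) (Function.update V r i) s' → I i s' →
      Halts w body s' T fun s'' =>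
        Rep w κ P (A (i + 1)) (Function.update V r i) s'' ∧ TempsEq e s' s'' ∧
        s''.reg (tReg d) = s'.reg (tReg d) ∧
        (∀ x, I (i + 1) { s'' with reg := Function.update s''.reg (vReg r) x })) :
    Halts w (forLoop r j d body) s (P j * (T + 2) + 4) fun s' =>
      Rep w κ P (A (P j)) V s' ∧ TempsEq e s s' ∧
        ∃ s'' x, I (P j) s'' ∧ s' = { s'' with reg := Function.update s''.reg (vReg r) x } := by
  set s₁ : State := { s with reg := Function.update s.reg (tReg d) (s.reg (vReg r)) } with h₁
  set s₂ : State := { s₁ with reg := Function.update s₁.reg (vReg r) 0 } with h₂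
  have hr₂ : Rep w κ P (A 0) (Function.update V r 0) s₂ := (hs.update_temp d _).update_var r 0
  have ht₂ : TempsEq d s s₂ := ((TempsEq.refl d s).update_temp le_rfl _).update_var r 0
  have hd₂ : s₂.reg (tReg d) = V r := by
    rw [h₂, h₁, ← hs.var r]
    simp only
    rw [Function.update_of_ne (by simp only [tReg, vReg]; omega), Function.update_self]
  let J : ℕ → State → Prop := fun i s' =>
    Rep w κ P (A i) (Function.update V r i) s' ∧ TempsEq e s s' ∧ s'.reg (tReg d) = V r ∧ I i s'
  have hw : 1 < 2 ^ w ∨ P j = 0 := by omega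
  have hloop := Halts.while_count (w := w)
    (c := .lt (.reg (vReg r)) (.reg (pReg j)))
    (p := .seq body (.instr (.op .add (vReg r) (.reg (vReg r)) (.const 1))))
    (T := T + 1) (P j) (I := J) (fun i hi s' hJ => by
      obtain ⟨hr, ht, hd, hIi⟩ := hJ
      refine ⟨?_, ?_⟩
      · simp only [Test.holds, Operand.eval, hr.par, hr.var, Function.update_self]
        exact hi
      · refine Halts.seq (hI i hi s' hr hIi) fun s'' ⟨hr'', ht'', hd'', hI''⟩ => Halts.instr ?_
        have hw' : 1 < 2 ^ w := by omega
        have hv : (Instr.op .add (vReg r) (.reg (vReg r)) (.const 1)).exec w s'' =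
            { s'' with reg := Function.update s''.reg (vReg r) (i + 1) } := by
          simp only [Instr.exec, Operand.eval, BinOp.eval, hr''.var, Function.update_self,
            Nat.mod_eq_of_lt hw']
          rw [Nat.mod_eq_of_lt (by omega)]
        rw [hv]
        refine ⟨?_, ?_, ?_, hI'' _⟩
        · have := hr''.update_var r (i + 1)
          rwa [Function.update_idem] at this
        · exact (ht.trans ht'').update_var r _
        · simp only
          rw [Function.update_of_ne (by simp only [tReg, vReg]; omega), hd'', hd])
    (fun s' hJ => by
      simp only [Test.holds, Operand.eval, hJ.1.par, hJ.1.var, Function.update_self]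
      omega)
    (P j) 0 (by omega) s₂ ⟨hr₂, ht₂.mono he, hd₂, hI0 s₂ hr₂ rfl ht₂⟩
  have hset : (Instr.set (vReg r) (.const 0)).exec w s₁ = s₂ := by
    simp [Instr.exec, Operand.eval, h₂]
  refine Halts.mono (T := 1 + (1 + ((P j * (T + 1 + 1) + 1) + 1))) ?_
    (by rw [show T + 1 + 1 = T + 2 from rfl]; omega) fun _ h => h
  refine Halts.seq (R := fun s' => s' = s₁) (Halts.instr (by simp [Instr.exec, Operand.eval, h₁]))
    fun s' hs' => ?_
  subst hs'
  refine Halts.seq (R := fun s' => s' = s₂) (Halts.instr hset) fun s' hs' => ?_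
  subst hs'
  refine Halts.seq hloop fun s' hJ => Halts.instr ?_
  obtain ⟨hr, ht, hd, hIi⟩ := hJ
  refine ⟨?_, ht.update_var r _, s', _, hIi, rfl⟩
  have := hr.update_var r (s'.reg (tReg d))
  rw [Function.update_idem, hd, Function.update_eq_self] at this
  simp only [Instr.exec, Operand.eval]
  rwa [hd]

theorem Ex.compile_halts {w κ : ℕ} {P : ℕ → ℕ} (hκ : κ ≤ w) (hP : ∀ j, P j < 2 ^ w)
    (A : ℕ → ℕ → ℕ) (e : Ex) (he : e.Reads (· < 2 ^ κ)) :
    ∀ (d : ℕ) (V : ℕ → ℕ) (s : State), Rep w κ P A V s →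
      Halts w (e.compile κ d) s (e.cost P) fun s' =>
        Rep w κ P A V s' ∧ s'.mem = s.mem ∧ TempsEq d s s' ∧
          s'.reg (tReg d) = e.eval w κ P A V := by
  induction e with
  | lit c =>
    intro d V s hs
    refine Halts.instr ⟨hs.update_temp d _, rfl, (TempsEq.refl d s).update_temp le_rfl _, ?_⟩
    simp [Instr.exec, Operand.eval, Ex.eval]
  | var r =>
    intro d V s hs
    refine Halts.instr ⟨hs.update_temp d _, rfl, (TempsEq.refl d s).update_temp le_rfl _, ?_⟩
    simp only [Instr.exec, Operand.eval, Ex.eval, Function.update_self, hs.var]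
  | par j =>
    intro d V s hs
    refine Halts.instr ⟨hs.update_temp d _, rfl, (TempsEq.refl d s).update_temp le_rfl _, ?_⟩
    simp only [Instr.exec, Operand.eval, Ex.eval, Function.update_self, hs.par]
  | op o a b iha ihb =>
    intro d V s hs
    refine Halts.mono (T := a.cost P + (b.cost P + 1)) ?_ (by simp only [Ex.cost]; omega)
      fun _ h => h
    refine Halts.seq (iha he.1 d V s hs) fun s₁ ⟨h₁, m₁, t₁, v₁⟩ => ?_
    refine Halts.seq (ihb he.2 (d + 1) V s₁ h₁) fun s₂ ⟨h₂, m₂, t₂, v₂⟩ => Halts.instr ?_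
    refine ⟨h₂.update_temp d _, m₂.trans m₁,
      (t₁.trans (t₂.mono (by omega))).update_temp le_rfl _, ?_⟩
    simp only [Instr.exec, Operand.eval, Ex.eval, Function.update_self, v₂, t₂ d (by omega), v₁]
  | rd k i ih =>
    intro d V s hs
    refine Halts.mono (T := i.cost P + (1 + (1 + 1))) ?_ (by simp only [Ex.cost]; omega)
      fun _ h => h
    refine Halts.seq (ih he.2 d V s hs) fun s₁ ⟨h₁, m₁, t₁, v₁⟩ => ?_
    refine Halts.seq (R := fun s' => s' = _) (Halts.instr rfl) fun s₂ e₂ => ?_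
    refine Halts.seq (R := fun s' => s' = _) (Halts.instr rfl) fun s₃ e₃ => Halts.instr ?_
    subst e₃ e₂
    refine ⟨((h₁.update_temp d _).update_temp d _).update_temp d _, m₁,
      ((t₁.update_temp le_rfl _).update_temp le_rfl _).update_temp le_rfl _, ?_⟩
    simp only [Instr.exec, Operand.eval, Ex.eval, Function.update_self, v₁, BinOp.eval]
    rw [address_eq hκ he.1, h₁.mem k he.1 _ (Nat.mod_lt _ (by positivity))]
  | ite a b x y iha ihb ihx ihy =>
    intro d V s hs
    obtain ⟨hea, heb, hex, hey⟩ := he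
    refine Halts.mono (T := a.cost P + (b.cost P + (1 + x.cost P + y.cost P))) ?_
      (by simp only [Ex.cost]; omega) fun _ h => h
    refine Halts.seq (iha hea d V s hs) fun s₁ ⟨h₁, m₁, t₁, v₁⟩ => ?_
    refine Halts.seq (ihb heb (d + 1) V s₁ h₁) fun s₂ ⟨h₂, m₂, t₂, v₂⟩ => ?_
    have hv := t₂ d (by omega)
    rw [v₁] at hv
    have t₃ := t₁.trans (t₂.mono (Nat.le_succ d))
    refine Halts.ite (fun hc => ?_) (fun hc => ?_)
    · simp only [Test.holds, Operand.eval, hv, v₂] at hc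
      refine (ihx hex d V s₂ h₂).mono le_rfl fun s₃ ⟨h₃, m₃, t₄, v₃⟩ =>
        ⟨h₃, m₃.trans (m₂.trans m₁), t₃.trans t₄, ?_⟩
      rw [v₃, Ex.eval, if_pos hc]
    · simp only [Test.holds, Operand.eval, hv, v₂] at hc
      refine (ihy hey d V s₂ h₂).mono le_rfl fun s₃ ⟨h₃, m₃, t₄, v₃⟩ =>
        ⟨h₃, m₃.trans (m₂.trans m₁), t₃.trans t₄, ?_⟩
      rw [v₃, Ex.eval, if_neg hc]
  | sum r j e ih =>
    intro d V s hs
    refine Halts.mono (T := 1 + (P j * (e.cost P + 1 + 2) + 4)) ?_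
      (by rw [Ex.cost, show e.cost P + 1 + 2 = e.cost P + 3 from rfl]; omega) fun _ h => h
    refine Halts.seq (R := fun s' => s' = _) (Halts.instr rfl) fun s₁ e₁ => ?_
    have h₁ : Rep w κ P A V s₁ := by subst e₁; exact hs.update_temp d _
    have t₁ : TempsEq d s s₁ := by subst e₁; exact (TempsEq.refl d s).update_temp le_rfl _
    have m₁ : s₁.mem = s.mem := by subst e₁; rfl
    have v₁ : s₁.reg (tReg d) = 0 := by subst e₁; simp [Instr.exec, Operand.eval]
    refine (Halts.forLoop (e := d) (A := fun _ => A) (fun i s' => s'.mem = s.mem ∧ TempsEq d s s' ∧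
      s'.reg (tReg d) =
        (∑ i ∈ Finset.range i, e.eval w κ P A (Function.update V r i)) % 2 ^ w) (hP j) h₁ (by omega)
      (fun s' _ hm ht => ⟨hm.trans m₁, t₁.trans (ht.mono (by omega)), by
        rw [ht d (by omega), v₁]; simp⟩) fun i hi s' hr' hI' => ?_).mono le_rfl ?_
    · refine Halts.seq (ih he (d + 2) _ s' hr') fun s₂ ⟨h₂, m₂, t₂, v₂⟩ => Halts.instr ?_
      refine ⟨h₂.update_temp d _, (t₂.mono (by omega)).update_temp le_rfl _, ?_,
        fun x => ⟨m₂.trans hI'.1, ?_, ?_⟩⟩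
      · simp only [Instr.exec]
        rw [Function.update_of_ne (by simp only [tReg]; omega), t₂ (d + 1) (by omega)]
      · exact ((hI'.2.1.trans (t₂.mono (by omega))).update_temp le_rfl _).update_var r x
      · simp only [Instr.exec, Operand.eval, BinOp.eval]
        rw [Function.update_of_ne (by simp only [tReg, vReg]; omega), Function.update_self, v₂,
          t₂ d (by omega), hI'.2.2, Finset.sum_range_succ, Nat.mod_add_mod]
    · rintro s' ⟨hr, ht, s'', x, ⟨hm, ht'', hv⟩, rfl⟩
      refine ⟨hr, hm, ht''.update_var r x, ?_⟩
      simp only [Ex.eval]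
      rw [Function.update_of_ne (by simp only [tReg, vReg]; omega), hv]

/-- Array programs: `store k i e` writes `e` to entry `i` of array `k`, and `loop r j b` executes
`b` for all values of the variable `r` below the parameter `j`. -/
inductive St
  | skip
  | store (k : ℕ) (i e : Ex)
  | seq (a b : St)
  | loop (r j : ℕ) (b : St)

/-- Iterate the functions `f 0, …, f (n - 1)`. -/
def iter {α : Type*} (f : ℕ → α → α) : ℕ → α → α
  | 0, a => a
  | n + 1, a => f n (iter f n a)

/-- The effect of an array program on the arrays. -/
def St.exec (w κ : ℕ) (P : ℕ → ℕ) : (ℕ → ℕ) → St → (ℕ → ℕ → ℕ) → (ℕ → ℕ → ℕ)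
  | _, skip, A => A
  | V, store k i e, A =>
      Function.update A k (Function.update (A k) (i.eval w κ P A V % 2 ^ (w - κ))
        (e.eval w κ P A V))
  | V, seq a b, A => b.exec w κ P V (a.exec w κ P V A)
  | V, loop r j b, A => iter (fun i A => b.exec w κ P (Function.update V r i) A) (P j) A

/-- All arrays that a program mentions satisfy `R`. -/
def St.Uses (R : ℕ → Prop) : St → Prop
  | skip => True
  | store k i e => R k ∧ i.Reads R ∧ e.Reads R
  | seq a b => a.Uses R ∧ b.Uses R
  | loop _ _ b => b.Uses R

/-- All arrays that a program writes satisfy `R`. -/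
def St.Writes (R : ℕ → Prop) : St → Prop
  | skip => True
  | store k _ _ => R k
  | seq a b => a.Writes R ∧ b.Writes R
  | loop _ _ b => b.Writes R

/-- A bound for the running time of an array program. -/
def St.cost (P : ℕ → ℕ) : St → ℕ
  | skip => 1
  | store _ i e => i.cost P + e.cost P + 3
  | seq a b => a.cost P + b.cost P
  | loop _ j b => P j * (b.cost P + 2) + 4

/-- Code for an array program. -/
def St.compile (κ : ℕ) : ℕ → St → Program
  | _, skip => .skip
  | d, store k i e =>
      .seq (i.compile κ d) <|
      .seq (.instr (.op .mul (tReg d) (.reg (tReg d)) (.const (2 ^ κ)))) <|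
      .seq (.instr (.op .add (tReg d) (.reg (tReg d)) (.const k))) <|
      .seq (e.compile κ (d + 1)) <|
      .instr (.store (.reg (tReg d)) (.reg (tReg (d + 1))))
  | d, seq a b => .seq (a.compile κ d) (b.compile κ d)
  | d, loop r j b => forLoop r j d (b.compile κ (d + 1))

theorem Rep.store {w κ P A V s} (h : Rep w κ P A V s) {k i : ℕ} (hk : k < 2 ^ κ) (x : ℕ) :
    Rep w κ P (Function.update A k (Function.update (A k) i x)) V
      { s with mem := Function.update s.mem (2 ^ κ * i + k) x } := by
  refine ⟨fun k' hk' i' hi' => ?_, h.par, h.var⟩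
  have hinj : 2 ^ κ * i' + k' = 2 ^ κ * i + k ↔ k' = k ∧ i' = i := by
    refine ⟨fun he => ?_, fun ⟨h₁, h₂⟩ => by rw [h₁, h₂]⟩
    have h₁ := congrArg (· % 2 ^ κ) he
    have h₂ := congrArg (· / 2 ^ κ) he
    simp only [Nat.mul_add_mod, Nat.mod_eq_of_lt hk, Nat.mod_eq_of_lt hk'] at h₁
    simp only [Nat.mul_add_div (Nat.two_pow_pos κ), Nat.div_eq_of_lt hk,
      Nat.div_eq_of_lt hk'] at h₂
    omega
  simp only [Function.update_apply, hinj]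
  by_cases h₁ : k' = k
  · subst h₁
    by_cases h₂ : i' = i
    · simp [h₂]
    · simp [h₂, h.mem k' hk' i' hi']
  · simp [h₁, h.mem k' hk' i' hi']

theorem St.compile_halts {w κ : ℕ} {P : ℕ → ℕ} (hκ : κ ≤ w) (hP : ∀ j, P j < 2 ^ w) (b : St)
    (hb : b.Uses (· < 2 ^ κ)) :
    ∀ (d : ℕ) (A : ℕ → ℕ → ℕ) (V : ℕ → ℕ) (s : State), Rep w κ P A V s →
      Halts w (b.compile κ d) s (b.cost P) fun s' =>
        Rep w κ P (b.exec w κ P V A) V s' ∧ TempsEq d s s' := by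
  induction b with
  | skip => exact fun d A V s hs => ⟨1, s, le_rfl, .skip s, hs, TempsEq.refl d s⟩
  | seq a b iha ihb =>
    intro d A V s hs
    refine Halts.seq (iha hb.1 d A V s hs) fun s₁ ⟨h₁, t₁⟩ => ?_
    exact (ihb hb.2 d _ V s₁ h₁).mono le_rfl fun s₂ ⟨h₂, t₂⟩ => ⟨h₂, t₁.trans t₂⟩
  | store k i e =>
    intro d A V s hs
    obtain ⟨hk, hi, he⟩ := hb
    refine Halts.mono (T := i.cost P + (1 + (1 + (e.cost P + 1)))) ?_
      (by simp only [St.cost]; omega) fun _ h => h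
    refine Halts.seq (i.compile_halts hκ hP A hi d V s hs) fun s₁ ⟨h₁, m₁, t₁, v₁⟩ => ?_
    refine Halts.seq (R := fun s' => s' = _) (Halts.instr rfl) fun s₂ e₂ => ?_
    refine Halts.seq (R := fun s' => s' = _) (Halts.instr rfl) fun s₃ e₃ => ?_
    have h₃ : Rep w κ P A V s₃ := by subst e₃ e₂; exact (h₁.update_temp d _).update_temp d _
    have t₃ : TempsEq d s s₃ := by
      subst e₃ e₂; exact (t₁.update_temp le_rfl _).update_temp le_rfl _
    have v₃ : s₃.reg (tReg d) = 2 ^ κ * (i.eval w κ P A V % 2 ^ (w - κ)) + k := by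
      subst e₃ e₂
      simp only [Instr.exec, Operand.eval, Function.update_self, v₁, BinOp.eval]
      exact address_eq hκ hk
    refine Halts.seq (e.compile_halts hκ hP A he (d + 1) V s₃ h₃)
      fun s₄ ⟨h₄, m₄, t₄, v₄⟩ => Halts.instr ?_
    simp only [Instr.exec, Operand.eval, v₄, t₄ d (by omega), v₃]
    exact ⟨h₄.store hk _, t₃.trans (t₄.mono (by omega))⟩
  | loop r j b ih =>
    intro d A V s hs
    refine (Halts.forLoop (e := d)
      (A := fun n => iter (fun i A => b.exec w κ P (Function.update V r i) A) n A)
      (fun _ _ => True) (hP j) hs le_rfl (fun _ _ _ _ => trivial) fun i hi s' hr' _ =>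
        (ih hb (d + 1) _ _ s' hr').mono le_rfl fun s'' ⟨hr'', t''⟩ =>
          ⟨hr'', t''.mono (by omega), t'' d (by omega), fun _ => trivial⟩).mono le_rfl ?_
    rintro s' ⟨hr, ht, -⟩
    exact ⟨hr, ht⟩

/-! ### Evaluation lemmas -/

theorem BinOp.eval_lt (w : ℕ) (o : BinOp) (x y : ℕ) : o.eval w x y < 2 ^ w := by
  cases o <;> exact Nat.mod_lt _ (by positivity)

theorem Ex.eval_congr {w κ P} {A A' : ℕ → ℕ → ℕ} (e : Ex) (he : e.Reads fun k => A k = A' k) :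
    ∀ V, e.eval w κ P A V = e.eval w κ P A' V := by
  induction e with
  | lit _ | var _ | par _ => exact fun V => rfl
  | op o a b iha ihb => intro V; simp only [Ex.eval, iha he.1, ihb he.2]
  | rd k i ih => intro V; simp only [Ex.eval, ih he.2, he.1]
  | ite a b x y iha ihb ihx ihy =>
    intro V; simp only [Ex.eval, iha he.1, ihb he.2.1, ihx he.2.2.1, ihy he.2.2.2]
  | sum r j e ih => intro V; simp only [Ex.eval, ih he]

theorem Ex.Reads.mono {R R' : ℕ → Prop} {e : Ex} (h : e.Reads R) (hR : ∀ k, R k → R' k) :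
    e.Reads R' := by
  induction e with
  | lit _ | var _ | par _ => trivial
  | op o a b iha ihb => exact ⟨iha h.1, ihb h.2⟩
  | rd k i ih => exact ⟨hR _ h.1, ih h.2⟩
  | ite a b x y iha ihb ihx ihy => exact ⟨iha h.1, ihb h.2.1, ihx h.2.2.1, ihy h.2.2.2⟩
  | sum r j e ih => exact ih h

theorem iter_apply_of_forall {f : ℕ → (ℕ → ℕ → ℕ) → (ℕ → ℕ → ℕ)} {k : ℕ}
    (hf : ∀ i A, f i A k = A k) (n : ℕ) (A : ℕ → ℕ → ℕ) : iter f n A k = A k := by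
  induction n with
  | zero => rfl
  | succ n ih => rw [iter, hf, ih]

theorem St.exec_of_writes {w κ P} {k : ℕ} (b : St) (hb : b.Writes (· ≠ k)) :
    ∀ V A, b.exec w κ P V A k = A k := by
  induction b with
  | skip => exact fun V A => rfl
  | store k' i e => exact fun V A => Function.update_of_ne (Ne.symm hb) _ _
  | seq a b iha ihb => intro V A; rw [St.exec, ihb hb.2, iha hb.1]
  | loop r j b ih =>
    intro V A
    exact iter_apply_of_forall (fun i A => ih hb _ A) _ A

theorem St.Writes.mono {R R' : ℕ → Prop} {b : St} (h : b.Writes R) (hR : ∀ k, R k → R' k) :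
    b.Writes R' := by
  induction b with
  | skip => trivial
  | store k i e => exact hR _ h
  | seq a b iha ihb => exact ⟨iha h.1, ihb h.2⟩
  | loop r j b ih => exact ih h

/-- The program that stores the value of `e`, as a function of the variable `0`, in array `k`. -/
def St.table (k j : ℕ) (e : Ex) : St := .loop 0 j (.store k (.var 0) e)

theorem St.exec_table {w κ P V A k j e} (he : e.Reads (· ≠ k)) (hP : P j ≤ 2 ^ (w - κ)) (i : ℕ)
    (hi : i < P j) :
    (St.table k j e).exec w κ P V A k i = e.eval w κ P A (Function.update V 0 i) := by
  have key : ∀ n ≤ P j, ∀ i < n,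
      iter (fun i A => (St.store k (.var 0) e).exec w κ P (Function.update V 0 i) A) n A k i =
        e.eval w κ P A (Function.update V 0 i) := by
    intro n
    induction n with
    | zero => intro _ i hi; omega
    | succ n ih =>
      intro hn i hi
      set A' := iter (fun i A => (St.store k (.var 0) e).exec w κ P (Function.update V 0 i) A) n A
        with hA'
      have hfr : ∀ k' ≠ k, A' k' = A k' := fun k' hk' =>
        iter_apply_of_forall (fun i A => St.exec_of_writes (.store k (.var 0) e) hk'.symm _ A) n A
      have hm : n % 2 ^ (w - κ) = n := Nat.mod_eq_of_lt (by omega)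
      simp only [iter, St.exec, Ex.eval, Function.update_self, hm]
      by_cases h : i = n
      · subst h
        rw [Function.update_self]
        exact e.eval_congr (he.mono hfr) _
      · rw [Function.update_of_ne h]
        exact ih (by omega) i (by omega)
  exact key _ le_rfl i hi

instance : Add Ex := ⟨.op .add⟩
instance : Mul Ex := ⟨.op .mul⟩
instance : Div Ex := ⟨.op .div⟩

/-- Subtraction; the second operand is reduced modulo the word size. -/
def Ex.sub (a b : Ex) : Ex := .op .sub a (b + .lit 0)

instance : Sub Ex := ⟨.sub⟩

section Eval

variable {w κ : ℕ} {P : ℕ → ℕ} {A : ℕ → ℕ → ℕ} {V : ℕ → ℕ}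

theorem Ex.cast_eval_add (a b : Ex) :
    (((a + b).eval w κ P A V : ℕ) : ZMod (2 ^ w)) = a.eval w κ P A V + b.eval w κ P A V := by
  change (((a.eval w κ P A V + b.eval w κ P A V) % 2 ^ w : ℕ) : ZMod (2 ^ w)) = _
  rw [ZMod.natCast_mod, Nat.cast_add]

theorem Ex.cast_eval_mul (a b : Ex) :
    (((a * b).eval w κ P A V : ℕ) : ZMod (2 ^ w)) = a.eval w κ P A V * b.eval w κ P A V := by
  change (((a.eval w κ P A V * b.eval w κ P A V) % 2 ^ w : ℕ) : ZMod (2 ^ w)) = _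
  rw [ZMod.natCast_mod, Nat.cast_mul]

theorem Ex.cast_eval_lit (c : ℕ) : (((lit c).eval w κ P A V : ℕ) : ZMod (2 ^ w)) = c :=
  ZMod.natCast_mod _ _

theorem Ex.cast_eval_sub (a b : Ex) :
    (((a - b).eval w κ P A V : ℕ) : ZMod (2 ^ w)) = a.eval w κ P A V - b.eval w κ P A V := by
  change (((a.eval w κ P A V + 2 ^ w - (b.eval w κ P A V + 0 % 2 ^ w) % 2 ^ w) % 2 ^ w : ℕ) :
    ZMod (2 ^ w)) = _
  have h := Nat.mod_lt (b.eval w κ P A V + 0 % 2 ^ w) (Nat.two_pow_pos w)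
  rw [ZMod.natCast_mod, Nat.cast_sub (by omega), ZMod.natCast_mod, Nat.cast_add, Nat.cast_add,
    ZMod.natCast_self, ZMod.natCast_mod]
  simp

theorem Ex.cast_eval_sum (r j : ℕ) (e : Ex) :
    (((sum r j e).eval w κ P A V : ℕ) : ZMod (2 ^ w)) =
      ∑ i ∈ Finset.range (P j), (e.eval w κ P A (Function.update V r i) : ZMod (2 ^ w)) := by
  simp only [eval]
  rw [ZMod.natCast_mod, Nat.cast_sum]

theorem Ex.cast_eval_ite (a b x y : Ex) :
    (((ite a b x y).eval w κ P A V : ℕ) : ZMod (2 ^ w)) =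
      if a.eval w κ P A V < b.eval w κ P A V then (x.eval w κ P A V : ZMod (2 ^ w))
      else y.eval w κ P A V := by
  simp only [eval]
  split_ifs <;> rfl

theorem Ex.eval_add {a b : Ex} (h : a.eval w κ P A V + b.eval w κ P A V < 2 ^ w) :
    (a + b).eval w κ P A V = a.eval w κ P A V + b.eval w κ P A V := Nat.mod_eq_of_lt h

theorem Ex.eval_mul {a b : Ex} (h : a.eval w κ P A V * b.eval w κ P A V < 2 ^ w) :
    (a * b).eval w κ P A V = a.eval w κ P A V * b.eval w κ P A V := Nat.mod_eq_of_lt h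

theorem Ex.eval_div {a b : Ex} (h : a.eval w κ P A V < 2 ^ w) :
    (a / b).eval w κ P A V = a.eval w κ P A V / b.eval w κ P A V :=
  Nat.mod_eq_of_lt ((Nat.div_le_self _ _).trans_lt h)

theorem Ex.eval_sub {a b : Ex} (h : a.eval w κ P A V < 2 ^ w)
    (hb : b.eval w κ P A V ≤ a.eval w κ P A V) :
    (a - b).eval w κ P A V = a.eval w κ P A V - b.eval w κ P A V := by
  change (a.eval w κ P A V + 2 ^ w - (b.eval w κ P A V + 0 % 2 ^ w) % 2 ^ w) % 2 ^ w = _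
  rw [Nat.zero_mod, add_zero, Nat.mod_eq_of_lt (hb.trans_lt h), Nat.sub_add_comm hb,
    Nat.add_mod_right, Nat.mod_eq_of_lt (by omega)]

theorem Ex.eval_mod {a b : Ex} (h : a.eval w κ P A V < 2 ^ w) :
    (op .mod a b).eval w κ P A V = a.eval w κ P A V % b.eval w κ P A V :=
  Nat.mod_eq_of_lt ((Nat.mod_le _ _).trans_lt h)

theorem Ex.eval_shr {a b : Ex} (h : a.eval w κ P A V < 2 ^ w) :
    (op .shr a b).eval w κ P A V = a.eval w κ P A V / 2 ^ b.eval w κ P A V := by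
  change (a.eval w κ P A V >>> b.eval w κ P A V) % 2 ^ w = _
  rw [Nat.shiftRight_eq_div_pow]
  exact Nat.mod_eq_of_lt ((Nat.div_le_self _ _).trans_lt h)

theorem Ex.eval_lit {c : ℕ} (h : c < 2 ^ w) : (lit c).eval w κ P A V = c := Nat.mod_eq_of_lt h

theorem Ex.eval_rd {k : ℕ} {i : Ex} (h : i.eval w κ P A V < 2 ^ (w - κ)) :
    (rd k i).eval w κ P A V = A k (i.eval w κ P A V) := by
  rw [eval, Nat.mod_eq_of_lt h]

end Eval

theorem iter_induction {α : Type*} {f : ℕ → α → α} {N : ℕ} {a : α} (I : ℕ → α → Prop) (h0 : I 0 a)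
    (hs : ∀ i < N, ∀ b, I i b → I (i + 1) (f i b)) : I N (iter f N a) := by
  have : ∀ n ≤ N, I n (iter f n a) := by
    intro n
    induction n with
    | zero => exact fun _ => h0
    | succ n ih => exact fun hn => hs n hn _ (ih (by omega))
  exact this N le_rfl

/-! ### The sizes of an instance -/

/-- The parameters hold the sizes of an instance with `n` points, slabs of size `q` and
`n / q + 2` rows. -/
structure Sizes (w κ : ℕ) (P : ℕ → ℕ) (n q lg : ℕ) : Prop where
  p0 : P 0 = n
  p1 : P 1 = q
  p2 : P 2 = n / q + 2
  p3 : P 3 = (n / q + 2) * n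
  p4 : P 4 = n * (q + 1)
  p5 : P 5 = lg
  p6 : P 6 = n + 1
  le_two_pow : n ≤ 2 ^ lg
  q_le : q ≤ n
  q_pos : 0 < n → 0 < q
  big : (n + 2) ^ 3 ≤ 2 ^ (w - κ)

/-- `Y` is a permutation of `{0, …, n - 1}` with inverse `X`. -/
structure PermPair (n : ℕ) (Y X : ℕ → ℕ) : Prop where
  y_lt : ∀ x < n, Y x < n
  x_lt : ∀ y < n, X y < n
  xy : ∀ x < n, X (Y x) = x
  yx : ∀ y < n, Y (X y) = y

section Dyadic

theorem sum_dyadic_lt {R : Type*} [CommRing R] (lg : ℕ) : ∀ p q : ℕ, p < 2 ^ lg → q < 2 ^ lg →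
    (∑ l ∈ Finset.range lg, if 0 < p / 2 ^ l % 2 ∧ q / 2 ^ l = p / 2 ^ l - 1 then (1 : R) else 0) =
      if q < p then 1 else 0 := by
  induction lg with
  | zero => intro p q hp hq; simp at hp hq; simp [hp, hq]
  | succ lg ih =>
    intro p q hp hq
    rw [Finset.sum_range_succ']
    have h := ih (p / 2) (q / 2) (by omega) (by omega)
    simp only [Nat.div_div_eq_div_mul, ← pow_succ'] at h
    rw [h]
    simp only [pow_zero, Nat.div_one]
    split_ifs <;> first | omega | simp

theorem sum_dyadic_gt {R : Type*} [CommRing R] (lg : ℕ) : ∀ p q : ℕ, p < 2 ^ lg → q < 2 ^ lg →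
    (∑ l ∈ Finset.range lg, if p / 2 ^ l % 2 < 1 ∧ q / 2 ^ l = p / 2 ^ l + 1 then (1 : R) else 0) =
      if p < q then 1 else 0 := by
  induction lg with
  | zero => intro p q hp hq; simp at hp hq; simp [hp, hq]
  | succ lg ih =>
    intro p q hp hq
    rw [Finset.sum_range_succ']
    have h := ih (p / 2) (q / 2) (by omega) (by omega)
    simp only [Nat.div_div_eq_div_mul, ← pow_succ'] at h
    rw [h]
    simp only [pow_zero, Nat.div_one]
    split_ifs <;> first | omega | simp

end Dyadic

/-- `u` lies in the quadrant `l` of `p`: the first component says whether `u` is to the right, the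
second whether it is above. -/
def Quad (Y : ℕ → ℕ) (l : Bool × Bool) (p u : ℕ) : Prop :=
  (if l.1 then p < u else u < p) ∧ (if l.2 then Y p < Y u else Y u < Y p)

instance (Y l p u) : Decidable (Quad Y l p u) := by unfold Quad; infer_instance

/-- The sums of the weights `f` over the quadrants `l` of all points. -/
def push {R : Type*} [CommRing R] (n : ℕ) (Y : ℕ → ℕ) (l : Bool × Bool) (f : ℕ → R) (p : ℕ) : R :=
  ∑ u ∈ Finset.range n, if Quad Y l p u then f u else 0

/-- Array `k` holds, row by row, the function `f`. -/
def Rows (w n rows : ℕ) (A : ℕ → ℕ → ℕ) (k : ℕ) (f : ℕ → ℕ → ZMod (2 ^ w)) : Prop :=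
  ∀ S < rows, ∀ p < n, (A k (S * n + p) : ZMod (2 ^ w)) = f S p

namespace Dom

/-- The point of the current step of a sweep. -/
def pt (l : Bool × Bool) : Ex :=
  .rd 2 (if l.2 then .par 0 - (.var 3 + .lit 1) else .var 3)

/-- The block of the current point. -/
def blk (l : Bool × Bool) : Ex := .op .shr (pt l) (.var 1)

/-- The entry of the current point. -/
def idx (l : Bool × Bool) : Ex := .var 2 * .par 0 + pt l

/-- One step of a sweep. -/
def step (l : Bool × Bool) (src dst : ℕ) : St :=
  .seq (.store dst (idx l)
    (if l.1 then
      .ite (.op .mod (blk l) (.lit 2)) (.lit 1) (.rd dst (idx l) + .rd 3 (blk l + .lit 1))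
        (.rd dst (idx l))
    else
      .ite (.lit 0) (.op .mod (blk l) (.lit 2)) (.rd dst (idx l) + .rd 3 (blk l - .lit 1))
        (.rd dst (idx l))))
  (.store 3 (blk l) (.rd 3 (blk l) + .rd src (idx l)))

end Dom

/-- The program that applies `push` to all rows of array `src`. -/
def dom (l : Bool × Bool) (src dst : ℕ) : St :=
  .seq (.table dst 3 (.lit 0)) <|
  .loop 1 5 <| .loop 2 2 <| .seq (.table 3 6 (.lit 0)) <| .loop 3 0 <| Dom.step l src dst
namespace Dom

/-- The point of step `y` of a sweep. -/
def point (n : ℕ) (X : ℕ → ℕ) (l : Bool × Bool) (y : ℕ) : ℕ :=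
  if l.2 then X (n - (y + 1)) else X y

/-- The step of a sweep in which the point `p` is visited. -/
def time (n : ℕ) (Y : ℕ → ℕ) (l : Bool × Bool) (p : ℕ) : ℕ :=
  if l.2 then n - (Y p + 1) else Y p

/-- The block `b` has a sibling that lies to the side `l`. -/
def Active (l : Bool × Bool) (b : ℕ) : Prop := if l.1 then b % 2 < 1 else 0 < b % 2

instance (l b) : Decidable (Active l b) := by unfold Active; infer_instance

/-- The sibling of a block. -/
def sib (l : Bool × Bool) (b : ℕ) : ℕ := if l.1 then b + 1 else b - 1

section

variable {w κ n q lg : ℕ} {P Y X : ℕ → ℕ} {l : Bool × Bool}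

theorem point_lt (h : PermPair n Y X) {y : ℕ} (hy : y < n) : point n X l y < n := by
  unfold point; split_ifs <;> exact h.x_lt _ (by omega)

theorem time_lt (h : PermPair n Y X) {p : ℕ} (hp : p < n) : time n Y l p < n := by
  have := h.y_lt p hp
  unfold time; split_ifs <;> omega

theorem time_eq_iff (h : PermPair n Y X) {p y : ℕ} (hp : p < n) (hy : y < n) :
    time n Y l p = y ↔ p = point n X l y := by
  have h₁ := h.y_lt p hp
  unfold time point
  split_ifs
  · refine ⟨fun he => ?_, fun he => ?_⟩
    · rw [← he, show n - (n - (Y p + 1) + 1) = Y p by omega, h.xy p hp]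
    · rw [he, h.yx _ (by omega)]; omega
  · refine ⟨fun he => ?_, fun he => ?_⟩
    · rw [← he, h.xy p hp]
    · rw [he, h.yx _ (by omega)]

theorem time_lt_iff (h : PermPair n Y X) {p u : ℕ} (hp : p < n) (hu : u < n) :
    time n Y l u < time n Y l p ↔ if l.2 then Y p < Y u else Y u < Y p := by
  have h₁ := h.y_lt p hp
  have h₂ := h.y_lt u hu
  unfold time
  split_ifs <;> omega

end

theorem lt_of_sizes {w κ n q lg : ℕ} {P : ℕ → ℕ} (hs : Sizes w κ P n q lg) {x : ℕ}
    (hx : x < (n + 2) ^ 3) : x < 2 ^ (w - κ) ∧ x < 2 ^ w := by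
  have h₁ := hs.big
  have h₂ : 2 ^ (w - κ) ≤ 2 ^ w := Nat.pow_le_pow_right (by norm_num) (by omega)
  omega

theorem flat_lt {n q S p : ℕ} (hS : S < n / q + 2) (hp : p < n) : S * n + p < (n + 2) ^ 2 := by
  have h₁ : n / q ≤ n := Nat.div_le_self _ _
  nlinarith [Nat.mul_le_mul_right n (show S ≤ n + 1 by omega)]

theorem sq_le_cube (n : ℕ) : (n + 2) ^ 2 < (n + 2) ^ 3 :=
  Nat.pow_lt_pow_right (by omega) (by omega)

theorem exec_step {w κ n q lg : ℕ} {P Y X V : ℕ → ℕ} {l : Bool × Bool} {A : ℕ → ℕ → ℕ}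
    {src dst : ℕ} (hs : Sizes w κ P n q lg) (h : PermPair n Y X) (hA : ∀ y < n, A 2 y = X y)
    (hV : V 2 < n / q + 2) (hV3 : V 3 < n) (hd2 : dst ≠ 2) (hd3 : dst ≠ 3) (hsd : src ≠ dst) :
    ∃ v v' : ℕ, (step l src dst).exec w κ P V A =
      Function.update (Function.update A dst
        (Function.update (A dst) (V 2 * n + point n X l (V 3)) v)) 3
        (Function.update (A 3) (point n X l (V 3) / 2 ^ V 1) v') ∧
      (v : ZMod (2 ^ w)) = A dst (V 2 * n + point n X l (V 3)) +
        (if Active l (point n X l (V 3) / 2 ^ V 1) then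
          (A 3 (sib l (point n X l (V 3) / 2 ^ V 1)) : ZMod (2 ^ w)) else 0) ∧
      (v' : ZMod (2 ^ w)) = A 3 (point n X l (V 3) / 2 ^ V 1) +
        A src (V 2 * n + point n X l (V 3)) := by
  set p := point n X l (V 3) with hp
  have hpn : p < n := point_lt h hV3
  have hb : p / 2 ^ V 1 ≤ p := Nat.div_le_self _ _
  have hn : n + 2 ≤ (n + 2) ^ 2 := Nat.le_self_pow (by norm_num) _
  have hc := sq_le_cube n
  have hlt := fun x hx => lt_of_sizes hs (x := x) hx
  have hfl : V 2 * n + p < (n + 2) ^ 3 := (flat_lt hV hpn).trans hc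
  have ept : ∀ A' : ℕ → ℕ → ℕ, (∀ y < n, A' 2 y = X y) → (pt l).eval w κ P A' V = p := by
    intro A' hA'
    unfold pt
    by_cases h2 : l.2
    · have e₁ : (Ex.var 3 + Ex.lit 1).eval w κ P A' V = V 3 + 1 := by
        have : (Ex.lit 1).eval w κ P A' V = 1 := Ex.eval_lit (hlt 1 (by omega)).2
        rw [Ex.eval_add (by rw [this]; exact (hlt _ (by simp only [Ex.eval]; omega)).2), this]
        rfl
      have e₂ : (Ex.par 0 - (Ex.var 3 + Ex.lit 1)).eval w κ P A' V = n - (V 3 + 1) := by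
        have : (Ex.par 0).eval w κ P A' V = n := hs.p0
        rw [Ex.eval_sub (by rw [this]; exact (hlt _ (by omega)).2) (by rw [this, e₁]; omega),
          this, e₁]
      rw [if_pos h2, Ex.eval_rd (by rw [e₂]; exact (hlt _ (by omega)).1), e₂, hA' _ (by omega), hp,
        point, if_pos h2]
    · rw [if_neg h2, Ex.eval_rd (by simp only [Ex.eval]; exact (hlt _ (by omega)).1)]
      simp only [Ex.eval]
      rw [hA' _ hV3, hp, point, if_neg h2]
  have eblk : ∀ A' : ℕ → ℕ → ℕ, (∀ y < n, A' 2 y = X y) →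
      (blk l).eval w κ P A' V = p / 2 ^ V 1 := by
    intro A' hA'
    unfold blk
    rw [Ex.eval_shr (by rw [ept A' hA']; exact (hlt _ (by omega)).2), ept A' hA']
    rfl
  have eidx : ∀ A' : ℕ → ℕ → ℕ, (∀ y < n, A' 2 y = X y) →
      (idx l).eval w κ P A' V = V 2 * n + p := by
    intro A' hA'
    have e₁ : (Ex.var 2 * Ex.par 0).eval w κ P A' V = V 2 * n := by
      rw [Ex.eval_mul] <;> simp only [Ex.eval, hs.p0]
      exact (hlt _ (by omega)).2
    unfold idx
    rw [Ex.eval_add (by rw [e₁, ept A' hA']; exact (hlt _ hfl).2), e₁, ept A' hA']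
  have m₁ : (V 2 * n + p) % 2 ^ (w - κ) = V 2 * n + p := Nat.mod_eq_of_lt (hlt _ hfl).1
  have m₂ : (p / 2 ^ V 1) % 2 ^ (w - κ) = p / 2 ^ V 1 :=
    Nat.mod_eq_of_lt (hlt _ (by omega)).1
  have e1 : (Ex.lit 1).eval w κ P A V = 1 := Ex.eval_lit (hlt 1 (by omega)).2
  have emod : (Ex.op .mod (blk l) (.lit 2)).eval w κ P A V = p / 2 ^ V 1 % 2 := by
    by_cases hw2 : 2 < 2 ^ w
    · rw [Ex.eval_mod (by rw [eblk A hA]; exact (hlt _ (by omega)).2), eblk A hA, Ex.eval_lit hw2]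
    · have := (hlt (n + 2) (by omega)).2
      omega
  simp only [step, St.exec]
  set v := Ex.eval w κ P A V (if l.1 then _ else _) with hv
  set A' := Function.update A dst (Function.update (A dst)
    ((idx l).eval w κ P A V % 2 ^ (w - κ)) v) with hA'
  have hA2 : ∀ y < n, A' 2 y = X y := fun y hy => by
    rw [hA', Function.update_of_ne hd2.symm, hA y hy]
  have hA3 : A' 3 = A 3 := by rw [hA', Function.update_of_ne hd3.symm]
  refine ⟨v, (Ex.rd 3 (blk l) + Ex.rd src (idx l)).eval w κ P A' V, ?_, ?_, ?_⟩
  · rw [eblk A' hA2, m₂, hA3]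
    simp only [hA', eidx A hA, m₁]
  · rw [hv]
    have erd : (Ex.rd dst (idx l)).eval w κ P A V = A dst (V 2 * n + p) := by
      rw [Ex.eval_rd (by rw [eidx A hA]; exact (hlt _ hfl).1), eidx A hA]
    by_cases h1 : l.1
    · have esib : (blk l + .lit 1).eval w κ P A V = p / 2 ^ V 1 + 1 := by
        rw [Ex.eval_add (by rw [eblk A hA, e1]; exact (hlt _ (by omega)).2), eblk A hA, e1]
      simp only [h1, if_true, Active, sib]
      rw [Ex.cast_eval_ite, emod, e1, Ex.cast_eval_add, erd,
        Ex.eval_rd (by rw [esib]; exact (hlt _ (by omega)).1), esib]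
      split_ifs <;> simp
    · simp only [h1, Active, sib]
      rw [if_neg (by simp), Ex.cast_eval_ite, emod, Ex.eval_lit (Nat.two_pow_pos w), Ex.cast_eval_add, erd]
      by_cases hpos : 0 < p / 2 ^ V 1 % 2
      · have esib : (blk l - .lit 1).eval w κ P A V = p / 2 ^ V 1 - 1 := by
          rw [Ex.eval_sub (by rw [eblk A hA]; exact (hlt _ (by omega)).2)
            (by rw [eblk A hA, e1]; omega), eblk A hA, e1]
        rw [Ex.eval_rd (by rw [esib]; exact (hlt _ (by omega)).1), esib]
        simp [hpos]
      · simp [hpos]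
  · rw [Ex.cast_eval_add, Ex.eval_rd (by rw [eblk A' hA2]; exact (hlt _ (by omega)).1),
      Ex.eval_rd (by rw [eidx A' hA2]; exact (hlt _ hfl).1), eblk A' hA2, eidx A' hA2, hA3]
    congr 3
    rw [hA', Function.update_of_ne hsd]

end Dom

namespace Dom

variable {w κ n q lg : ℕ} {P Y X : ℕ → ℕ} {l : Bool × Bool} {src dst : ℕ}

/-- The contribution of one row and one dyadic scale to the entry of a point. -/
def contr {R : Type*} [CommRing R] (n : ℕ) (Y : ℕ → ℕ) (l : Bool × Bool) (e : ℕ) (f : ℕ → R)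
    (p : ℕ) : R :=
  ∑ u ∈ Finset.range n,
    if time n Y l u < time n Y l p ∧ (Active l (p / 2 ^ e) ∧ u / 2 ^ e = sib l (p / 2 ^ e))
    then f u else 0

theorem sum_contr {R : Type*} [CommRing R] (hs : Sizes w κ P n q lg) (h : PermPair n Y X)
    (f : ℕ → R) {p : ℕ} (hp : p < n) :
    ∑ e ∈ Finset.range lg, contr n Y l e f p = push n Y l f p := by
  unfold contr push
  rw [Finset.sum_comm]
  refine Finset.sum_congr rfl fun u hu => ?_
  have hu := Finset.mem_range.1 hu
  have hn := hs.le_two_pow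
  have key : (∑ e ∈ Finset.range lg,
      if Active l (p / 2 ^ e) ∧ u / 2 ^ e = sib l (p / 2 ^ e) then (1 : R) else 0) =
        if (if l.1 then p < u else u < p) then 1 else 0 := by
    obtain ⟨l₁, l₂⟩ := l
    unfold Active sib
    cases l₁
    · simpa using sum_dyadic_lt (R := R) lg p u (by omega) (by omega)
    · simpa using sum_dyadic_gt (R := R) lg p u (by omega) (by omega)
  have hone : (if Quad Y l p u then f u else 0) =
      (if (if l.1 then p < u else u < p) then (1 : R) else 0) *
        if (if l.2 then Y p < Y u else Y u < Y p) then f u else 0 := by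
    unfold Quad
    simp only [ite_and, ite_mul, one_mul, zero_mul]
  rw [hone, ← key, Finset.sum_mul]
  refine Finset.sum_congr rfl fun e _ => ?_
  simp only [time_lt_iff h hp hu]
  rw [if_congr and_comm rfl rfl, ite_and, ite_mul, one_mul, zero_mul]

/-- The invariant of a sweep: the first `j` steps of the sweep over row `S` at scale `e` have been
done. -/
structure Sweep (w n : ℕ) (Y : ℕ → ℕ) (l : Bool × Bool) (dst e S : ℕ) (f : ℕ → ZMod (2 ^ w))
    (A₀ : ℕ → ℕ → ℕ) (j : ℕ) (A : ℕ → ℕ → ℕ) : Prop where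
  other : ∀ k, k ≠ dst → k ≠ 3 → A k = A₀ k
  acc : ∀ b ≤ n, (A 3 b : ZMod (2 ^ w)) =
    ∑ u ∈ Finset.range n, if time n Y l u < j ∧ u / 2 ^ e = b then f u else 0
  rest : ∀ t, (∀ p < n, time n Y l p < j → t ≠ S * n + p) → A dst t = A₀ dst t
  done : ∀ p < n, time n Y l p < j →
    (A dst (S * n + p) : ZMod (2 ^ w)) = A₀ dst (S * n + p) + contr n Y l e f p

theorem Sweep.step (hs : Sizes w κ P n q lg) (h : PermPair n Y X) (hd2 : dst ≠ 2) (hd3 : dst ≠ 3)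
    (hsd : src ≠ dst) (hs3 : src ≠ 3) {A₀ A : ℕ → ℕ → ℕ} {V : ℕ → ℕ} {S : ℕ}
    {f : ℕ → ZMod (2 ^ w)} (hA₀ : ∀ y < n, A₀ 2 y = X y)
    (hf : ∀ p < n, (A₀ src (S * n + p) : ZMod (2 ^ w)) = f p)
    (hV2 : V 2 = S) (hS : S < n / q + 2) {j : ℕ} (hj : j < n) (hV3 : V 3 = j)
    (hI : Sweep w n Y l dst (V 1) S f A₀ j A) :
    Sweep w n Y l dst (V 1) S f A₀ (j + 1) ((Dom.step l src dst).exec w κ P V A) := by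
  obtain ⟨v, v', he, hv, hv'⟩ := exec_step (l := l) (src := src) (V := V) (A := A) hs h
    (fun y hy => by rw [hI.other 2 hd2.symm (by norm_num), hA₀ y hy])
    (hV2 ▸ hS) (hV3 ▸ hj) hd2 hd3 hsd
  rw [hV2, hV3] at he hv hv'
  set p := point n X l j with hp
  have hpn : p < n := point_lt h hj
  have htp : time n Y l p = j := (time_eq_iff h hpn hj).2 rfl
  have hsucc : ∀ u < n, (time n Y l u < j + 1 ↔ time n Y l u < j ∨ u = p) := fun u hu => by
    rw [← time_eq_iff h hu hj]; omega
  rw [he]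
  refine ⟨fun k h₁ h₂ => ?_, fun b hb => ?_, fun t ht => ?_, fun p' hp' ht => ?_⟩
  · rw [Function.update_of_ne h₂, Function.update_of_ne h₁, hI.other k h₁ h₂]
  · have hsum : (∑ u ∈ Finset.range n,
        if time n Y l u < j + 1 ∧ u / 2 ^ V 1 = b then f u else 0) =
        (∑ u ∈ Finset.range n, if time n Y l u < j ∧ u / 2 ^ V 1 = b then f u else 0) +
          if p / 2 ^ V 1 = b then f p else 0 := by
      rw [← Finset.sum_ite_eq_of_mem' (Finset.range n) p
        (fun u => if u / 2 ^ V 1 = b then f u else 0) (Finset.mem_range.2 hpn),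
        ← Finset.sum_add_distrib]
      refine Finset.sum_congr rfl fun u hu => ?_
      simp only [hsucc u (Finset.mem_range.1 hu)]
      by_cases hup : u = p
      · simp [hup, htp]
      · simp [hup]
    rw [Function.update_self, hsum]
    by_cases hbp : b = p / 2 ^ V 1
    · subst hbp
      rw [Function.update_self, hv', hI.acc _ hb, if_pos rfl, hI.other src hsd hs3, hf p hpn]
    · rw [Function.update_of_ne hbp, if_neg (Ne.symm hbp), add_zero, hI.acc b hb]
  · rw [Function.update_of_ne hd3, Function.update_self,
      Function.update_of_ne (ht p hpn (by omega)), hI.rest t fun p' hp' h' => ht p' hp' (by omega)]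
  · rw [Function.update_of_ne hd3, Function.update_self]
    rcases (hsucc p' hp').1 ht with h' | rfl
    · have hne : p' ≠ p := fun e => by rw [e] at h'; omega
      rw [Function.update_of_ne (by omega), hI.done p' hp' h']
    · rw [Function.update_self, hv, hI.rest _ fun p' hp' h' => by
        intro e
        have : p' = p := by omega
        rw [this] at h'; omega]
      congr 1
      unfold contr
      by_cases ha : Active l (p / 2 ^ V 1)
      · have hsib : sib l (p / 2 ^ V 1) ≤ n := by
          have := Nat.div_le_self p (2 ^ V 1)
          unfold sib; split_ifs <;> omega
        rw [if_pos ha, hI.acc _ hsib]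
        simp only [ha, true_and, htp]
      · simp [ha]

end Dom

theorem writes_dom (l : Bool × Bool) (src dst : ℕ) :
    (dom l src dst).Writes fun k => k = dst ∨ k = 3 := by
  simp [dom, St.table, Dom.step, St.Writes]

theorem exec_dom_of_ne {w κ : ℕ} {P : ℕ → ℕ} {l : Bool × Bool} {src dst k : ℕ} (hk : k ≠ dst) (hk3 : k ≠ 3)
    (V : ℕ → ℕ) (A : ℕ → ℕ → ℕ) : (dom l src dst).exec w κ P V A k = A k :=
  St.exec_of_writes _ ((writes_dom l src dst).mono fun k' h => by
    rintro rfl; rcases h with h | h <;> contradiction) _ _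

open Dom in
theorem exec_dom {w κ n q lg : ℕ} {P Y X : ℕ → ℕ} {l : Bool × Bool} {src dst : ℕ}
    (hs : Sizes w κ P n q lg) (h : PermPair n Y X) (hd2 : dst ≠ 2) (hd3 : dst ≠ 3)
    (hsd : src ≠ dst) (hs3 : src ≠ 3) {A₀ : ℕ → ℕ → ℕ} {f : ℕ → ℕ → ZMod (2 ^ w)}
    (hA₀ : ∀ y < n, A₀ 2 y = X y) (hf : Rows w n (n / q + 2) A₀ src f) (V : ℕ → ℕ) :
    Rows w n (n / q + 2) ((dom l src dst).exec w κ P V A₀) dst fun S => push n Y l (f S) := by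
  have hP3 : P 3 ≤ 2 ^ (w - κ) := by
    have h₁ := hs.big
    have h₂ : n / q ≤ n := Nat.div_le_self _ _
    have h₃ := sq_le_cube n
    rw [hs.p3]; nlinarith [Nat.mul_le_mul_right n (show n / q + 2 ≤ n + 2 by omega)]
  have hP6 : P 6 ≤ 2 ^ (w - κ) := by
    rw [hs.p6]
    have := hs.big
    have : n + 2 ≤ (n + 2) ^ 3 := Nat.le_self_pow (by norm_num) _
    omega
  set A₁ := (St.table dst 3 (.lit 0)).exec w κ P V A₀ with hA₁
  have hA₁o : ∀ k ≠ dst, A₁ k = A₀ k := fun k hk =>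
    St.exec_of_writes (.loop 0 3 (.store dst (.var 0) (.lit 0))) (Ne.symm hk) V A₀
  have hA₁d : ∀ S < n / q + 2, ∀ p < n, A₁ dst (S * n + p) = 0 := fun S hS p hp => by
    rw [hA₁, St.exec_table (e := .lit 0) trivial hP3]
    · simp [Ex.eval]
    · rw [hs.p3]; nlinarith [Nat.mul_le_mul_right n (show S + 1 ≤ n / q + 2 by omega)]
  have main : ∀ e ≤ lg, (∀ k, k ≠ dst → k ≠ 3 →
      iter (fun e A => (St.loop 2 2 (.seq (.table 3 6 (.lit 0)) (.loop 3 0 (step l src dst)))).exec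
        w κ P (Function.update V 1 e) A) e A₁ k = A₀ k) ∧
      ∀ S < n / q + 2, ∀ p < n,
      ((iter (fun e A => (St.loop 2 2 (.seq (.table 3 6 (.lit 0)) (.loop 3 0 (step l src dst)))).exec
        w κ P (Function.update V 1 e) A) e A₁ dst (S * n + p) : ℕ) : ZMod (2 ^ w)) =
        ∑ e ∈ Finset.range e, contr n Y l e (f S) p := by
    intro e
    induction e with
    | zero =>
      refine fun _ => ⟨fun k h₁ _ => hA₁o k h₁, fun S hS p hp => ?_⟩
      simp [iter, hA₁d S hS p hp]
    | succ e ih =>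
      intro he
      obtain ⟨iho, ihd⟩ := ih (by omega)
      rw [iter]
      set B := iter (fun e A => (St.loop 2 2 (.seq (.table 3 6 (.lit 0))
        (.loop 3 0 (step l src dst)))).exec w κ P (Function.update V 1 e) A) e A₁
      have hmid := iter_induction (N := P 2) (a := B)
        (f := fun i A => (St.seq (.table 3 6 (.lit 0)) (.loop 3 0 (step l src dst))).exec w κ P
          (Function.update (Function.update V 1 e) 2 i) A)
        (I := fun S A => (∀ k, k ≠ dst → k ≠ 3 → A k = A₀ k) ∧
          ∀ S' < n / q + 2, ∀ p < n, (A dst (S' * n + p) : ZMod (2 ^ w)) =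
            (∑ e ∈ Finset.range e, contr n Y l e (f S') p) +
              if S' < S then contr n Y l e (f S') p else 0)
        ⟨iho, fun S' hS' p hp => by rw [ihd S' hS' p hp]; simp⟩
        (fun S hS A ⟨ho, hd⟩ => by
          rw [hs.p2] at hS
          simp only [St.exec]
          set W := Function.update (Function.update V 1 e) 2 S
          set C := (St.table 3 6 (.lit 0)).exec w κ P W A with hC
          have hCo : ∀ k ≠ 3, C k = A k := fun k hk =>
            St.exec_of_writes (.loop 0 6 (.store 3 (.var 0) (.lit 0))) (Ne.symm hk) W A
          have hC3 : ∀ b ≤ n, C 3 b = 0 := fun b hb => by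
            rw [hC, St.exec_table (e := .lit 0) trivial hP6 _ (by rw [hs.p6]; omega)]
            simp [Ex.eval]
          have hsw := iter_induction (N := P 0) (a := C)
            (f := fun i A => (step l src dst).exec w κ P (Function.update W 3 i) A)
            (I := Sweep w n Y l dst e S (f S) C)
            ⟨fun _ _ _ => rfl, fun b hb => by simp [hC3 b hb], fun _ _ => rfl,
              fun _ _ h' => by omega⟩
            (fun j hj A' hI => by
              rw [hs.p0] at hj
              have := Sweep.step (src := src) (V := Function.update W 3 j) (S := S)
                (f := f S) hs h hd2 hd3 hsd hs3 (A₀ := C) (A := A') (l := l)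
                (fun y hy => by
                  rw [hCo 2 (by norm_num), ho 2 hd2.symm (by norm_num), hA₀ y hy])
                (fun p hp => by rw [hCo src hs3, ho src hsd hs3, hf S hS p hp])
                (by simp [W]) hS hj (by simp)
                (by simpa [W, Function.update_apply] using hI)
              simpa [W, Function.update_apply] using this)
          rw [hs.p0] at hsw
          rw [hs.p0]
          refine ⟨fun k h₁ h₂ => by rw [hsw.other k h₁ h₂, hCo k h₂, ho k h₁ h₂],
            fun S' hS' p hp => ?_⟩
          by_cases hSS : S' = S
          · subst hSS
            rw [hsw.done p hp (time_lt h hp), hCo dst hd3, hd S' hS' p hp]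
            simp
          · rw [hsw.rest, hCo dst hd3, hd S' hS' p hp]
            · congr 1
              exact if_congr (by omega) rfl rfl
            · intro p' hp' _ hcon
              apply hSS
              have h₁ := congrArg (· / n) hcon
              have hn : 0 < n := by omega
              simpa [Nat.add_div_of_dvd_right, Nat.mul_div_cancel _ hn, Nat.div_eq_of_lt hp,
                Nat.div_eq_of_lt hp', Nat.mul_add_div, mul_comm _ n, hn] using h₁)
      refine ⟨hmid.1, fun S hS p hp => ?_⟩
      have := hmid.2 S hS p hp
      rw [hs.p2, if_pos hS, ← Finset.sum_range_succ] at this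
      rw [← this, ← hs.p2]
      rfl
  intro S hS p hp
  have := (main lg le_rfl).2 S hS p hp
  rw [sum_contr hs h _ hp, ← hs.p5] at this
  exact this

open Finset

section Slabs

variable {R : Type*} [CommRing R] {n q : ℕ} {Y X : ℕ → ℕ}

theorem PermPair.y_inj (h : PermPair n Y X) {u v : ℕ} (hu : u < n) (hv : v < n) :
    Y u = Y v ↔ u = v :=
  ⟨fun e => by rw [← h.xy u hu, e, h.xy v hv], fun e => by rw [e]⟩

theorem PermPair.symm (h : PermPair n Y X) : PermPair n X Y := ⟨h.x_lt, h.y_lt, h.yx, h.xy⟩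

theorem PermPair.sum_comp (h : PermPair n Y X) (g : ℕ → R) :
    ∑ y ∈ range n, g (X y) = ∑ x ∈ range n, g x :=
  sum_nbij' X Y (fun y hy => mem_range.2 (h.x_lt y (mem_range.1 hy)))
    (fun x hx => mem_range.2 (h.y_lt x (mem_range.1 hx)))
    (fun y hy => h.yx y (mem_range.1 hy)) (fun x hx => h.xy x (mem_range.1 hx)) fun _ _ => rfl

theorem sum_slab (hq : 0 < q) (S : ℕ) (g : ℕ → R) :
    (∑ t ∈ range q, if S * q + t < n then g (S * q + t) else 0) =
      ∑ x ∈ range n, if x / q = S then g x else 0 := by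
  rw [← sum_filter, ← sum_filter]
  refine sum_nbij' (fun t => S * q + t) (fun x => x - S * q) (fun t ht => ?_) (fun x hx => ?_)
    (fun t _ => by simp) (fun x hx => ?_) fun _ _ => rfl
  · simp only [mem_filter, mem_range] at ht ⊢
    exact ⟨ht.2, by rw [mul_comm, Nat.mul_add_div hq, Nat.div_eq_of_lt ht.1, add_zero]⟩
  all_goals
    simp only [mem_filter, mem_range] at hx ⊢
    have h₁ := Nat.div_add_mod x q
    have h₂ := Nat.mod_lt x hq
    rw [hx.2, mul_comm] at h₁
  · exact ⟨by omega, by omega⟩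
  · omega

theorem div_lt_or_eq_iff (q a b : ℕ) : a < b ↔ a / q < b / q ∨ (b / q = a / q ∧ a < b) := by
  refine ⟨fun h => ?_, fun h => ?_⟩
  · have := Nat.div_le_div_right (c := q) h.le
    omega
  · rcases h with h | h
    · by_contra hc
      have := Nat.div_le_div_right (c := q) (not_lt.1 hc)
      omega
    · exact h.2

theorem ite_lt_slab (q a b : ℕ) (x : R) : (if a < b then x else 0) =
    (if a / q < b / q then x else 0) + if b / q = a / q then if a < b then x else 0 else 0 := by
  have h := div_lt_or_eq_iff q a b
  split_ifs <;> first | omega | simp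

/-- The sum of the values `M a c` over all triples of points `a`, `b`, `c` such that `b` is to the
left of `a` and below `c`. -/
def tripleSum (n : ℕ) (Y : ℕ → ℕ) (M : ℕ → ℕ → R) : R :=
  ∑ b ∈ range n, ∑ a ∈ range n, ∑ c ∈ range n, if b < a ∧ Y b < Y c then M a c else 0

theorem tripleSum_eq (q : ℕ) (M : ℕ → ℕ → R) :
    tripleSum n Y M =
      (∑ a ∈ range n, ∑ c ∈ range n,
        (∑ b ∈ range n, if b / q < a / q ∧ Y b < Y c then 1 else 0) * M a c) +
      (∑ b ∈ range n, ∑ a ∈ range n, if a / q = b / q then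
        if b < a then ∑ c ∈ range n, if Y b / q < Y c / q then M a c else 0 else 0 else 0) +
      ∑ b ∈ range n, ∑ a ∈ range n, if a / q = b / q then
        if b < a then ∑ c ∈ range n, if Y c / q = Y b / q then
          if Y b < Y c then M a c else 0 else 0 else 0 else 0 := by
  have h₁ : (∑ a ∈ range n, ∑ c ∈ range n,
      (∑ b ∈ range n, if b / q < a / q ∧ Y b < Y c then 1 else 0) * M a c) =
      ∑ b ∈ range n, ∑ a ∈ range n, ∑ c ∈ range n,
        if b / q < a / q then if Y b < Y c then M a c else 0 else 0 := by
    rw [sum_comm' (t' := range n) (s' := fun _ => range n) (by simp)]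
    simp_rw [sum_mul]
    rw [sum_congr rfl fun _ _ => sum_comm, sum_comm]
    refine sum_congr rfl fun b _ => ?_
    rw [sum_comm]
    simp only [ite_and, ite_mul, one_mul, zero_mul]
  rw [h₁, add_assoc, ← sum_add_distrib, ← sum_add_distrib, tripleSum]
  refine sum_congr rfl fun b _ => ?_
  rw [← sum_add_distrib, ← sum_add_distrib]
  refine sum_congr rfl fun a _ => ?_
  have h₂ : ∀ c, (if b < a ∧ Y b < Y c then M a c else 0) =
      (if b / q < a / q then if Y b < Y c then M a c else 0 else 0) +
      ((if a / q = b / q then if b < a then if Y b / q < Y c / q then M a c else 0 else 0 else 0) +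
        if a / q = b / q then if b < a then if Y c / q = Y b / q then
          if Y b < Y c then M a c else 0 else 0 else 0 else 0) := fun c => by
    rw [ite_and, ite_lt_slab q b a]
    congr 1
    rw [ite_lt_slab q (Y b) (Y c)]
    split_ifs <;> first | (exfalso; omega) | simp
  rw [sum_congr rfl fun c _ => h₂ c, sum_add_distrib, sum_add_distrib]
  congr 1
  split_ifs <;> simp

/-- The number of points to the left of `x` and below `y`. -/
def cnt (n : ℕ) (Y : ℕ → ℕ) (x y : ℕ) : ℕ := #{p ∈ range n | p < x ∧ Y p < y}

theorem cast_cnt (x y : ℕ) :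
    (cnt n Y x y : R) = ∑ p ∈ range n, if p < x ∧ Y p < y then 1 else 0 := by
  rw [cnt, card_filter]; simp

theorem cnt_le (x y : ℕ) : cnt n Y x y ≤ n :=
  (card_filter_le _ _).trans (card_range n).le

theorem cnt_mono {x y x' y' : ℕ} (hx : x ≤ x') (hy : y ≤ y') : cnt n Y x y ≤ cnt n Y x' y' :=
  card_le_card fun p hp => by
    simp only [mem_filter] at hp ⊢
    exact ⟨hp.1, by omega, by omega⟩

theorem PermPair.sum_lt (h : PermPair n Y X) {y : ℕ} (hy : y ≤ n) :
    (∑ p ∈ range n, if Y p < y then (1 : R) else 0) = y := by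
  rw [← h.symm.symm.sum_comp]
  have : ∀ i ∈ range n, (if Y (X i) < y then (1 : R) else 0) = if i < y then 1 else 0 :=
    fun i hi => by rw [h.yx i (mem_range.1 hi)]
  rw [sum_congr rfl this, ← sum_filter, sum_const, nsmul_one]
  congr 1
  rw [show filter (fun i => i < y) (range n) = range y by ext; simp; omega, card_range]

/-- The number of points of the slab of `x` that are to the left of `x` and whose rank within the
slab is below `r`. -/
def slabCnt (n q : ℕ) (Y : ℕ → ℕ) (x r : ℕ) : ℕ :=
  #{p ∈ range n | p / q = x / q ∧ p < x ∧
    cnt n Y ((p / q + 1) * q) (Y p) - cnt n Y (p / q * q) (Y p) < r}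

theorem div_eq_iff_mem_slab (hq : 0 < q) (p S : ℕ) :
    p / q = S ↔ ¬ p < S * q ∧ p < (S + 1) * q := by
  rw [Nat.div_eq_iff hq, Nat.succ_mul]
  omega

theorem cnt_slab_sub (hq : 0 < q) (S y : ℕ) : cnt n Y ((S + 1) * q) y - cnt n Y (S * q) y =
    #{p ∈ range n | p / q = S ∧ Y p < y} := by
  have h := card_sdiff_of_subset (s := {p ∈ range n | p < S * q ∧ Y p < y})
    (t := {p ∈ range n | p < (S + 1) * q ∧ Y p < y}) fun p hp => by
      simp only [mem_filter] at hp ⊢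
      exact ⟨hp.1, by rw [Nat.succ_mul]; omega, hp.2.2⟩
  rw [cnt, cnt, ← h]
  congr 1
  ext p
  simp only [Finset.mem_sdiff, mem_filter, div_eq_iff_mem_slab hq]
  tauto

theorem cnt_slab_lt_iff (hq : 0 < q) {p y : ℕ} (hp : p < n) :
    cnt n Y ((p / q + 1) * q) (Y p) - cnt n Y (p / q * q) (Y p) <
      cnt n Y ((p / q + 1) * q) y - cnt n Y (p / q * q) y ↔ Y p < y := by
  rw [cnt_slab_sub hq, cnt_slab_sub hq]
  refine ⟨fun h => ?_, fun h => card_lt_card ?_⟩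
  · by_contra hc
    refine h.not_ge (card_le_card fun p' hp' => ?_)
    simp only [mem_filter] at hp' ⊢
    exact ⟨hp'.1, hp'.2.1, by omega⟩
  · refine (ssubset_iff_of_subset fun p' hp' => ?_).2 ⟨p, ?_, ?_⟩
    · simp only [mem_filter] at hp' ⊢
      exact ⟨hp'.1, hp'.2.1, by omega⟩
    · simp [hp, h]
    · simp

theorem cnt_eq (hq : 0 < q) (x y : ℕ) : cnt n Y x y = cnt n Y (x / q * q) y +
    slabCnt n q Y x (cnt n Y ((x / q + 1) * q) y - cnt n Y (x / q * q) y) := by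
  rw [cnt, cnt, slabCnt, ← card_union_of_disjoint]
  · congr 1
    ext p
    simp only [mem_union, mem_filter, mem_range]
    have hx := (div_eq_iff_mem_slab hq x (x / q)).1 rfl
    constructor
    · rintro ⟨hp, h₁, h₂⟩
      by_cases h₃ : p < x / q * q
      · exact .inl ⟨hp, h₃, h₂⟩
      · have he : p / q = x / q := (div_eq_iff_mem_slab hq _ _).2 ⟨h₃, by omega⟩
        refine .inr ⟨hp, he, h₁, ?_⟩
        rw [← he]
        exact (cnt_slab_lt_iff hq hp).2 h₂
    · rintro (⟨hp, h₁, h₂⟩ | ⟨hp, he, h₁, h₂⟩)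
      · exact ⟨hp, by omega, h₂⟩
      · rw [← he] at h₂
        exact ⟨hp, h₁, (cnt_slab_lt_iff hq hp).1 h₂⟩
  · rw [disjoint_filter]
    rintro p _ ⟨h₁, -⟩ ⟨h₂, -⟩
    exact ((div_eq_iff_mem_slab hq _ _).1 h₂).1 h₁

end Slabs

section Chains

variable {R : Type*} [CommRing R] {n q : ℕ} {Y X : ℕ → ℕ}

/-- The quadrants. -/
abbrev SW : Bool × Bool := (false, false)
/-- A quadrant. -/
abbrev NW : Bool × Bool := (false, true)
/-- A quadrant. -/
abbrev SE : Bool × Bool := (true, false)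
/-- A quadrant. -/
abbrev NE : Bool × Bool := (true, true)

theorem push_add (l : Bool × Bool) (f g : ℕ → R) (p : ℕ) :
    push n Y l (fun u => f u + g u) p = push n Y l f p + push n Y l g p := by
  simp only [push, ← sum_add_distrib]
  exact sum_congr rfl fun u _ => by split_ifs <;> simp

theorem push_congr (l : Bool × Bool) {f g : ℕ → R} (h : ∀ u < n, f u = g u) (p : ℕ) :
    push n Y l f p = push n Y l g p :=
  sum_congr rfl fun u hu => by rw [h u (mem_range.1 hu)]

theorem push_push (l l' : Bool × Bool) (f : ℕ → R) (p : ℕ) :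
    push n Y l (push n Y l' f) p =
      ∑ z ∈ range n, f z * ∑ r ∈ range n, if Quad Y l p r ∧ Quad Y l' r z then 1 else 0 := by
  simp only [push, mul_sum]
  rw [sum_comm]
  refine sum_congr rfl fun r _ => ?_
  split_ifs with h
  · exact sum_congr rfl fun z _ => by simp [h]
  · simp [h]

theorem push_push_ite_lt_slab (q : ℕ) (l l' : Bool × Bool) (f g : ℕ → ℕ) (p : ℕ) :
    push n Y l (push n Y l' fun z => if f z < g z then (1 : R) else 0) p =
      push n Y l (push n Y l' fun z => if f z / q < g z / q then (1 : R) else 0) p +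
      ∑ z ∈ range n, if g z / q = f z / q then if f z < g z then
        ∑ r ∈ range n, if Quad Y l p r ∧ Quad Y l' r z then (1 : R) else 0 else 0 else 0 := by
  rw [push_congr l fun u _ => (push_congr l' (fun z _ => ite_lt_slab q (f z) (g z) (1 : R)) u).trans
    (push_add l' _ _ u), push_add]
  congr 1
  rw [push_push]
  refine sum_congr rfl fun z _ => ?_
  split_ifs <;> simp

/-- The number of points strictly between `c` and `a`. -/
def mid₂ (R : Type*) [CommRing R] (n : ℕ) (Y : ℕ → ℕ) (a c : ℕ) : R :=
  ∑ u ∈ range n, if Quad Y SW a u ∧ Quad Y SW u c then 1 else 0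

/-- The number of increasing pairs of points strictly between `c` and `a`. -/
def mid₃ (R : Type*) [CommRing R] (n : ℕ) (Y : ℕ → ℕ) (a c : ℕ) : R :=
  ∑ u ∈ range n, ∑ v ∈ range n,
    if Quad Y SW a u ∧ Quad Y SW u v ∧ Quad Y SW v c then 1 else 0

theorem sum_mul_mid₂ (g : ℕ → R) (a : ℕ) :
    ∑ c ∈ range n, g c * mid₂ R n Y a c = push n Y SW (push n Y SW g) a :=
  (push_push _ _ _ _).symm

theorem sum_mul_mid₃ (g : ℕ → R) (a : ℕ) :
    ∑ c ∈ range n, g c * mid₃ R n Y a c = push n Y SW (push n Y SW (push n Y SW g)) a := by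
  rw [push]
  simp_rw [push_push]
  simp only [mid₃, mul_sum]
  rw [sum_comm]
  refine sum_congr rfl fun u _ => ?_
  split_ifs with h
  · simp [h]
  · simp [h]

theorem mid₂_eq (h : PermPair n Y X) {a c : ℕ} (ha : a < n) (hc : c < n) :
    mid₂ R n Y a c = if c < a then if Y c < Y a then
      (cnt n Y a (Y a) : R) - cnt n Y a (Y c) - cnt n Y c (Y a) + cnt n Y c (Y c) - 1
      else 0 else 0 := by
  rw [mid₂]
  split_ifs with h₁ h₂
  · have hone : (1 : R) = ∑ u ∈ range n, if u = c then 1 else 0 := by simp [hc]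
    conv_rhs => rw [hone]
    simp only [cast_cnt, ← sum_sub_distrib, ← sum_add_distrib, Quad]
    refine sum_congr rfl fun u hu => ?_
    have hu := mem_range.1 hu
    have e₁ := h.y_inj hu hc
    have e₂ := h.y_inj hu ha
    simp only [Bool.false_eq_true, if_false]
    rcases lt_trichotomy u a with h₃ | h₃ | h₃ <;> rcases lt_trichotomy u c with h₄ | h₄ | h₄ <;>
      rcases lt_trichotomy (Y u) (Y a) with h₅ | h₅ | h₅ <;>
      rcases lt_trichotomy (Y u) (Y c) with h₆ | h₆ | h₆
    all_goals first | (exfalso; omega) | skip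
    all_goals have hne : c < u → u ≠ c := fun h e => by omega
    all_goals have hne' : u < c → u ≠ c := fun h e => by omega
    all_goals simp [h₃, h₄, h₅, h₆, hne, hne', h₁, h₁.not_gt, h₁.ne', h₂, h₂.not_gt,
      h₃.not_gt, h₄.not_gt, h₅.not_gt, h₆.not_gt]
  · refine sum_eq_zero fun u _ => if_neg ?_
    simp only [Quad, Bool.false_eq_true, if_false]
    omega
  · refine sum_eq_zero fun u _ => if_neg ?_
    simp only [Quad, Bool.false_eq_true, if_false]
    omega

theorem mid₃_eq_push (h : PermPair n Y X) {a c : ℕ} (ha : a < n) (hc : c < n) (h₁ : c < a)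
    (h₂ : Y c < Y a) :
    mid₃ R n Y a c = push n Y SW (push n Y SW fun v => if Y c < Y v then 1 else 0) a -
      push n Y NW (push n Y NE fun u => if Y u < Y a then 1 else 0) c +
      push n Y SE (push n Y SW fun v => if v < c then 1 else 0) a -
      push n Y SW (push n Y NE fun u => if a < u then 1 else 0) c +
      push n Y NE (fun _ => 1) a * cnt n Y c (Y c) := by
  have e₁ : ∀ l l' (f : ℕ → R) p, push n Y l (push n Y l' f) p = ∑ u ∈ range n, ∑ v ∈ range n,
      if Quad Y l p u ∧ Quad Y l' u v then f v else 0 := fun l l' f p => by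
    simp only [push]
    refine sum_congr rfl fun u _ => ?_
    split_ifs with h <;> simp [h]
  have e₂ : ∀ l l' (f : ℕ → R) p, push n Y l (push n Y l' f) p = ∑ u ∈ range n, ∑ v ∈ range n,
      if Quad Y l p v ∧ Quad Y l' v u then f u else 0 := fun l l' f p => by
    rw [sum_comm, e₁]
  have e₃ : push n Y NE (fun _ => (1 : R)) a * cnt n Y c (Y c) = ∑ u ∈ range n, ∑ v ∈ range n,
      if Quad Y NE a u ∧ (v < c ∧ Y v < Y c) then 1 else 0 := by
    rw [cast_cnt, push, sum_mul_sum]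
    refine sum_congr rfl fun u _ => sum_congr rfl fun v _ => ?_
    simp only [ite_and, ite_mul, one_mul, zero_mul]
  rw [e₁ SW SW, e₂ NW NE, e₁ SE SW, e₂ SW NE, e₃, mid₃]
  simp only [← sum_sub_distrib, ← sum_add_distrib, Quad]
  refine sum_congr rfl fun u hu => sum_congr rfl fun v hv => ?_
  have hu := mem_range.1 hu
  have hv := mem_range.1 hv
  have i₁ := h.y_inj hu ha
  have i₂ := h.y_inj hv hc
  have i₃ := h.y_inj hu hv
  simp only [Bool.false_eq_true, if_false, if_true]
  by_cases hvu : v < u ∧ Y v < Y u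
  · obtain ⟨hx, hy⟩ := hvu
    simp only [hx, hy, and_self, and_true, true_and]
    rcases lt_trichotomy u a with h₃ | h₃ | h₃ <;> rcases lt_trichotomy v c with h₄ | h₄ | h₄ <;>
      rcases lt_trichotomy (Y u) (Y a) with h₅ | h₅ | h₅ <;>
      rcases lt_trichotomy (Y v) (Y c) with h₆ | h₆ | h₆
    all_goals first | (exfalso; omega) | skip
    all_goals simp [h₃, h₄, h₅, h₆, h₃.not_gt, h₄.not_gt, h₅.not_gt, h₆.not_gt]
  · have hd : ¬ ((a < u ∧ Y a < Y u) ∧ v < c ∧ Y v < Y c) := by omega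
    simp [hd, hvu]

theorem sum_between (h : PermPair n Y X) {c u : ℕ} (hc : c < n) :
    (∑ v ∈ range n, if Quad Y NW c v ∧ Quad Y NE v u then (1 : R) else 0) =
      if Y c < Y u then (cnt n Y (min c u) (Y u) : R) - cnt n Y (min c u) (Y c) else 0 := by
  split_ifs with h₁
  · rw [cast_cnt, cast_cnt, ← sum_sub_distrib]
    refine sum_congr rfl fun v hv => ?_
    have i₂ := h.y_inj (mem_range.1 hv) hc
    simp only [Quad, Bool.false_eq_true, if_false, if_true, lt_min_iff]
    split_ifs <;> first | (exfalso; omega) | simp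
  · refine sum_eq_zero fun v _ => if_neg ?_
    simp only [Quad, Bool.false_eq_true, if_false, if_true]
    omega

theorem sum_right (h : PermPair n Y X) {a v : ℕ} (ha : a < n) (hv : v < a) :
    (∑ u ∈ range n, if Quad Y SE a u ∧ Quad Y SW u v then (1 : R) else 0) =
      if Y v < Y a then ((Y a : R) - Y v) - cnt n Y a (Y a) + cnt n Y a (Y v) else 0 := by
  have hvn := hv.trans ha
  split_ifs with h₁
  · rw [cast_cnt, cast_cnt, ← h.sum_lt (h.y_lt a ha).le, ← h.sum_lt (h.y_lt v hvn).le,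
      ← sum_sub_distrib, ← sum_sub_distrib, ← sum_add_distrib]
    refine sum_congr rfl fun u hu => ?_
    have i₁ := h.y_inj (mem_range.1 hu) ha
    have i₂ := h.y_inj (mem_range.1 hu) hvn
    simp only [Quad, Bool.false_eq_true, if_false, if_true]
    rcases lt_trichotomy u a with h₃ | h₃ | h₃ <;>
      rcases lt_trichotomy (Y u) (Y a) with h₅ | h₅ | h₅ <;>
      rcases lt_trichotomy (Y v) (Y u) with h₆ | h₆ | h₆
    all_goals first | (exfalso; omega) | skip
    all_goals first | simp [h₃, h₅, h₆, h₃.not_gt, h₅.not_gt, h₆.not_gt]; done | skip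
    all_goals
      have h₇ : v < u := by omega
      simp [h₃, h₅, h₆, h₁.not_gt, h₃.not_gt, h₆.not_gt, h₇]
  · refine sum_eq_zero fun u _ => if_neg ?_
    simp only [Quad, Bool.false_eq_true, if_false, if_true]
    omega

theorem sum_below {a c u : ℕ} (hc : c < a) (hu : a < u) :
    (∑ v ∈ range n, if Quad Y SW c v ∧ Quad Y NE v u then (1 : R) else 0) =
      cnt n Y c (min (Y c) (Y u)) := by
  rw [cast_cnt]
  refine sum_congr rfl fun v _ => if_congr ?_ rfl rfl
  simp only [Quad, Bool.false_eq_true, if_false, if_true, lt_min_iff]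
  omega

theorem mid₃_eq (q : ℕ) (h : PermPair n Y X) {a c : ℕ} (ha : a < n) (hc : c < n) (h₁ : c < a)
    (h₂ : Y c < Y a) :
    mid₃ R n Y a c =
      (push n Y SW (push n Y SW fun v => if Y c / q < Y v / q then 1 else 0) a +
        ∑ v ∈ range n, if Y v / q = Y c / q then if Y c < Y v then mid₂ R n Y a v else 0 else 0) -
      (push n Y NW (push n Y NE fun u => if Y u / q < Y a / q then 1 else 0) c +
        ∑ u ∈ range n, if Y u / q = Y a / q then if Y u < Y a then if Y c < Y u then
          (cnt n Y (min c u) (Y u) : R) - cnt n Y (min c u) (Y c) else 0 else 0 else 0) +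
      (push n Y SE (push n Y SW fun v => if v / q < c / q then 1 else 0) a +
        ∑ v ∈ range n, if v / q = c / q then if v < c then if Y v < Y a then
          ((Y a : R) - Y v) - cnt n Y a (Y a) + cnt n Y a (Y v) else 0 else 0 else 0) -
      (push n Y SW (push n Y NE fun u => if a / q < u / q then 1 else 0) c +
        ∑ u ∈ range n, if u / q = a / q then if a < u then
          (cnt n Y c (min (Y c) (Y u)) : R) else 0 else 0) +
      push n Y NE (fun _ => 1) a * cnt n Y c (Y c) := by
  rw [mid₃_eq_push h ha hc h₁ h₂, push_push_ite_lt_slab q SW SW (fun _ => Y c) Y,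
    push_push_ite_lt_slab q NW NE Y (fun _ => Y a),
    push_push_ite_lt_slab q SE SW (fun v => v) (fun _ => c),
    push_push_ite_lt_slab q SW NE (fun _ => a) (fun u => u)]
  congr 1
  congr 1
  · congr 1
    · congr 1
      congr 1
      refine sum_congr rfl fun u _ => ?_
      rw [sum_between h hc]
      exact if_congr eq_comm rfl rfl
    · congr 1
      refine sum_congr rfl fun v _ => ?_
      by_cases hv : v < c
      · rw [sum_right h ha (hv.trans h₁)]
        exact if_congr eq_comm rfl rfl
      · simp [hv]
  · congr 1
    refine sum_congr rfl fun u _ => ?_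
    by_cases hu : a < u
    · rw [sum_below h₁ hu]
    · simp [hu]

theorem mid₃_eq_zero {a c : ℕ} (h : ¬ (c < a ∧ Y c < Y a)) : mid₃ R n Y a c = 0 := by
  refine sum_eq_zero fun u _ => sum_eq_zero fun v _ => if_neg ?_
  simp only [Quad, Bool.false_eq_true, if_false]
  omega

end Chains

section Reads

variable {R : ℕ → Prop} {a b x y : Ex} {c k r j : ℕ}

@[simp] theorem Ex.reads_add : (a + b).Reads R ↔ a.Reads R ∧ b.Reads R := Iff.rfl
@[simp] theorem Ex.reads_mul : (a * b).Reads R ↔ a.Reads R ∧ b.Reads R := Iff.rfl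
@[simp] theorem Ex.reads_div : (a / b).Reads R ↔ a.Reads R ∧ b.Reads R := Iff.rfl
@[simp] theorem Ex.reads_sub : (a - b).Reads R ↔ a.Reads R ∧ b.Reads R :=
  ⟨fun h => ⟨h.1, h.2.1⟩, fun h => ⟨h.1, h.2, trivial⟩⟩
@[simp] theorem Ex.reads_lit : (Ex.lit c).Reads R := trivial
@[simp] theorem Ex.reads_var : (Ex.var r).Reads R := trivial
@[simp] theorem Ex.reads_par : (Ex.par j).Reads R := trivial
@[simp] theorem Ex.reads_op {o : BinOp} : (Ex.op o a b).Reads R ↔ a.Reads R ∧ b.Reads R := Iff.rfl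
@[simp] theorem Ex.reads_rd : (Ex.rd k a).Reads R ↔ R k ∧ a.Reads R := Iff.rfl
@[simp] theorem Ex.reads_ite : (Ex.ite a b x y).Reads R ↔
    a.Reads R ∧ b.Reads R ∧ x.Reads R ∧ y.Reads R := Iff.rfl
@[simp] theorem Ex.reads_sum : (Ex.sum r j a).Reads R ↔ a.Reads R := Iff.rfl

end Reads

theorem natCast_inj_of_lt {w x y : ℕ} (hx : x < 2 ^ w) (hy : y < 2 ^ w)
    (h : (x : ZMod (2 ^ w)) = y) : x = y := by
  rwa [ZMod.natCast_eq_natCast_iff', Nat.mod_eq_of_lt hx, Nat.mod_eq_of_lt hy] at h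

section

variable {w κ n q lg : ℕ} {P Y X V : ℕ → ℕ} {A : ℕ → ℕ → ℕ}

theorem Sizes.lt_index (hs : Sizes w κ P n q lg) {x : ℕ} (hx : x ≤ (n + 2) ^ 2) :
    x < 2 ^ (w - κ) := (Dom.lt_of_sizes hs (hx.trans_lt (Dom.sq_le_cube n))).1

theorem Sizes.lt_word (hs : Sizes w κ P n q lg) {x : ℕ} (hx : x ≤ (n + 2) ^ 2) : x < 2 ^ w :=
  (Dom.lt_of_sizes hs (hx.trans_lt (Dom.sq_le_cube n))).2

theorem le_sq (n : ℕ) : 4 * n + 4 ≤ (n + 2) ^ 2 := by nlinarith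

theorem Sizes.lit_one (hs : Sizes w κ P n q lg) : (Ex.lit 1).eval w κ P A V = 1 :=
  Ex.eval_lit (hs.lt_word ((by omega : 1 ≤ 4 * n + 4).trans (le_sq n)))

theorem lit_zero : (Ex.lit 0).eval w κ P A V = 0 := Nat.zero_mod _

theorem Sizes.eval_flat (hs : Sizes w κ P n q lg) {a b : Ex} {S p : ℕ}
    (ha : a.eval w κ P A V = S) (hb : b.eval w κ P A V = p) (hS : S < n / q + 2) (hp : p < n) :
    (a * .par 0 + b).eval w κ P A V = S * n + p := by
  have h₁ := Dom.flat_lt hS hp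
  have e₁ : (a * .par 0).eval w κ P A V = S * n := by
    rw [Ex.eval_mul] <;> simp only [Ex.eval, hs.p0, ha]
    exact hs.lt_word (by omega)
  rw [Ex.eval_add] <;> rw [e₁, hb]
  exact hs.lt_word h₁.le

theorem Sizes.eval_rd_flat (hs : Sizes w κ P n q lg) {a b : Ex} {S p : ℕ} (k : ℕ)
    (ha : a.eval w κ P A V = S) (hb : b.eval w κ P A V = p) (hS : S < n / q + 2) (hp : p < n) :
    (Ex.rd k (a * .par 0 + b)).eval w κ P A V = A k (S * n + p) := by
  rw [Ex.eval_rd] <;> rw [hs.eval_flat ha hb hS hp]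
  exact hs.lt_index (Dom.flat_lt hS hp).le

theorem Sizes.eval_rd_pt (hs : Sizes w κ P n q lg) {a : Ex} {p : ℕ} (k : ℕ)
    (ha : a.eval w κ P A V = p) (hp : p < n) : (Ex.rd k a).eval w κ P A V = A k p := by
  rw [Ex.eval_rd] <;> rw [ha]
  exact hs.lt_index (by have := le_sq n; omega)

theorem Sizes.eval_slab (hs : Sizes w κ P n q lg) {a : Ex} {x : ℕ}
    (ha : a.eval w κ P A V = x) (hx : x < n) : (a / .par 1).eval w κ P A V = x / q := by
  have := le_sq n
  rw [Ex.eval_div] <;> rw [ha]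
  · simp only [Ex.eval, hs.p1]
  · exact hs.lt_word (by omega)

/-- The entry `t` of the slab of `a`. -/
def Ex.slabPt (a t : Ex) : Ex := a / .par 1 * .par 1 + t

theorem Sizes.eval_slabPt (hs : Sizes w κ P n q lg) {a b : Ex} {x t : ℕ}
    (ha : a.eval w κ P A V = x) (hb : b.eval w κ P A V = t) (hx : x < n) (ht : t < q) :
    (a.slabPt b).eval w κ P A V = x / q * q + t := by
  have h₁ := le_sq n
  have h₂ := Nat.div_mul_le_self x q
  have h₃ := hs.q_le
  have e₁ : (a / .par 1 * .par 1).eval w κ P A V = x / q * q := by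
    rw [Ex.eval_mul] <;> rw [hs.eval_slab ha hx] <;> simp only [Ex.eval, hs.p1]
    exact hs.lt_word (by omega)
  rw [Ex.slabPt, Ex.eval_add] <;> rw [e₁, hb]
  exact hs.lt_word (by omega)

/-- The row of the entry `var 0` of an array of rows. -/
def Ex.row : Ex := .var 0 / .par 0

/-- The column of the entry `var 0` of an array of rows. -/
def Ex.col : Ex := .op .mod (.var 0) (.par 0)

theorem Sizes.eval_row (hs : Sizes w κ P n q lg) {S p : ℕ} (hS : S < n / q + 2) (hp : p < n) :
    Ex.row.eval w κ P A (Function.update V 0 (S * n + p)) = S := by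
  rw [Ex.row, Ex.eval_div]
  · simp only [Ex.eval, hs.p0, Function.update_self]
    rw [mul_comm, Nat.mul_add_div (by omega), Nat.div_eq_of_lt hp, add_zero]
  · simp only [Ex.eval, Function.update_self]
    exact hs.lt_word (Dom.flat_lt hS hp).le

theorem Sizes.eval_col (hs : Sizes w κ P n q lg) {S p : ℕ} (hS : S < n / q + 2) (hp : p < n) :
    Ex.col.eval w κ P A (Function.update V 0 (S * n + p)) = p := by
  rw [Ex.col, Ex.eval_mod]
  · simp only [Ex.eval, hs.p0, Function.update_self]
    rw [mul_comm, Nat.mul_add_mod, Nat.mod_eq_of_lt hp]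
  · simp only [Ex.eval, Function.update_self]
    exact hs.lt_word (Dom.flat_lt hS hp).le

theorem exec_table_of_ne {k k' j : ℕ} (e : Ex) (h : k' ≠ k) :
    (St.table k j e).exec w κ P V A k' = A k' :=
  St.exec_of_writes (.loop 0 j (.store k (.var 0) e)) h.symm V A

theorem Sizes.exec_table_flat (hs : Sizes w κ P n q lg) {k : ℕ} {e : Ex} (he : e.Reads (· ≠ k))
    {S p : ℕ} (hS : S < n / q + 2) (hp : p < n) :
    (St.table k 3 e).exec w κ P V A k (S * n + p) =
      e.eval w κ P A (Function.update V 0 (S * n + p)) := by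
  have h₁ : n / q ≤ n := Nat.div_le_self _ _
  refine St.exec_table he ?_ _ ?_
  · rw [hs.p3]
    exact (hs.lt_index (by nlinarith [Nat.mul_le_mul_right n (show n / q + 2 ≤ n + 2 by omega)])).le
  · rw [hs.p3]; nlinarith [Nat.mul_le_mul_right n (show S + 1 ≤ n / q + 2 by omega)]

theorem Sizes.rows_table (hs : Sizes w κ P n q lg) {k : ℕ} {e : Ex} (he : e.Reads (· ≠ k))
    {f : ℕ → ℕ → ZMod (2 ^ w)} (h : ∀ S < n / q + 2, ∀ p < n,
      (e.eval w κ P A (Function.update V 0 (S * n + p)) : ZMod (2 ^ w)) = f S p) :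
    Rows w n (n / q + 2) ((St.table k 3 e).exec w κ P V A) k f := fun S hS p hp => by
  rw [hs.exec_table_flat he hS hp, h S hS p hp]

theorem Rows.congr {A' : ℕ → ℕ → ℕ} {k rows : ℕ} {f : ℕ → ℕ → ZMod (2 ^ w)}
    (h : Rows w n rows A k f) (hA : A' k = A k) : Rows w n rows A' k f := fun S hS p hp => by
  rw [hA, h S hS p hp]

theorem div_lt_rows {x : ℕ} (hx : x < n) : x / q < n / q + 2 := by
  have := Nat.div_le_div_right (c := q) hx.le
  omega

end

/-! ### Counting points below and to the left of a place in constant time -/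

/-- The number of points of the first `S` slabs that are below `y`. -/
def Ex.slabs (S y : Ex) : Ex := .rd 5 (S * .par 0 + y)

/-- The number of points to the left of `x` and below `y`. -/
def Ex.cnt (x y : Ex) : Ex :=
  .slabs (x / .par 1) y +
    .rd 6 (x * (.par 1 + .lit 1) + (.slabs (x / .par 1 + .lit 1) y - .slabs (x / .par 1) y))

/-- The program for the tables of `Ex.slabs` and `Ex.cnt`. -/
def cntTables : St :=
  .seq (.table 8 3 (.ite .col (.row * .par 1) (.lit 1) (.lit 0))) <|
  .seq (dom SW 8 9) <| .seq (dom SE 8 10) <|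
  .seq (.table 5 3 (.rd 9 (.row * .par 0 + .rd 2 .col) + .rd 10 (.row * .par 0 + .rd 2 .col))) <|
  .table 6 4 <| .sum 4 1 <|
    let x : Ex := .var 0 / (.par 1 + .lit 1)
    let p := x.slabPt (.var 4)
    .ite p x
      (.ite (.slabs (p / .par 1 + .lit 1) (.rd 1 p) - .slabs (p / .par 1) (.rd 1 p))
        (.op .mod (.var 0) (.par 1 + .lit 1)) (.lit 1) (.lit 0))
      (.lit 0)

/-- The arrays hold a permutation, its inverse, and the tables of `cntTables`. -/
structure Base (w n q : ℕ) (Y X : ℕ → ℕ) (A : ℕ → ℕ → ℕ) : Prop where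
  y : ∀ x < n, A 1 x = Y x
  x : ∀ y < n, A 2 y = X y
  slabs : ∀ S < n / q + 2, ∀ y < n, A 5 (S * n + y) = cnt n Y (S * q) y
  slabCnt : ∀ x < n, ∀ r ≤ q, (A 6 (x * (q + 1) + r) : ZMod (2 ^ w)) = slabCnt n q Y x r

theorem Base.congr {w n q : ℕ} {Y X : ℕ → ℕ} {A A' : ℕ → ℕ → ℕ} (h : Base w n q Y X A)
    (h₁ : A' 1 = A 1) (h₂ : A' 2 = A 2) (h₅ : A' 5 = A 5) (h₆ : A' 6 = A 6) :
    Base w n q Y X A' :=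
  ⟨h₁ ▸ h.y, h₂ ▸ h.x, h₅ ▸ h.slabs, h₆ ▸ h.slabCnt⟩

section

variable {w κ n q lg : ℕ} {P Y X V : ℕ → ℕ} {A : ℕ → ℕ → ℕ}

theorem Sizes.eval_slabs (hs : Sizes w κ P n q lg) (h5 : ∀ S < n / q + 2, ∀ y < n,
      A 5 (S * n + y) = WordRAM.cnt n Y (S * q) y)
    {a b : Ex} {S y : ℕ} (ha : a.eval w κ P A V = S) (hb : b.eval w κ P A V = y)
    (hS : S < n / q + 2) (hy : y < n) :
    (Ex.slabs a b).eval w κ P A V = WordRAM.cnt n Y (S * q) y := by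
  rw [Ex.slabs, hs.eval_rd_flat 5 ha hb hS hy, h5 S hS y hy]

theorem Sizes.eval_succ_slab (hs : Sizes w κ P n q lg) {a : Ex} {x : ℕ}
    (ha : a.eval w κ P A V = x) (hx : x < n) :
    (a / .par 1 + .lit 1).eval w κ P A V = x / q + 1 := by
  have h₁ := Nat.div_le_self x q
  have h₂ := le_sq n
  rw [Ex.eval_add] <;> rw [hs.eval_slab ha hx, hs.lit_one]
  exact hs.lt_word (by omega)

/-- The rank of a height within a slab. -/
theorem Sizes.eval_rank (hs : Sizes w κ P n q lg) (h5 : ∀ S < n / q + 2, ∀ y < n,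
      A 5 (S * n + y) = WordRAM.cnt n Y (S * q) y)
    {a b : Ex} {x y : ℕ} (ha : a.eval w κ P A V = x) (hb : b.eval w κ P A V = y)
    (hx : x < n) (hy : y < n) :
    (Ex.slabs (a / .par 1 + .lit 1) b - Ex.slabs (a / .par 1) b).eval w κ P A V =
      WordRAM.cnt n Y ((x / q + 1) * q) y - WordRAM.cnt n Y (x / q * q) y := by
  have h₁ : x / q + 1 < n / q + 2 := by
    have := Nat.div_le_div_right (c := q) hx.le
    omega
  have h₂ := le_sq n
  have h₃ := cnt_le (n := n) (Y := Y) ((x / q + 1) * q) y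
  have e₁ := hs.eval_slabs h5 (hs.eval_succ_slab ha hx) hb h₁ hy
  have e₂ := hs.eval_slabs h5 (hs.eval_slab ha hx) hb (by omega) hy
  rw [Ex.eval_sub] <;> rw [e₁]
  · rw [e₂]
  · exact hs.lt_word (by omega)
  · rw [e₂]
    exact cnt_mono (Nat.mul_le_mul_right q (by omega)) le_rfl

theorem rank_le (hq : 0 < q) (S y : ℕ) :
    WordRAM.cnt n Y ((S + 1) * q) y - WordRAM.cnt n Y (S * q) y ≤ q := by
  rw [cnt_slab_sub hq]
  refine (card_le_card (t := Ico (S * q) ((S + 1) * q)) fun p hp => ?_).trans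
    (by rw [Nat.card_Ico, Nat.succ_mul]; omega)
  simp only [mem_filter, mem_Ico] at hp ⊢
  have := (div_eq_iff_mem_slab hq p S).1 hp.2.1
  omega

theorem Base.eval_cnt (hs : Sizes w κ P n q lg) (hb : Base w n q Y X A) {a b : Ex} {x y : ℕ}
    (ha : a.eval w κ P A V = x) (hb' : b.eval w κ P A V = y) (hx : x < n) (hy : y < n) :
    ((Ex.cnt a b).eval w κ P A V : ZMod (2 ^ w)) = WordRAM.cnt n Y x y := by
  have hq : 0 < q := hs.q_pos (by omega)
  have e₁ := hs.eval_rank hb.slabs ha hb' hx hy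
  have h₁ := rank_le (n := n) (Y := Y) hq (x / q) y
  have h₂ := le_sq n
  have h₃ := hs.q_le
  have h₄ : x * (q + 1) + q ≤ (n + 2) ^ 2 := by
    nlinarith [Nat.mul_le_mul hx.le (show q + 1 ≤ n + 1 by omega)]
  have e₂ : (Ex.par 1 + .lit 1).eval w κ P A V = q + 1 := by
    rw [Ex.eval_add] <;> rw [hs.lit_one] <;> simp only [Ex.eval, hs.p1]
    exact hs.lt_word (by omega)
  have e₃ : (a * (.par 1 + .lit 1)).eval w κ P A V = x * (q + 1) := by
    rw [Ex.eval_mul] <;> rw [ha, e₂]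
    exact hs.lt_word (by omega)
  rw [Ex.cnt, Ex.cast_eval_add, hs.eval_slabs hb.slabs (hs.eval_slab ha hx) hb' (div_lt_rows hx) hy,
    Ex.eval_rd, Ex.eval_add, e₃, e₁, hb.slabCnt x hx _ h₁, cnt_eq hq x y, Nat.cast_add]
  · rw [e₃, e₁]; exact hs.lt_word (by omega)
  · rw [Ex.eval_add] <;> rw [e₃, e₁]
    · exact hs.lt_index (by omega)
    · exact hs.lt_word (by omega)

theorem writes_cntTables : cntTables.Writes (· ∈ ({3, 5, 6, 8, 9, 10} : Set ℕ)) := by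
  simp [cntTables, dom, St.table, Dom.step, St.Writes]

theorem exec_cntTables (hs : Sizes w κ P n q lg) (h : PermPair n Y X)
    (h₁ : ∀ x < n, A 1 x = Y x) (h₂ : ∀ y < n, A 2 y = X y) :
    Base w n q Y X (cntTables.exec w κ P V A) := by
  simp only [cntTables, St.exec]
  set A₁ := (St.table 8 3 (.ite .col (.row * .par 1) (.lit 1) (.lit 0))).exec w κ P V A with hA₁
  set A₂ := (dom SW 8 9).exec w κ P V A₁ with hA₂
  set A₃ := (dom SE 8 10).exec w κ P V A₂ with hA₃
  set A₄ := (St.table 5 3 (.rd 9 (.row * .par 0 + .rd 2 .col) +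
    .rd 10 (.row * .par 0 + .rd 2 .col))).exec w κ P V A₃ with hA₄
  have f₁ : ∀ k ≠ 8, A₁ k = A k := fun k hk => exec_table_of_ne _ hk
  have f₂ : ∀ k, k ≠ 9 → k ≠ 3 → A₂ k = A₁ k := fun k hk hk' => exec_dom_of_ne hk hk' _ _
  have f₃ : ∀ k, k ≠ 10 → k ≠ 3 → A₃ k = A₂ k := fun k hk hk' => exec_dom_of_ne hk hk' _ _
  have f₄ : ∀ k ≠ 5, A₄ k = A₃ k := fun k hk => exec_table_of_ne _ hk
  have r₁ : Rows w n (n / q + 2) A₁ 8 fun S p => if p < S * q then 1 else 0 := by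
    refine hs.rows_table (by simp [Ex.row, Ex.col]) fun S hS p hp => ?_
    have hSq : S * q ≤ (n + 2) ^ 2 := by
      have := Nat.div_mul_le_self n q
      have := hs.q_le
      nlinarith [Nat.mul_le_mul_right q (show S ≤ n / q + 1 by omega)]
    have e₁ : (Ex.row * .par 1).eval w κ P A (Function.update V 0 (S * n + p)) = S * q := by
      rw [Ex.eval_mul] <;> rw [hs.eval_row hS hp] <;> simp only [Ex.eval, hs.p1]
      exact hs.lt_word hSq
    rw [Ex.cast_eval_ite, hs.eval_col hS hp, e₁, hs.lit_one, lit_zero]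
    split_ifs <;> simp
  have r₂ : Rows w n (n / q + 2) A₂ 9 fun S => push n Y SW fun p => if p < S * q then 1 else 0 :=
    exec_dom hs h (by norm_num) (by norm_num) (by norm_num) (by norm_num)
      (fun y hy => by rw [f₁ 2 (by norm_num), h₂ y hy]) r₁ V
  have r₃ : Rows w n (n / q + 2) A₃ 10 fun S => push n Y SE fun p => if p < S * q then 1 else 0 :=
    exec_dom hs h (by norm_num) (by norm_num) (by norm_num) (by norm_num)
      (fun y hy => by rw [f₂ 2 (by norm_num) (by norm_num), f₁ 2 (by norm_num), h₂ y hy])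
      (r₁.congr (f₂ 8 (by norm_num) (by norm_num))) V
  have r₂' := r₂.congr (f₃ 9 (by norm_num) (by norm_num))
  have h₂' : ∀ y < n, A₃ 2 y = X y := fun y hy => by
    rw [f₃ 2 (by norm_num) (by norm_num), f₂ 2 (by norm_num) (by norm_num), f₁ 2 (by norm_num),
      h₂ y hy]
  have h₅ : ∀ S < n / q + 2, ∀ y < n, A₄ 5 (S * n + y) = WordRAM.cnt n Y (S * q) y := by
    intro S hS y hy
    rw [hA₄, hs.exec_table_flat (by simp [Ex.row, Ex.col]) hS hy]
    have ex : (Ex.rd 2 .col).eval w κ P A₃ (Function.update V 0 (S * n + y)) = X y := by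
      rw [hs.eval_rd_pt 2 (hs.eval_col hS hy) hy, h₂' y hy]
    have hx := h.x_lt y hy
    refine natCast_inj_of_lt (BinOp.eval_lt _ _ _ _)
      (hs.lt_word ((cnt_le _ _).trans (by have := le_sq n; omega))) ?_
    rw [Ex.cast_eval_add, hs.eval_rd_flat 9 (hs.eval_row hS hy) ex hS hx,
      hs.eval_rd_flat 10 (hs.eval_row hS hy) ex hS hx, r₂' S hS _ hx, r₃ S hS _ hx, cast_cnt]
    simp only [push, ← sum_add_distrib]
    refine sum_congr rfl fun u hu => ?_
    have := h.y_inj (mem_range.1 hu) hx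
    rw [h.yx y hy] at this
    simp only [Quad, Bool.false_eq_true, if_false, if_true, h.yx y hy]
    rcases lt_trichotomy u (X y) with h' | h' | h' <;> by_cases h'' : Y u < y <;>
      first | (exfalso; omega) | simp [h', h'', h'.not_gt, h.yx y hy]
  refine ⟨fun x hx => ?_, fun y hy => ?_, fun S hS y hy => ?_, fun x hx r hr => ?_⟩
  · rw [exec_table_of_ne _ (by norm_num), f₄ 1 (by norm_num), f₃ 1 (by norm_num) (by norm_num),
      f₂ 1 (by norm_num) (by norm_num), f₁ 1 (by norm_num), h₁ x hx]
  · rw [exec_table_of_ne _ (by norm_num), f₄ 2 (by norm_num), h₂' y hy]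
  · rw [exec_table_of_ne _ (by norm_num), h₅ S hS y hy]
  · have hq : 0 < q := hs.q_pos (by omega)
    have hlt := le_sq n
    have hqn := hs.q_le
    have hP4 : n * (q + 1) ≤ (n + 2) ^ 2 := by nlinarith
    have hxr : x * (q + 1) + r < n * (q + 1) := by
      nlinarith [Nat.mul_le_mul_right (q + 1) (show x + 1 ≤ n by omega)]
    rw [St.exec_table (by simp [Ex.slabPt, Ex.slabs]) (by rw [hs.p4]; exact (hs.lt_index hP4).le)
      _ (by rw [hs.p4]; exact hxr), Ex.cast_eval_sum, hs.p1, WordRAM.slabCnt, card_filter,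
      Nat.cast_sum]
    have e₀ : ∀ V : ℕ → ℕ, (Ex.par 1 + .lit 1).eval w κ P A₄ V = q + 1 := fun V => by
      rw [Ex.eval_add] <;> rw [hs.lit_one] <;> simp only [Ex.eval, hs.p1]
      exact hs.lt_word (by omega)
    have e₁ : ∀ t, (Ex.var 0 / (.par 1 + .lit 1)).eval w κ P A₄
        (Function.update (Function.update V 0 (x * (q + 1) + r)) 4 t) = x := fun t => by
      have e : (Ex.var 0).eval w κ P A₄
          (Function.update (Function.update V 0 (x * (q + 1) + r)) 4 t) = x * (q + 1) + r := by
        simp [Ex.eval]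
      rw [Ex.eval_div] <;> rw [e]
      · rw [e₀, mul_comm, Nat.mul_add_div (by omega), Nat.div_eq_of_lt (by omega), add_zero]
      · exact hs.lt_word (by omega)
    have e₂ : ∀ t, (Ex.op .mod (.var 0) (.par 1 + .lit 1)).eval w κ P A₄
        (Function.update (Function.update V 0 (x * (q + 1) + r)) 4 t) = r := fun t => by
      have e : (Ex.var 0).eval w κ P A₄
          (Function.update (Function.update V 0 (x * (q + 1) + r)) 4 t) = x * (q + 1) + r := by
        simp [Ex.eval]
      rw [Ex.eval_mod] <;> rw [e]
      · rw [e₀, mul_comm, Nat.mul_add_mod, Nat.mod_eq_of_lt (by omega)]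
      · exact hs.lt_word (by omega)
    have hY : ∀ p < n, A₄ 1 p = Y p := fun p hp => by
      rw [f₄ 1 (by norm_num), f₃ 1 (by norm_num) (by norm_num), f₂ 1 (by norm_num) (by norm_num),
        f₁ 1 (by norm_num), h₁ p hp]
    refine Eq.trans (b := ∑ t ∈ range q, if x / q * q + t < n then
      if x / q * q + t < x ∧ WordRAM.cnt n Y (((x / q * q + t) / q + 1) * q) (Y (x / q * q + t)) -
        WordRAM.cnt n Y ((x / q * q + t) / q * q) (Y (x / q * q + t)) < r then (1 : ZMod (2 ^ w))
          else 0 else 0) (sum_congr rfl fun t ht => ?_) ?_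
    · have ht := mem_range.1 ht
      have e₃ := hs.eval_slabPt (e₁ t) (b := .var 4) (t := t)
        (by simp only [Ex.eval, Function.update_self]) hx ht
      rw [Ex.cast_eval_ite, e₃, e₁ t]
      by_cases hp : x / q * q + t < x
      · have hpn := hp.trans hx
        have e₄ := hs.eval_rd_pt 1 e₃ hpn
        rw [hY _ hpn] at e₄
        rw [if_pos hp, if_pos hpn, Ex.cast_eval_ite, hs.eval_rank h₅ e₃ e₄ hpn (h.y_lt _ hpn),
          e₂ t, Ex.cast_eval_lit, Ex.cast_eval_lit]
        simp only [hp, true_and, Nat.cast_one, Nat.cast_zero]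
      · rw [if_neg hp, Ex.cast_eval_lit]
        simp [hp]
    · rw [sum_slab hq (x / q) (fun p => if p < x ∧ WordRAM.cnt n Y ((p / q + 1) * q) (Y p) -
        WordRAM.cnt n Y (p / q * q) (Y p) < r then (1 : ZMod (2 ^ w)) else 0)]
      refine sum_congr rfl fun p _ => ?_
      simp only [ite_and, Nat.cast_ite, Nat.cast_one, Nat.cast_zero]

end

section

variable {w κ n q lg : ℕ} {P Y X V : ℕ → ℕ} {A : ℕ → ℕ → ℕ}

/-- The sum of `e` over the values of the variable `r` below `q` for which the corresponding entry
of the slab of `a` is a point. -/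
def Ex.sumSlab (r : ℕ) (a e : Ex) : Ex := .sum r 1 (.ite (a.slabPt (.var r)) (.par 0) e (.lit 0))

theorem Sizes.eval_slabPt_var (hs : Sizes w κ P n q lg) {a : Ex} {x t r : ℕ}
    (ha : a.eval w κ P A V = x) (hr : V r = t) (hx : x < n) (ht : t < q) :
    (a.slabPt (.var r)).eval w κ P A V = x / q * q + t :=
  hs.eval_slabPt ha (by simpa only [Ex.eval] using hr) hx ht

theorem Sizes.eval_sumSlab (hs : Sizes w κ P n q lg) {r x : ℕ} {a e : Ex}
    {g : ℕ → ZMod (2 ^ w)} (ha : ∀ t, a.eval w κ P A (Function.update V r t) = x) (hx : x < n)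
    (he : ∀ t < q, x / q * q + t < n →
      (e.eval w κ P A (Function.update V r t) : ZMod (2 ^ w)) = g (x / q * q + t)) :
    ((Ex.sumSlab r a e).eval w κ P A V : ZMod (2 ^ w)) =
      ∑ p ∈ range n, if p / q = x / q then g p else 0 := by
  rw [← sum_slab (hs.q_pos (by omega)), Ex.sumSlab, Ex.cast_eval_sum, hs.p1]
  refine sum_congr rfl fun t ht => ?_
  have ht := mem_range.1 ht
  have e₁ := hs.eval_slabPt_var (ha t) (Function.update_self r t V) hx ht
  rw [Ex.cast_eval_ite, e₁, Ex.cast_eval_lit, show (Ex.par 0).eval w κ P A (Function.update V r t) = n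
    from hs.p0]
  split_ifs with h
  · rw [he t ht h]
  · simp

theorem Sizes.eval_sumSlab' (hs : Sizes w κ P n q lg) (h : PermPair n Y X) {r y : ℕ} {a e : Ex}
    {g : ℕ → ZMod (2 ^ w)} (ha : ∀ t, a.eval w κ P A (Function.update V r t) = y) (hy : y < n)
    (he : ∀ t < q, y / q * q + t < n →
      (e.eval w κ P A (Function.update V r t) : ZMod (2 ^ w)) = g (X (y / q * q + t))) :
    ((Ex.sumSlab r a e).eval w κ P A V : ZMod (2 ^ w)) =
      ∑ p ∈ range n, if Y p / q = y / q then g p else 0 := by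
  rw [hs.eval_sumSlab (g := fun y => g (X y)) ha hy he,
    ← h.sum_comp fun p => if Y p / q = y / q then g p else 0]
  exact sum_congr rfl fun p hp => by rw [h.yx p (mem_range.1 hp)]

/-- The number of points strictly between `c` and `a`. -/
def Ex.mid₂ (a c : Ex) : Ex :=
  .ite c a (.ite (.rd 1 c) (.rd 1 a)
    (cnt a (.rd 1 a) - cnt a (.rd 1 c) - cnt c (.rd 1 a) + cnt c (.rd 1 c) - .lit 1)
    (.lit 0)) (.lit 0)

theorem Base.eval_y (hs : Sizes w κ P n q lg) (hb : Base w n q Y X A) {a : Ex} {x : ℕ}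
    (ha : a.eval w κ P A V = x) (hx : x < n) : (Ex.rd 1 a).eval w κ P A V = Y x := by
  rw [hs.eval_rd_pt 1 ha hx, hb.y x hx]

theorem Base.eval_x (hs : Sizes w κ P n q lg) (hb : Base w n q Y X A) {a : Ex} {y : ℕ}
    (ha : a.eval w κ P A V = y) (hy : y < n) : (Ex.rd 2 a).eval w κ P A V = X y := by
  rw [hs.eval_rd_pt 2 ha hy, hb.x y hy]

theorem Base.eval_mid₂ (hs : Sizes w κ P n q lg) (h : PermPair n Y X) (hb : Base w n q Y X A)
    {a c : Ex} {x z : ℕ} (ha : a.eval w κ P A V = x) (hc : c.eval w κ P A V = z) (hx : x < n)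
    (hz : z < n) :
    ((Ex.mid₂ a c).eval w κ P A V : ZMod (2 ^ w)) = WordRAM.mid₂ (ZMod (2 ^ w)) n Y x z := by
  have hya := hb.eval_y hs ha hx
  have hyc := hb.eval_y hs hc hz
  have hx' := h.y_lt x hx
  have hz' := h.y_lt z hz
  rw [mid₂_eq h hx hz]
  simp only [Ex.mid₂, Ex.cast_eval_ite, Ex.cast_eval_sub, Ex.cast_eval_add, Ex.cast_eval_lit, ha,
    hc, hya, hyc, hb.eval_cnt hs ha hya hx hx', hb.eval_cnt hs ha hyc hx hz',
    hb.eval_cnt hs hc hya hz hx', hb.eval_cnt hs hc hyc hz hz', Nat.cast_zero, Nat.cast_one]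

/-- The sum of `tripleSum_eq`, for weights in array `7` and values `mid`; the arrays `T` and `H`
hold the sums over full slabs. -/
def slabSum (T H : ℕ) (mid : Ex → Ex → Ex) : Ex :=
  let b : Ex := .var 4
  let a := b.slabPt (.var 5)
  let y := (Ex.rd 1 b).slabPt (.var 6)
  .sum 4 0 (.rd 7 b * .rd T (b / .par 1 * .par 0 + b)) +
    .sum 4 0 (.sumSlab 5 b (.ite b a (.rd 7 a * .rd H (.rd 1 b / .par 1 * .par 0 + a)) (.lit 0))) +
    .sum 4 0 (.sumSlab 5 b (.ite b a (.rd 7 a *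
      .sumSlab 6 (.rd 1 b) (.ite (.rd 1 b) y (mid a (.rd 2 y)) (.lit 0))) (.lit 0)))

theorem Base.eval_slabSum (hs : Sizes w κ P n q lg) (h : PermPair n Y X) (hb : Base w n q Y X A)
    {T H : ℕ} {mid : Ex → Ex → Ex} {W : ℕ → ZMod (2 ^ w)} {M : ℕ → ℕ → ZMod (2 ^ w)}
    {F : (ℕ → ZMod (2 ^ w)) → ℕ → ZMod (2 ^ w)} (hF : ∀ g a, ∑ c ∈ range n, g c * M a c = F g a)
    (hW : ∀ a < n, (A 7 a : ZMod (2 ^ w)) = W a)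
    (hT : Rows w n (n / q + 2) A T fun S => F fun c => cnt n Y (S * q) (Y c))
    (hH : Rows w n (n / q + 2) A H fun S => F fun c => if S < Y c / q then 1 else 0)
    (hM : ∀ V : ℕ → ℕ, ∀ x < n, ∀ z < n, ∀ a c : Ex,
      (∀ t, a.eval w κ P A (Function.update V 7 t) = x) →
      (∀ t, c.eval w κ P A (Function.update V 7 t) = z) →
      ((mid a c).eval w κ P A V : ZMod (2 ^ w)) = M x z) :
    ((slabSum T H mid).eval w κ P A V : ZMod (2 ^ w)) =
      tripleSum n Y fun a c => W a * M a c := by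
  have m1 : ∀ a (g : ℕ → ZMod (2 ^ w)),
      ∑ c ∈ range n, g c * (W a * M a c) = W a * F g a := fun a g => by
    rw [← hF, mul_sum]
    exact sum_congr rfl fun c _ => by ring
  rw [tripleSum_eq q]
  simp only [slabSum, Ex.cast_eval_add]
  congr 1
  · congr 1
    · rw [Ex.cast_eval_sum, hs.p0]
      refine sum_congr rfl fun a ha => ?_
      have ha := mem_range.1 ha
      have e₁ : (Ex.var 4).eval w κ P A (Function.update V 4 a) = a := Function.update_self ..
      rw [Ex.cast_eval_mul, hs.eval_rd_pt 7 e₁ ha,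
        hs.eval_rd_flat T (hs.eval_slab e₁ ha) e₁ (div_lt_rows ha) ha, hW a ha,
        hT _ (div_lt_rows ha) a ha, m1 a fun c => ∑ b ∈ range n, if b / q < a / q ∧ Y b < Y c then
          (1 : ZMod (2 ^ w)) else 0]
      refine congrArg (W a * F · a) (funext fun c => ?_)
      rw [cast_cnt]
      refine sum_congr rfl fun p _ => if_congr (and_congr_left fun _ => ?_) rfl rfl
      exact (Nat.div_lt_iff_lt_mul (hs.q_pos (by omega))).symm
    · rw [Ex.cast_eval_sum, hs.p0]
      refine sum_congr rfl fun b hb' => ?_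
      have hbn := mem_range.1 hb'
      refine (hs.eval_sumSlab (x := b) (g := fun a => if b < a then ∑ c ∈ range n,
        if Y b / q < Y c / q then W a * M a c else 0 else 0) (fun t => ?_) hbn
        fun t ht hp => ?_).trans (sum_congr rfl fun a _ => rfl)
      · simp [Ex.eval]
      · set V' := Function.update (Function.update V 4 b) 5 t with hV'
        have e₁ : (Ex.var 4).eval w κ P A V' = b := by simp [Ex.eval, hV']
        have e₂ := hs.eval_slabPt_var (V := V') (r := 5) e₁ (Function.update_self ..) hbn ht
        have e₃ := hb.eval_y hs e₁ hbn
        have hy := h.y_lt b hbn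
        rw [Ex.cast_eval_ite, Ex.cast_eval_mul, e₁, e₂, hs.eval_rd_pt 7 e₂ hp,
          hs.eval_rd_flat H (hs.eval_slab e₃ hy) e₂ (div_lt_rows hy) hp, hW _ hp,
          hH _ (div_lt_rows hy) _ hp, ← m1, Ex.cast_eval_lit, Nat.cast_zero]
        simp only [ite_mul, one_mul, zero_mul]
  · rw [Ex.cast_eval_sum, hs.p0]
    refine sum_congr rfl fun b hb' => ?_
    have hbn := mem_range.1 hb'
    refine (hs.eval_sumSlab (x := b) (g := fun a => if b < a then ∑ c ∈ range n,
      if Y c / q = Y b / q then if Y b < Y c then W a * M a c else 0 else 0 else 0)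
      (fun t => ?_) hbn fun t ht hp => ?_).trans (sum_congr rfl fun a _ => rfl)
    · simp [Ex.eval]
    · set V' := Function.update (Function.update V 4 b) 5 t with hV'
      have e₁ : (Ex.var 4).eval w κ P A V' = b := by simp [Ex.eval, hV']
      have e₂ := hs.eval_slabPt_var (V := V') (r := 5) e₁ (Function.update_self ..) hbn ht
      have hy := h.y_lt b hbn
      have f₁ : ∀ s, (Ex.var 4).eval w κ P A (Function.update V' 6 s) = b := fun s => by
        simp [Ex.eval, hV']
      rw [Ex.cast_eval_ite, Ex.cast_eval_mul, e₁, e₂, hs.eval_rd_pt 7 e₂ hp, hW _ hp,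
        Ex.cast_eval_lit, Nat.cast_zero]
      refine if_congr Iff.rfl ?_ rfl
      rw [hs.eval_sumSlab' h (V := V') (y := Y b) (g := fun c => if Y b < Y c then
        M (b / q * q + t) c else 0) (fun s => hb.eval_y hs (f₁ s) hbn) hy fun s hs' hp' => ?_,
        mul_sum]
      · refine sum_congr rfl fun c _ => ?_
        split_ifs <;> simp
      · have f₂ : ∀ u, (Ex.var 4).eval w κ P A (Function.update (Function.update V' 6 s) 7 u) = b :=
          fun u => by simp [Ex.eval, hV']
        have f₃ : ∀ u, ((Ex.rd 1 (.var 4)).slabPt (.var 6)).eval w κ P A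
            (Function.update (Function.update V' 6 s) 7 u) = Y b / q * q + s := fun u =>
          hs.eval_slabPt_var (hb.eval_y hs (f₂ u) hbn) (by simp) hy hs'
        have f₄ := hs.eval_slabPt_var (V := Function.update V' 6 s) (r := 6)
          (hb.eval_y hs (f₁ s) hbn) (Function.update_self ..) hy hs'
        rw [Ex.cast_eval_ite, f₄, hb.eval_y hs (f₁ s) hbn, Ex.cast_eval_lit, Nat.cast_zero,
          h.yx _ hp']
        refine if_congr Iff.rfl ?_ rfl
        exact hM _ _ hp _ (h.x_lt _ hp') _ _
          (fun u => hs.eval_slabPt_var (f₂ u) (by simp [hV']) hbn ht)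
          fun u => hb.eval_x hs (f₃ u) hp'

end

section

variable {w κ n q lg : ℕ} {P Y X V : ℕ → ℕ} {A : ℕ → ℕ → ℕ}

/-- The smaller value. -/
def Ex.min (a b : Ex) : Ex := .ite a b a b

theorem Ex.eval_min {a b : Ex} {x y : ℕ} (ha : a.eval w κ P A V = x)
    (hb : b.eval w κ P A V = y) : (Ex.min a b).eval w κ P A V = Min.min x y := by
  rw [Ex.min, Ex.eval, ha, hb]
  split_ifs with h
  · exact (min_eq_left h.le).symm
  · exact (min_eq_right (not_lt.1 h)).symm

/-- The arrays that are needed for `Ex.mid₃`. -/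
structure Mid₃Tables (w n q : ℕ) (Y : ℕ → ℕ) (A : ℕ → ℕ → ℕ) : Prop where
  t2 : Rows w n (n / q + 2) A 11 fun S =>
    push n Y SW (push n Y SW fun v => if S < Y v / q then 1 else 0)
  t3 : Rows w n (n / q + 2) A 13 fun S =>
    push n Y NW (push n Y NE fun u => if Y u / q < S then 1 else 0)
  t5 : Rows w n (n / q + 2) A 14 fun S =>
    push n Y SE (push n Y SW fun v => if v / q < S then 1 else 0)
  t6 : Rows w n (n / q + 2) A 15 fun S =>
    push n Y SW (push n Y NE fun u => if S < u / q then 1 else 0)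
  ne : Rows w n (n / q + 2) A 16 fun _ => push n Y NE fun _ => 1

/-- The number of increasing pairs of points strictly between `c` and `a`. -/
def Ex.mid₃ (a c : Ex) : Ex :=
  let ya : Ex := .rd 1 a
  let yc : Ex := .rd 1 c
  let v := yc.slabPt (.var 7)
  let u := ya.slabPt (.var 7)
  let v' := c.slabPt (.var 7)
  let u' := a.slabPt (.var 7)
  .ite c a (.ite yc ya
    (.rd 11 (yc / .par 1 * .par 0 + a) +
        .sumSlab 7 yc (.ite yc v (.mid₂ a (.rd 2 v)) (.lit 0)) -
      (.rd 13 (ya / .par 1 * .par 0 + c) +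
        .sumSlab 7 ya (.ite u ya (.ite yc u
          (cnt (.min c (.rd 2 u)) u - cnt (.min c (.rd 2 u)) yc) (.lit 0)) (.lit 0))) +
      (.rd 14 (c / .par 1 * .par 0 + a) +
        .sumSlab 7 c (.ite v' c (.ite (.rd 1 v') ya
          (ya - .rd 1 v' - cnt a ya + cnt a (.rd 1 v')) (.lit 0)) (.lit 0))) -
      (.rd 15 (a / .par 1 * .par 0 + c) +
        .sumSlab 7 a (.ite a u' (cnt c (.min yc (.rd 1 u'))) (.lit 0))) +
      .rd 16 a * cnt c yc) (.lit 0)) (.lit 0)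

theorem Base.eval_mid₃ (hs : Sizes w κ P n q lg) (h : PermPair n Y X) (hb : Base w n q Y X A)
    (ht : Mid₃Tables w n q Y A) {a c : Ex} {x z : ℕ} (hx : x < n) (hz : z < n)
    (ha : ∀ t, a.eval w κ P A (Function.update V 7 t) = x)
    (hc : ∀ t, c.eval w κ P A (Function.update V 7 t) = z) :
    ((Ex.mid₃ a c).eval w κ P A V : ZMod (2 ^ w)) = WordRAM.mid₃ (ZMod (2 ^ w)) n Y x z := by
  have ha' : a.eval w κ P A V = x := by simpa using ha (V 7)
  have hc' : c.eval w κ P A V = z := by simpa using hc (V 7)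
  have hya := hb.eval_y hs ha' hx
  have hyc := hb.eval_y hs hc' hz
  have hyx := h.y_lt x hx
  have hyz := h.y_lt z hz
  have lz : ∀ V : ℕ → ℕ, ((Ex.lit 0).eval w κ P A V : ZMod (2 ^ w)) = 0 := fun V => by
    rw [Ex.cast_eval_lit, Nat.cast_zero]
  by_cases h₁ : z < x
  swap
  · rw [mid₃_eq_zero fun h => h₁ h.1, Ex.mid₃, Ex.cast_eval_ite, ha', hc', if_neg h₁, lz]
  by_cases h₂ : Y z < Y x
  swap
  · rw [mid₃_eq_zero fun h => h₂ h.2, Ex.mid₃, Ex.cast_eval_ite, ha', hc', if_pos h₁,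
      Ex.cast_eval_ite, hya, hyc, if_neg h₂, lz]
  rw [mid₃_eq q h hx hz h₁ h₂, Ex.mid₃, Ex.cast_eval_ite, ha', hc', if_pos h₁, Ex.cast_eval_ite,
    hya, hyc, if_pos h₂]
  simp only [Ex.cast_eval_add, Ex.cast_eval_sub, Ex.cast_eval_mul]
  rw [hs.eval_rd_flat 11 (hs.eval_slab hyc hyz) ha' (div_lt_rows hyz) hx,
    ht.t2 _ (div_lt_rows hyz) _ hx,
    hs.eval_rd_flat 13 (hs.eval_slab hya hyx) hc' (div_lt_rows hyx) hz,
    ht.t3 _ (div_lt_rows hyx) _ hz,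
    hs.eval_rd_flat 14 (hs.eval_slab hc' hz) ha' (div_lt_rows hz) hx,
    ht.t5 _ (div_lt_rows hz) _ hx,
    hs.eval_rd_flat 15 (hs.eval_slab ha' hx) hc' (div_lt_rows hx) hz,
    ht.t6 _ (div_lt_rows hx) _ hz, hs.eval_rd_pt 16 ha' hx, hb.eval_cnt hs hc' hyc hz hyz]
  have ne := ht.ne 0 (Nat.succ_pos _) x hx
  rw [zero_mul, zero_add] at ne
  rw [ne]
  have ya : ∀ t, (Ex.rd 1 a).eval w κ P A (Function.update V 7 t) = Y x := fun t =>
    hb.eval_y hs (ha t) hx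
  have yc : ∀ t, (Ex.rd 1 c).eval w κ P A (Function.update V 7 t) = Y z := fun t =>
    hb.eval_y hs (hc t) hz
  congr 1
  congr 1
  · congr 1
    · congr 1
      · congr 1
        refine hs.eval_sumSlab' h yc hyz fun t ht hp => ?_
        have e₁ := hs.eval_slabPt_var (yc t) (Function.update_self 7 t V) hyz ht
        rw [Ex.cast_eval_ite, yc, e₁, lz, hb.eval_mid₂ hs h (ha t) (hb.eval_x hs e₁ hp) hx
          (h.x_lt _ hp), h.yx _ hp]
      · congr 1
        refine hs.eval_sumSlab' h ya hyx fun t ht hp => ?_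
        have e₁ := hs.eval_slabPt_var (ya t) (Function.update_self 7 t V) hyx ht
        have e₂ := Ex.eval_min (hc t) (hb.eval_x hs e₁ hp)
        have hm : Min.min z (X (Y x / q * q + t)) < n := (min_le_left _ _).trans_lt hz
        rw [Ex.cast_eval_ite, Ex.cast_eval_ite, Ex.cast_eval_sub, ya, yc, e₁, lz,
          hb.eval_cnt hs e₂ e₁ hm hp, hb.eval_cnt hs e₂ (yc t) hm hyz, h.yx _ hp]
    · congr 1
      refine hs.eval_sumSlab hc hz fun t ht hp => ?_
      have e₁ := hs.eval_slabPt_var (hc t) (Function.update_self 7 t V) hz ht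
      have e₂ := hb.eval_y hs e₁ hp
      have e₃ := h.y_lt _ hp
      rw [Ex.cast_eval_ite, Ex.cast_eval_ite, Ex.cast_eval_add, Ex.cast_eval_sub, Ex.cast_eval_sub,
        ya, hc, e₁, lz, e₂, hb.eval_cnt hs (ha t) (ya t) hx hyx, hb.eval_cnt hs (ha t) e₂ hx e₃]
  · congr 1
    refine hs.eval_sumSlab ha hx fun t ht hp => ?_
    have e₁ := hs.eval_slabPt_var (ha t) (Function.update_self 7 t V) hx ht
    have e₂ := hb.eval_y hs e₁ hp
    rw [Ex.cast_eval_ite, ha, e₁, lz, hb.eval_cnt hs (hc t) (Ex.eval_min (yc t) e₂) hz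
      ((min_le_left _ _).trans_lt hyz)]

/-! ### Programs for the items -/

/-- The function `e`, pushed along two quadrants to the array `dst`. -/
def push₂ (e : Ex) (l l' : Bool × Bool) (dst : ℕ) : St :=
  .seq (.table 8 3 e) <| .seq (dom l' 8 9) (dom l 9 dst)

theorem push₂_apply_of_ne {e : Ex} {l l' : Bool × Bool} {dst k : ℕ} (h3 : k ≠ 3) (h8 : k ≠ 8)
    (h9 : k ≠ 9) (hd : k ≠ dst) : (push₂ e l l' dst).exec w κ P V A k = A k := by
  simp only [push₂, St.exec]
  rw [exec_dom_of_ne hd h3, exec_dom_of_ne h9 h3, exec_table_of_ne _ h8]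

theorem exec_push₂ (hs : Sizes w κ P n q lg) (h : PermPair n Y X) (hA : ∀ y < n, A 2 y = X y)
    {e : Ex} (he : e.Reads (· ≠ 8)) {l l' : Bool × Bool} {dst : ℕ} (hd : dst ≠ 2 ∧ dst ≠ 3 ∧ 9 ≠ dst)
    {f : ℕ → ℕ → ZMod (2 ^ w)} (hf : ∀ S < n / q + 2, ∀ p < n,
      (e.eval w κ P A (Function.update V 0 (S * n + p)) : ZMod (2 ^ w)) = f S p) :
    Rows w n (n / q + 2) ((push₂ e l l' dst).exec w κ P V A) dst fun S =>
      push n Y l (push n Y l' (f S)) := by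
  simp only [push₂, St.exec]
  have h₁ : ∀ y < n, ((St.table 8 3 e).exec w κ P V A) 2 y = X y := fun y hy => by
    rw [exec_table_of_ne _ (by norm_num), hA y hy]
  refine exec_dom hs h hd.1 hd.2.1 hd.2.2 (by norm_num) (fun y hy => ?_)
    (exec_dom hs h (by norm_num) (by norm_num) (by norm_num) (by norm_num) h₁
      (hs.rows_table he hf) V) V
  rw [exec_dom_of_ne (by norm_num) (by norm_num), h₁ y hy]

/-- The slab of a height. -/
def Ex.ySlab : Ex := .rd 1 .col / .par 1

theorem Base.eval_y_col (hs : Sizes w κ P n q lg) (hb : Base w n q Y X A) {S p : ℕ}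
    (hS : S < n / q + 2) (hp : p < n) :
    (Ex.rd 1 .col).eval w κ P A (Function.update V 0 (S * n + p)) = Y p :=
  hb.eval_y hs (hs.eval_col hS hp) hp

theorem Base.eval_ySlab (hs : Sizes w κ P n q lg) (h : PermPair n Y X) (hb : Base w n q Y X A)
    {S p : ℕ} (hS : S < n / q + 2) (hp : p < n) :
    Ex.ySlab.eval w κ P A (Function.update V 0 (S * n + p)) = Y p / q :=
  hs.eval_slab (hb.eval_y_col hs hS hp) (h.y_lt p hp)

/-- The tables for full slabs. -/
def fullTables : St :=
  .seq (push₂ (.slabs .row (.rd 1 .col)) SW SW 10)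
    (push₂ (.ite .row .ySlab (.lit 1) (.lit 0)) SW SW 11)

theorem Base.push₂ (hb : Base w n q Y X A) {e : Ex} {l l' : Bool × Bool} {dst : ℕ}
    (hd : 9 < dst) : Base w n q Y X ((push₂ e l l' dst).exec w κ P V A) := by
  refine hb.congr ?_ ?_ ?_ ?_ <;>
    exact push₂_apply_of_ne (by norm_num) (by norm_num) (by norm_num) (by omega)

theorem cast_lit_zero : ((Ex.lit 0).eval w κ P A V : ZMod (2 ^ w)) = 0 := by
  rw [Ex.cast_eval_lit, Nat.cast_zero]

theorem cast_lit_one : ((Ex.lit 1).eval w κ P A V : ZMod (2 ^ w)) = 1 := by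
  rw [Ex.cast_eval_lit, Nat.cast_one]

theorem exec_fullTables (hs : Sizes w κ P n q lg) (h : PermPair n Y X) (hb : Base w n q Y X A) :
    Base w n q Y X (fullTables.exec w κ P V A) ∧
    Rows w n (n / q + 2) (fullTables.exec w κ P V A) 10 (fun S =>
      push n Y SW (push n Y SW fun c => cnt n Y (S * q) (Y c))) ∧
    Rows w n (n / q + 2) (fullTables.exec w κ P V A) 11 (fun S =>
      push n Y SW (push n Y SW fun c => if S < Y c / q then 1 else 0)) := by
  simp only [fullTables, St.exec]
  set A₁ := (WordRAM.push₂ (.slabs .row (.rd 1 .col)) SW SW 10).exec w κ P V A with hA₁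
  have hb₁ : Base w n q Y X A₁ := hb.push₂ (by norm_num)
  have r₁ : Rows w n (n / q + 2) A₁ 10 (fun S =>
      push n Y SW (push n Y SW fun c => cnt n Y (S * q) (Y c))) :=
    exec_push₂ hs h hb.x (by simp [Ex.slabs, Ex.row, Ex.col]) (by norm_num) fun S hS p hp => by
      rw [hs.eval_slabs hb.slabs (hs.eval_row hS hp) (hb.eval_y_col hs hS hp) hS (h.y_lt p hp)]
  refine ⟨hb₁.push₂ (by norm_num), r₁.congr (push₂_apply_of_ne (by norm_num) (by norm_num)
    (by norm_num) (by norm_num)), exec_push₂ hs h hb₁.x (by simp [Ex.ySlab, Ex.row, Ex.col])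
    (by norm_num) fun S hS p hp => ?_⟩
  rw [Ex.cast_eval_ite, hs.eval_row hS hp, hb₁.eval_ySlab hs h hS hp, cast_lit_zero, cast_lit_one]

/-- The program for the tables of `Ex.mid₃`. -/
def mid₃Tables : St :=
  .seq (push₂ (.ite .ySlab .row (.lit 1) (.lit 0)) NW NE 13) <|
  .seq (push₂ (.ite (.col / .par 1) .row (.lit 1) (.lit 0)) SE SW 14) <|
  .seq (push₂ (.ite .row (.col / .par 1) (.lit 1) (.lit 0)) SW NE 15) <|
  .seq (.table 8 3 (.lit 1)) (dom NE 8 16)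

theorem mid₃Tables_apply_of_ne {k : ℕ} (h3 : k ≠ 3) (h8 : k ≠ 8) (h9 : k ≠ 9) (h13 : k ≠ 13)
    (h14 : k ≠ 14) (h15 : k ≠ 15) (h16 : k ≠ 16) :
    mid₃Tables.exec w κ P V A k = A k := by
  simp only [mid₃Tables, St.exec]
  rw [exec_dom_of_ne h16 h3, exec_table_of_ne _ h8, push₂_apply_of_ne h3 h8 h9 h15,
    push₂_apply_of_ne h3 h8 h9 h14, push₂_apply_of_ne h3 h8 h9 h13]

theorem exec_mid₃Tables (hs : Sizes w κ P n q lg) (h : PermPair n Y X) (hb : Base w n q Y X A)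
    (ht : Rows w n (n / q + 2) A 11 fun S =>
      push n Y SW (push n Y SW fun c => if S < Y c / q then 1 else 0)) :
    Mid₃Tables w n q Y (mid₃Tables.exec w κ P V A) := by
  have r₂ : Rows w n (n / q + 2) (mid₃Tables.exec w κ P V A) 11 fun S =>
      push n Y SW (push n Y SW fun c => if S < Y c / q then 1 else 0) :=
    ht.congr (mid₃Tables_apply_of_ne (by norm_num) (by norm_num) (by norm_num) (by norm_num)
      (by norm_num) (by norm_num) (by norm_num))
  simp only [mid₃Tables, St.exec] at r₂ ⊢
  set A₁ := (push₂ (.ite .ySlab .row (.lit 1) (.lit 0)) NW NE 13).exec w κ P V A with hA₁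
  set A₂ := (push₂ (.ite (.col / .par 1) .row (.lit 1) (.lit 0)) SE SW 14).exec w κ P V A₁ with hA₂
  set A₃ := (push₂ (.ite .row (.col / .par 1) (.lit 1) (.lit 0)) SW NE 15).exec w κ P V A₂ with hA₃
  set A₄ := (St.table 8 3 (.lit 1)).exec w κ P V A₃ with hA₄
  have hb₁ : Base w n q Y X A₁ := hb.push₂ (by norm_num)
  have hb₂ : Base w n q Y X A₂ := hb₁.push₂ (by norm_num)
  have hb₃ : Base w n q Y X A₃ := hb₂.push₂ (by norm_num)
  have f₂ : A₂ 13 = A₁ 13 :=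
    push₂_apply_of_ne (by norm_num) (by norm_num) (by norm_num) (by norm_num)
  have f₃ : ∀ k, k = 13 ∨ k = 14 → A₃ k = A₂ k := fun k hk =>
    push₂_apply_of_ne (by omega) (by omega) (by omega) (by omega)
  have f₄ : ∀ k, 13 ≤ k → k ≤ 15 → (dom NE 8 16).exec w κ P V A₄ k = A₃ k := fun k hk hk' => by
    rw [exec_dom_of_ne (by omega) (by omega), hA₄, exec_table_of_ne _ (by omega)]
  refine ⟨r₂, Rows.congr ?_ ((f₄ 13 (by norm_num) (by norm_num)).trans
      ((f₃ 13 (.inl rfl)).trans f₂)),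
    Rows.congr ?_ ((f₄ 14 (by norm_num) (by norm_num)).trans (f₃ 14 (.inr rfl))),
    Rows.congr ?_ (f₄ 15 (by norm_num) (by norm_num)),
    exec_dom hs h (by norm_num) (by norm_num) (by norm_num) (by norm_num) (fun y hy => ?_)
      (hs.rows_table (by simp) fun S hS p hp => cast_lit_one) V⟩
  · refine exec_push₂ hs h hb.x (by simp [Ex.ySlab, Ex.row, Ex.col]) (by norm_num)
      fun S hS p hp => ?_
    rw [Ex.cast_eval_ite, hs.eval_row hS hp, hb.eval_ySlab hs h hS hp, cast_lit_zero, cast_lit_one]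
  · refine exec_push₂ hs h hb₁.x (by simp [Ex.row, Ex.col]) (by norm_num) fun S hS p hp => ?_
    rw [Ex.cast_eval_ite, hs.eval_row hS hp, hs.eval_slab (hs.eval_col hS hp) hp, cast_lit_zero,
      cast_lit_one]
  · refine exec_push₂ hs h hb₂.x (by simp [Ex.row, Ex.col]) (by norm_num) fun S hS p hp => ?_
    rw [Ex.cast_eval_ite, hs.eval_row hS hp, hs.eval_slab (hs.eval_col hS hp) hp, cast_lit_zero,
      cast_lit_one]
  · rw [exec_table_of_ne _ (by norm_num), hb₃.x y hy]

end

/-- The functions of a permutation that the algorithm evaluates. A tree is given by the parents and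
the quadrants of its vertices other than the root `0`, the last vertex first. -/
inductive Item
  | tree (T : List (ℕ × Bool × Bool))
  | mid₂
  | leafMid₂ (l : Bool × Bool)
  | mid₃

/-- The sum, over all placements of the vertices of a tree, of the products of the weights. -/
def treeSum {R : Type*} [CommRing R] (n : ℕ) (Y : ℕ → ℕ) :
    List (ℕ × Bool × Bool) → (ℕ → ℕ → R) → R
  | [], W => ∑ x ∈ range n, W 0 x
  | (p, l) :: T, W => treeSum n Y T (Function.update W p fun x => W p x *
      push n Y l (W (T.length + 1)) x)

/-- The value of an item. -/
def Item.value (R : Type*) [CommRing R] (n : ℕ) (Y : ℕ → ℕ) : Item → R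
  | tree T => treeSum n Y T fun _ _ => 1
  | mid₂ => tripleSum n Y (WordRAM.mid₂ R n Y)
  | leafMid₂ l => tripleSum n Y fun a c => push n Y l (fun _ => 1) a * WordRAM.mid₂ R n Y a c
  | mid₃ => tripleSum n Y (WordRAM.mid₃ R n Y)

/-- The program for `treeSum`, with the weights of the vertex `v` in the array `16 + v`. -/
def treeProg : List (ℕ × Bool × Bool) → St
  | [] => .skip
  | (p, l) :: T =>
    .seq (dom l (16 + (T.length + 1)) 8) <|
    .seq (.table 9 3 (.rd (16 + p) (.var 0) * .rd 8 (.var 0))) <|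
    .seq (.table (16 + p) 3 (.rd 9 (.var 0))) (treeProg T)

/-- The parents precede the children. -/
def IsTree : List (ℕ × Bool × Bool) → Prop
  | [] => True
  | (p, _) :: T => p ≤ T.length ∧ IsTree T

/-- The program that sets all weights in the first arrays from `16` on to `1`. -/
def onesProg : ℕ → St
  | 0 => .table 16 3 (.lit 1)
  | k + 1 => .seq (onesProg k) (.table (16 + (k + 1)) 3 (.lit 1))

/-- The program that prepares the evaluation of an item. -/
def Item.prog : Item → St
  | tree T => .seq (onesProg T.length) (treeProg T)
  | mid₂ => .seq (.table 7 0 (.lit 1)) fullTables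
  | leafMid₂ l => .seq (.table 8 3 (.lit 1)) <| .seq (dom l 8 7) fullTables
  | mid₃ => .seq (.table 7 0 (.lit 1)) <| .seq fullTables <| .seq (dom SW 10 12) <|
      .seq (dom SW 11 17) mid₃Tables

/-- The value of an item after the preparation. -/
def Item.result : Item → Ex
  | tree _ => .sum 4 0 (.rd 16 (.var 4))
  | mid₂ | leafMid₂ _ => slabSum 10 11 .mid₂
  | mid₃ => slabSum 12 17 .mid₃

/-- The items that are used. -/
def Item.Valid : Item → Prop
  | tree T => IsTree T ∧ T.length ≤ 4
  | _ => True

section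

variable {w κ n q lg : ℕ} {P Y X V : ℕ → ℕ} {A : ℕ → ℕ → ℕ}

theorem treeProg_apply_of_ne {k : ℕ} (h3 : k ≠ 3) (h8 : k ≠ 8) (h9 : k ≠ 9) (hk : k < 16)
    (T : List (ℕ × Bool × Bool)) (A : ℕ → ℕ → ℕ) : (treeProg T).exec w κ P V A k = A k := by
  induction T generalizing A with
  | nil => rfl
  | cons t T ih =>
    simp only [treeProg, St.exec]
    rw [ih, exec_table_of_ne _ (by omega), exec_table_of_ne _ h9, exec_dom_of_ne h8 h3]

theorem onesProg_apply_of_ne {k : ℕ} (hk : k < 16) (m : ℕ) (A : ℕ → ℕ → ℕ) :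
    (onesProg m).exec w κ P V A k = A k := by
  induction m with
  | zero => exact exec_table_of_ne _ (by omega)
  | succ m ih => simp only [onesProg, St.exec]; rw [exec_table_of_ne _ (by omega), ih]

theorem exec_onesProg (hs : Sizes w κ P n q lg) (m : ℕ) : ∀ v ≤ m,
    Rows w n (n / q + 2) ((onesProg m).exec w κ P V A) (16 + v) fun _ _ => 1 := by
  induction m with
  | zero =>
    intro v hv
    obtain rfl : v = 0 := by omega
    exact hs.rows_table (by simp) fun S hS p hp => cast_lit_one
  | succ m ih =>
    intro v hv
    simp only [onesProg, St.exec]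
    by_cases h : v = m + 1
    · subst h
      exact hs.rows_table (by simp) fun S hS p hp => cast_lit_one
    · exact (ih v (by omega)).congr (exec_table_of_ne _ (by omega))

theorem exec_treeProg (hs : Sizes w κ P n q lg) (h : PermPair n Y X) (T : List (ℕ × Bool × Bool)) :
    ∀ (A : ℕ → ℕ → ℕ) (W : ℕ → ℕ → ZMod (2 ^ w)), IsTree T → (∀ y < n, A 2 y = X y) →
      (∀ v ≤ T.length, Rows w n (n / q + 2) A (16 + v) fun _ => W v) →
      ((Ex.sum 4 0 (.rd 16 (.var 4))).eval w κ P ((treeProg T).exec w κ P V A) V : ZMod (2 ^ w)) =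
        treeSum n Y T W := by
  induction T with
  | nil =>
    intro A W _ _ hW
    rw [Ex.cast_eval_sum, hs.p0, treeSum]
    refine sum_congr rfl fun x hx => ?_
    have hx := mem_range.1 hx
    have e : (Ex.var 4).eval w κ P A (Function.update V 4 x) = x := Function.update_self ..
    rw [treeProg, St.exec, hs.eval_rd_pt 16 e hx]
    have := hW 0 le_rfl 0 (Nat.succ_pos _) x hx
    rwa [zero_mul, zero_add] at this
  | cons t T ih =>
    obtain ⟨p, l⟩ := t
    intro A W hT hA hW
    have hp : p ≤ T.length := hT.1
    simp only [treeProg, St.exec]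
    set A₁ := (dom l (16 + (T.length + 1)) 8).exec w κ P V A with hA₁
    set A₂ := (St.table 9 3 (.rd (16 + p) (.var 0) * .rd 8 (.var 0))).exec w κ P V A₁ with hA₂
    have r₁ : Rows w n (n / q + 2) A₁ 8 fun _ => push n Y l (W (T.length + 1)) :=
      exec_dom hs h (by norm_num) (by norm_num) (by omega) (by omega) hA (hW _ le_rfl) V
    have f₁ : ∀ v, A₁ (16 + v) = A (16 + v) := fun v => exec_dom_of_ne (by omega) (by omega) _ _
    have hidx : ∀ {S x}, S < n / q + 2 → x < n → S * n + x < 2 ^ (w - κ) := fun hS hx =>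
      hs.lt_index (Dom.flat_lt hS hx).le
    have ev : ∀ (A : ℕ → ℕ → ℕ) {S x} (k : ℕ), S < n / q + 2 → x < n →
        (Ex.rd k (.var 0)).eval w κ P A (Function.update V 0 (S * n + x)) = A k (S * n + x) := by
      intro A S x k hS hx
      have e : (Ex.var 0).eval w κ P A (Function.update V 0 (S * n + x)) = S * n + x :=
        Function.update_self ..
      rw [Ex.eval_rd] <;> rw [e]
      exact hidx hS hx
    have r₂ : Rows w n (n / q + 2) A₂ 9 fun _ x => W p x * push n Y l (W (T.length + 1)) x :=
      hs.rows_table (by simp; omega) fun S hS x hx => by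
        rw [Ex.cast_eval_mul, ev _ _ hS hx, ev _ _ hS hx, r₁ S hS x hx, f₁,
          hW p (by simp; omega) S hS x hx]
    refine ih _ _ hT.2 (fun y hy => ?_) fun v hv => ?_
    · rw [exec_table_of_ne _ (by omega), hA₂, exec_table_of_ne _ (by norm_num), hA₁,
        exec_dom_of_ne (by norm_num) (by norm_num), hA y hy]
    · by_cases hvp : v = p
      · subst hvp
        rw [Function.update_self]
        exact hs.rows_table (by simp; omega) fun S hS x hx => by rw [ev _ _ hS hx, r₂ S hS x hx]
      · rw [Function.update_of_ne hvp]
        exact (hW v (by simp; omega)).congr (by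
          rw [exec_table_of_ne _ (by omega), hA₂, exec_table_of_ne _ (by omega), f₁])

theorem fullTables_apply_of_ne {k : ℕ} (h3 : k ≠ 3) (h8 : k ≠ 8) (h9 : k ≠ 9) (h10 : k ≠ 10)
    (h11 : k ≠ 11) : fullTables.exec w κ P V A k = A k := by
  simp only [fullTables, St.exec]
  rw [push₂_apply_of_ne h3 h8 h9 h11, push₂_apply_of_ne h3 h8 h9 h10]

theorem Item.prog_apply_of_lt {k : ℕ} (h3 : k ≠ 3) (hk : k < 7) (i : Item) (A : ℕ → ℕ → ℕ) :
    i.prog.exec w κ P V A k = A k := by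
  cases i <;> simp only [Item.prog, St.exec]
  · rw [treeProg_apply_of_ne h3 (by omega) (by omega) (by omega), onesProg_apply_of_ne (by omega)]
  · rw [fullTables_apply_of_ne h3 (by omega) (by omega) (by omega) (by omega),
      exec_table_of_ne _ (by omega)]
  · rw [fullTables_apply_of_ne h3 (by omega) (by omega) (by omega) (by omega),
      exec_dom_of_ne (by omega) h3, exec_table_of_ne _ (by omega)]
  · rw [mid₃Tables_apply_of_ne h3 (by omega) (by omega) (by omega) (by omega) (by omega) (by omega),
      exec_dom_of_ne (by omega) h3, exec_dom_of_ne (by omega) h3,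
      fullTables_apply_of_ne h3 (by omega) (by omega) (by omega) (by omega),
      exec_table_of_ne _ (by omega)]

theorem Sizes.exec_table_pt (hs : Sizes w κ P n q lg) {k : ℕ} {e : Ex} (he : e.Reads (· ≠ k))
    {p : ℕ} (hp : p < n) :
    (St.table k 0 e).exec w κ P V A k p = e.eval w κ P A (Function.update V 0 p) :=
  St.exec_table he (by rw [hs.p0]; exact (hs.lt_index (by have := le_sq n; omega)).le) _
    (by rwa [hs.p0])

theorem Item.cast_eval_result (hs : Sizes w κ P n q lg) (h : PermPair n Y X)
    (hb : Base w n q Y X A) (i : Item) (hi : i.Valid) :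
    (i.result.eval w κ P (i.prog.exec w κ P V A) V : ZMod (2 ^ w)) = i.value _ n Y := by
  cases i with
  | tree T =>
    refine exec_treeProg hs h T _ _ hi.1 (fun y hy => ?_) (exec_onesProg hs T.length)
    rw [onesProg_apply_of_ne (by norm_num), hb.x y hy]
  | mid₂ =>
    simp only [Item.prog, St.exec, Item.result, Item.value]
    set A₁ := (St.table 7 0 (.lit 1)).exec w κ P V A with hA₁
    obtain ⟨hb₂, h10, h11⟩ := exec_fullTables (V := V) hs h (hb.congr (A' := A₁)
      (exec_table_of_ne _ (by norm_num)) (exec_table_of_ne _ (by norm_num))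
      (exec_table_of_ne _ (by norm_num)) (exec_table_of_ne _ (by norm_num)))
    rw [hb₂.eval_slabSum hs h (W := fun _ => 1) sum_mul_mid₂ (fun a ha => ?_) h10 h11
      fun V x hx z hz a c ha hc => ?_]
    · simp only [one_mul]
    · rw [fullTables_apply_of_ne (by norm_num) (by norm_num) (by norm_num) (by norm_num)
        (by norm_num), hA₁, hs.exec_table_pt (by simp) ha, cast_lit_one]
    · exact hb₂.eval_mid₂ hs h (by simpa using ha (V 7)) (by simpa using hc (V 7)) hx hz
  | leafMid₂ l =>
    simp only [Item.prog, St.exec, Item.result, Item.value]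
    set A₁ := (St.table 8 3 (.lit 1)).exec w κ P V A with hA₁
    set A₂ := (dom l 8 7).exec w κ P V A₁ with hA₂
    have f : ∀ k, k ≠ 3 → k < 7 → A₂ k = A k := fun k h3 hk => by
      rw [hA₂, exec_dom_of_ne (by omega) h3, hA₁, exec_table_of_ne _ (by omega)]
    have r : Rows w n (n / q + 2) A₂ 7 fun _ => push n Y l fun _ => 1 :=
      exec_dom hs h (by norm_num) (by norm_num) (by norm_num) (by norm_num)
        (fun y hy => by rw [exec_table_of_ne _ (by omega), hb.x y hy])
        (hs.rows_table (by simp) fun S hS p hp => cast_lit_one) V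
    obtain ⟨hb₂, h10, h11⟩ := exec_fullTables (V := V) hs h (hb.congr
      (f 1 (by norm_num) (by norm_num)) (f 2 (by norm_num) (by norm_num))
      (f 5 (by norm_num) (by norm_num)) (f 6 (by norm_num) (by norm_num)))
    refine hb₂.eval_slabSum hs h sum_mul_mid₂ (fun a ha => ?_) h10 h11
      fun V x hx z hz a c ha hc => ?_
    · rw [fullTables_apply_of_ne (by norm_num) (by norm_num) (by norm_num) (by norm_num)
        (by norm_num)]
      have := r 0 (Nat.succ_pos _) a ha
      rwa [zero_mul, zero_add] at this
    · exact hb₂.eval_mid₂ hs h (by simpa using ha (V 7)) (by simpa using hc (V 7)) hx hz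
  | mid₃ =>
    simp only [Item.prog, St.exec, Item.result, Item.value]
    set A₁ := (St.table 7 0 (.lit 1)).exec w κ P V A with hA₁
    obtain ⟨hb₂, h10, h11⟩ := exec_fullTables (V := V) hs h (hb.congr (A' := A₁)
      (exec_table_of_ne _ (by norm_num)) (exec_table_of_ne _ (by norm_num))
      (exec_table_of_ne _ (by norm_num)) (exec_table_of_ne _ (by norm_num)))
    set A₂ := fullTables.exec w κ P V A₁ with hA₂
    set A₃ := (dom SW 10 12).exec w κ P V A₂ with hA₃
    set A₄ := (dom SW 11 17).exec w κ P V A₃ with hA₄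
    have f₃ : ∀ k, k ≠ 12 → k ≠ 3 → A₃ k = A₂ k := fun k hk hk' => exec_dom_of_ne hk hk' _ _
    have f₄ : ∀ k, k ≠ 17 → k ≠ 3 → A₄ k = A₃ k := fun k hk hk' => exec_dom_of_ne hk hk' _ _
    have r₃ := exec_dom hs h (l := SW) (by norm_num) (by norm_num) (by norm_num)
      (by norm_num) hb₂.x h10 V (dst := 12)
    have r₄ := exec_dom hs h (l := SW) (by norm_num) (by norm_num) (by norm_num)
      (by norm_num) (fun y hy => by rw [f₃ 2 (by norm_num) (by norm_num), hb₂.x y hy])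
      (h11.congr (f₃ 11 (by norm_num) (by norm_num))) V (dst := 17)
    have f : ∀ k, k ≠ 12 → k ≠ 17 → k ≠ 3 → A₄ k = A₂ k := fun k h h' h'' => by
      rw [f₄ k h' h'', f₃ k h h'']
    have hb₄ : Base w n q Y X A₄ := hb₂.congr (f 1 (by norm_num) (by norm_num) (by norm_num))
      (f 2 (by norm_num) (by norm_num) (by norm_num))
      (f 5 (by norm_num) (by norm_num) (by norm_num))
      (f 6 (by norm_num) (by norm_num) (by norm_num))
    have ht := exec_mid₃Tables (V := V) hs h hb₄
      (h11.congr (f 11 (by norm_num) (by norm_num) (by norm_num)))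
    have g : ∀ k, k < 13 ∨ 16 < k → k ≠ 3 → k ≠ 8 → k ≠ 9 →
        mid₃Tables.exec w κ P V A₄ k = A₄ k := fun k hk h3 h8 h9 =>
      mid₃Tables_apply_of_ne h3 h8 h9 (by omega) (by omega) (by omega) (by omega)
    have hb₅ : Base w n q Y X (mid₃Tables.exec w κ P V A₄) :=
      hb₄.congr (g 1 (by norm_num) (by norm_num) (by norm_num) (by norm_num))
        (g 2 (by norm_num) (by norm_num) (by norm_num) (by norm_num))
        (g 5 (by norm_num) (by norm_num) (by norm_num) (by norm_num))
        (g 6 (by norm_num) (by norm_num) (by norm_num) (by norm_num))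
    rw [hb₅.eval_slabSum hs h (W := fun _ => 1) sum_mul_mid₃ (fun a ha => ?_)
      (r₃.congr ((g 12 (by norm_num) (by norm_num) (by norm_num) (by norm_num)).trans
        (f₄ 12 (by norm_num) (by norm_num))))
      (r₄.congr (g 17 (by norm_num) (by norm_num) (by norm_num) (by norm_num)))
      fun V x hx z hz a c ha hc => ?_]
    · simp only [one_mul]
    · rw [g 7 (by norm_num) (by norm_num) (by norm_num) (by norm_num),
        f 7 (by norm_num) (by norm_num) (by norm_num), hA₂, fullTables_apply_of_ne (by norm_num)
        (by norm_num) (by norm_num) (by norm_num) (by norm_num), hA₁, hs.exec_table_pt (by simp) ha,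
        cast_lit_one]
    · exact hb₅.eval_mid₃ hs h ht hx hz ha hc

end

/-! ### Items as numbers of homomorphisms -/

/-- The values of `g` satisfy the inequalities of the list `c`. -/
def Sat {k : ℕ} {α : Type*} [LT α] (c : List (ℕ × ℕ)) (g : Fin k → α) : Prop :=
  ∀ i j : Fin k, ((i : ℕ), (j : ℕ)) ∈ c → g i < g j

open Classical in
/-- The number of maps to the points of a permutation whose horizontal and vertical coordinates
satisfy the inequalities of `c.1` and `c.2`. -/
noncomputable def homCount (k : ℕ) (c : List (ℕ × ℕ) × List (ℕ × ℕ)) {n : ℕ}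
    (π : Equiv.Perm (Fin n)) : ℕ :=
  #{f : Fin k → Fin n | Sat c.1 f ∧ Sat c.2 (π ∘ f)}

/-- The inequality between the coordinates of `p` and of a vertex `u` of a quadrant of `p`. -/
def side (b : Bool) (p u : ℕ) : ℕ × ℕ := if b then (p, u) else (u, p)

/-- The inequalities for the vertices of a tree. -/
def treeCon : List (ℕ × Bool × Bool) → List (ℕ × ℕ) × List (ℕ × ℕ)
  | [] => ([], [])
  | (p, l) :: T => (side l.1 p (T.length + 1) :: (treeCon T).1,
      side l.2 p (T.length + 1) :: (treeCon T).2)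

/-- The number of vertices of an item. -/
def Item.size : Item → ℕ
  | tree T => T.length + 1
  | mid₂ => 4
  | leafMid₂ _ | mid₃ => 5

/-- The inequalities for the vertices of an item. -/
def Item.con : Item → List (ℕ × ℕ) × List (ℕ × ℕ)
  | tree T => treeCon T
  | mid₂ => ([(1, 0), (2, 1), (3, 0)], [(1, 0), (2, 1), (3, 2)])
  | leafMid₂ l => ([(1, 0), (2, 1), (3, 0), side l.1 0 4], [(1, 0), (2, 1), (3, 2), side l.2 0 4])
  | mid₃ => ([(1, 0), (2, 1), (3, 2), (4, 0)], [(1, 0), (2, 1), (3, 2), (4, 3)])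

section

variable {R : Type*} [CommRing R] {n : ℕ}

/-- The sum of `φ` over the values below `n` of the first `k` entries of `f`. -/
def homSum (n : ℕ) : ℕ → ((ℕ → ℕ) → R) → (ℕ → ℕ) → R
  | 0, φ, f => φ f
  | k + 1, φ, f => homSum n k (fun f => ∑ x ∈ range n, φ (Function.update f k x)) f

theorem homSum_succ (k : ℕ) (φ : (ℕ → ℕ) → R) (f : ℕ → ℕ) : homSum n (k + 1) φ f =
    homSum n k (fun f => ∑ x ∈ range n, φ (Function.update f k x)) f := rfl

theorem homSum_eq_sum (k : ℕ) (φ : (ℕ → ℕ) → R) (f₀ : ℕ → ℕ) :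
    homSum n k φ f₀ =
      ∑ f : Fin k → Fin n, φ fun i => if h : i < k then (f ⟨i, h⟩ : ℕ) else f₀ i := by
  induction k generalizing φ with
  | zero => simp [homSum]
  | succ k ih =>
    rw [homSum, ih]
    refine Eq.trans ?_ (Equiv.sum_comp (Fin.snocEquiv fun _ : Fin (k + 1) => Fin n)
      fun f : Fin (k + 1) → Fin n => φ fun i => if h : i < k + 1 then (f ⟨i, h⟩ : ℕ) else f₀ i)
    rw [Fintype.sum_prod_type_right]
    refine sum_congr rfl fun f _ => ?_
    rw [sum_range]
    refine sum_congr rfl fun x _ => congrArg φ (funext fun i => ?_)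
    rcases lt_trichotomy i k with h | h | h
    · rw [Function.update_of_ne h.ne, dif_pos h, dif_pos (by omega)]
      simp [Fin.snocEquiv, Fin.snoc, h]
    · subst h
      simp [Fin.snocEquiv, Fin.snoc]
    · rw [Function.update_of_ne h.ne', dif_neg (by omega), dif_neg (by omega)]

/-- All entries of the list satisfy the inequalities. -/
def SatNat (c : List (ℕ × ℕ)) (f : ℕ → ℕ) : Prop := ∀ p ∈ c, f p.1 < f p.2

instance (c f) : Decidable (SatNat c f) := by unfold SatNat; infer_instance

theorem satNat_cons {p c f} : SatNat (p :: c) f ↔ f p.1 < f p.2 ∧ SatNat c f := by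
  simp [SatNat]

theorem mem_treeCon_le {T : List (ℕ × Bool × Bool)} (hT : IsTree T) {p : ℕ × ℕ}
    (hp : p ∈ (treeCon T).1 ∨ p ∈ (treeCon T).2) : p.1 ≤ T.length ∧ p.2 ≤ T.length := by
  induction T with
  | nil => simp [treeCon] at hp
  | cons t T ih =>
    obtain ⟨r, l⟩ := t
    have h₁ := hT.1
    simp only [treeCon, List.mem_cons, List.length_cons, side] at hp ⊢
    have := ih hT.2
    rcases hp with (rfl | hp) | (rfl | hp)
    · split_ifs <;> simp <;> omega
    · have := this (.inl hp); omega
    · split_ifs <;> simp <;> omega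
    · have := this (.inr hp); omega

theorem satNat_update {c : List (ℕ × ℕ)} {m x : ℕ} (hc : ∀ p ∈ c, p.1 < m ∧ p.2 < m) (g : ℕ → ℕ)
    (f : ℕ → ℕ) : SatNat c (fun i => g (Function.update f m x i)) ↔ SatNat c fun i => g (f i) := by
  refine forall₂_congr fun p hp => ?_
  have := hc p hp
  simp only
  rw [Function.update_of_ne (by omega), Function.update_of_ne (by omega)]

theorem treeSum_eq_homSum {Y : ℕ → ℕ} {T : List (ℕ × Bool × Bool)} (hT : IsTree T)
    (W : ℕ → ℕ → R) (f₀ : ℕ → ℕ) :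
    treeSum n Y T W = homSum n (T.length + 1) (fun f => (∏ v ∈ range (T.length + 1), W v (f v)) *
      if SatNat (treeCon T).1 f ∧ SatNat (treeCon T).2 (fun i => Y (f i)) then 1 else 0) f₀ := by
  induction T generalizing W with
  | nil => simp [treeSum, homSum, SatNat, treeCon]
  | cons t T ih =>
    obtain ⟨p, l⟩ := t
    have hp : p ≤ T.length := hT.1
    rw [treeSum, ih hT.2, List.length_cons, homSum_succ (T.length + 1)]
    refine congrFun (congrArg _ (funext fun f => ?_)) _
    have h₁ : ∏ v ∈ range (T.length + 1), Function.update W p (fun x => W p x *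
        push n Y l (W (T.length + 1)) x) v (f v) =
        (∏ v ∈ range (T.length + 1), W v (f v)) * push n Y l (W (T.length + 1)) (f p) := by
      have : ∀ v ∈ range (T.length + 1), Function.update W p (fun x => W p x *
          push n Y l (W (T.length + 1)) x) v (f v) =
          W v (f v) * if v = p then push n Y l (W (T.length + 1)) (f p) else 1 := fun v _ => by
        by_cases hv : v = p
        · subst hv; simp
        · simp [hv]
      rw [prod_congr rfl this, prod_mul_distrib, prod_ite_eq' , if_pos (by simp; omega)]
    rw [h₁, push, mul_sum, sum_mul]
    refine sum_congr rfl fun x _ => ?_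
    have hc : ∀ p, p ∈ (treeCon T).1 ∨ p ∈ (treeCon T).2 → p.1 < T.length + 1 ∧ p.2 < T.length + 1 :=
      fun p h => by have := mem_treeCon_le hT.2 h; omega
    have s₁ := satNat_update (x := x) (fun p h => hc p (.inl h)) (fun i => i) f
    have s₂ := satNat_update (x := x) (fun p h => hc p (.inr h)) Y f
    have h₂ : ∏ v ∈ range (T.length + 1), W v (Function.update f (T.length + 1) x v) =
        ∏ v ∈ range (T.length + 1), W v (f v) := prod_congr rfl fun v hv => by
      rw [Function.update_of_ne (by have := mem_range.1 hv; omega)]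
    have h₃ : (SatNat (treeCon ((p, l) :: T)).1 (Function.update f (T.length + 1) x) ∧
        SatNat (treeCon ((p, l) :: T)).2 (fun i => Y (Function.update f (T.length + 1) x i))) ↔
        Quad Y l (f p) x ∧ SatNat (treeCon T).1 f ∧ SatNat (treeCon T).2 (fun i => Y (f i)) := by
      simp only [treeCon, satNat_cons]
      rw [s₁, s₂, Quad, side, side]
      have hne : p ≠ T.length + 1 := by omega
      cases l.1 <;> cases l.2 <;> simp [hne] <;> tauto
    rw [prod_range_succ _ (T.length + 1), h₂, Function.update_self]
    simp only [h₃, ite_and]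
    split_ifs <;> simp

/-- The one-line notation of a permutation, as a function on `ℕ`. -/
def oneLine {n : ℕ} (π : Equiv.Perm (Fin n)) (x : ℕ) : ℕ := if h : x < n then π ⟨x, h⟩ else 0

theorem oneLine_coe (π : Equiv.Perm (Fin n)) (x : Fin n) : oneLine π x = π x := by
  simp [oneLine]

theorem permPair_oneLine (π : Equiv.Perm (Fin n)) : PermPair n (oneLine π) (oneLine π⁻¹) where
  y_lt x hx := by simp [oneLine, hx]
  x_lt y hy := by simp [oneLine, hy]
  xy x hx := by
    rw [← Fin.val_mk hx, oneLine_coe, oneLine_coe]; simp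
  yx y hy := by
    rw [← Fin.val_mk hy, oneLine_coe, oneLine_coe]; simp

theorem satNat_iff_sat {k : ℕ} {c : List (ℕ × ℕ)} (hc : ∀ p ∈ c, p.1 < k ∧ p.2 < k)
    {g : Fin k → Fin n} {g' : ℕ → ℕ} (hg : ∀ i : Fin k, g' i = g i) : SatNat c g' ↔ Sat c g := by
  refine ⟨fun h i j hij => ?_, fun h p hp => ?_⟩
  · have := h _ hij
    rwa [hg, hg] at this
  · obtain ⟨h₁, h₂⟩ := hc p hp
    have := h ⟨p.1, h₁⟩ ⟨p.2, h₂⟩ hp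
    rw [← Fin.val_mk h₁, ← Fin.val_mk h₂, hg, hg]
    exact this

theorem homSum_eq_homCount {k : ℕ} {c : List (ℕ × ℕ) × List (ℕ × ℕ)}
    (hc : ∀ p, p ∈ c.1 ∨ p ∈ c.2 → p.1 < k ∧ p.2 < k) (π : Equiv.Perm (Fin n)) :
    homSum n k (fun f => if SatNat c.1 f ∧ SatNat c.2 (fun i => oneLine π (f i)) then (1 : R)
      else 0) (fun _ => 0) = homCount k c π := by
  classical
  rw [homSum_eq_sum, homCount, card_filter, Nat.cast_sum]
  refine sum_congr rfl fun f _ => ?_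
  rw [Nat.cast_ite, Nat.cast_one, Nat.cast_zero]
  refine if_congr (and_congr ?_ ?_) rfl rfl
  · exact satNat_iff_sat (fun p hp => hc p (.inl hp)) fun i => by simp
  · exact satNat_iff_sat (fun p hp => hc p (.inr hp)) fun i => by simp [oneLine_coe]

theorem Item.con_lt {i : Item} (hi : i.Valid) (p : ℕ × ℕ) (hp : p ∈ i.con.1 ∨ p ∈ i.con.2) :
    p.1 < i.size ∧ p.2 < i.size := by
  cases i with
  | tree T => have := mem_treeCon_le hi.1 hp; simp only [size]; omega
  | leafMid₂ l =>
    obtain ⟨a, b⟩ := l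
    simp only [con, List.mem_cons, List.not_mem_nil, side, size, or_false] at hp ⊢
    cases a <;> cases b <;> rcases hp with (h | h | h | h) | (h | h | h | h) <;> simp [h]
  | mid₂ =>
    simp only [con, List.mem_cons, List.not_mem_nil, size, or_false] at hp ⊢
    rcases hp with (h | h | h) | (h | h | h) <;> simp [h]
  | mid₃ =>
    simp only [con, List.mem_cons, List.not_mem_nil, size, or_false] at hp ⊢
    rcases hp with (h | h | h | h) | (h | h | h | h) <;> simp [h]

theorem tripleSum_sum (Y : ℕ → ℕ) (G : ℕ → ℕ → ℕ → R) :
    tripleSum n Y (fun a c => ∑ u ∈ range n, G a c u) = ∑ a ∈ range n, ∑ u ∈ range n,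
      ∑ c ∈ range n, ∑ b ∈ range n, if b < a ∧ Y b < Y c then G a c u else 0 := by
  rw [tripleSum, sum_comm]
  refine sum_congr rfl fun a _ => ?_
  have : ∀ b c, (if b < a ∧ Y b < Y c then ∑ u ∈ range n, G a c u else 0) =
      ∑ u ∈ range n, if b < a ∧ Y b < Y c then G a c u else 0 := fun b c => by
    split_ifs <;> simp
  simp only [this]
  rw [sum_congr rfl fun b _ => sum_comm, sum_comm]
  exact sum_congr rfl fun u _ => sum_comm

theorem Item.value_eq {i : Item} (hi : i.Valid) (π : Equiv.Perm (Fin n)) :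
    i.value R n (oneLine π) = homCount i.size i.con π := by
  rw [← homSum_eq_homCount (Item.con_lt hi)]
  cases i with
  | tree T =>
    rw [Item.value, treeSum_eq_homSum hi.1 _ fun _ => 0]
    simp only [prod_const_one, one_mul]
    rfl
  | mid₂ =>
    simp only [value]
    unfold WordRAM.mid₂
    simp only [tripleSum_sum, size, con, homSum, satNat_cons, Function.update_apply, Quad]
    refine sum_congr rfl fun a _ => sum_congr rfl fun u _ => sum_congr rfl fun c _ =>
      sum_congr rfl fun b _ => ?_
    refine (ite_and _ _ _ _).symm.trans (if_congr ?_ rfl rfl)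
    simp [SatNat]
    tauto
  | leafMid₂ l =>
    simp only [value]
    unfold WordRAM.mid₂
    simp only [mul_sum, tripleSum_sum, size, con, homSum, satNat_cons, Function.update_apply]
    refine sum_congr rfl fun a _ => sum_congr rfl fun u _ => sum_congr rfl fun c _ =>
      sum_congr rfl fun b _ => ?_
    obtain ⟨l₁, l₂⟩ := l
    by_cases h : (b < a ∧ oneLine π b < oneLine π c) ∧ Quad (oneLine π) SW a u ∧
      Quad (oneLine π) SW u c
    · rw [if_pos h.1, if_pos h.2, mul_one, push]
      refine sum_congr rfl fun d _ => if_congr ?_ rfl rfl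
      simp only [Quad, Bool.false_eq_true, if_false] at h
      cases l₁ <;> cases l₂ <;> simp [h, Quad, side, SatNat]
    · refine Eq.trans (b := 0) ?_ (sum_eq_zero fun d _ => if_neg fun hc => h ?_).symm
      · split_ifs with h₁ h₂
        · exact absurd ⟨h₁, h₂⟩ h
        · rw [mul_zero]
        · rfl
      · simp at hc
        simp only [Quad, Bool.false_eq_true, if_false]
        tauto
  | mid₃ =>
    simp only [value]
    unfold WordRAM.mid₃
    simp only [tripleSum_sum, size, con, homSum, satNat_cons, Function.update_apply, Quad]
    refine sum_congr rfl fun a _ => sum_congr rfl fun u _ => ?_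
    refine Eq.trans (sum_congr rfl fun c _ => Eq.trans (sum_congr rfl fun b _ => ?_) sum_comm)
      sum_comm
    by_cases h : b < a ∧ oneLine π b < oneLine π c
    · rw [if_pos h]
      exact sum_congr rfl fun v _ => if_congr (by simp [SatNat, h]; tauto) rfl rfl
    · rw [if_neg h]
      exact (sum_eq_zero fun v _ => if_neg fun hc => h (by simp at hc; tauto)).symm

end

/-! ### Symmetries -/

/-- The image of a permutation under the symmetry of the square that first reflects the coordinates
given by `g.2` and then transposes if `g.1`. -/
def image (g : Bool × Bool × Bool) {n : ℕ} (π : Equiv.Perm (Fin n)) : Equiv.Perm (Fin n) :=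
  let ρ := (if g.2.2 then Fin.revPerm else 1) * π * (if g.2.1 then Fin.revPerm else 1)
  if g.1 then ρ⁻¹ else ρ

/-- Reversed inequalities. -/
def flipCon (b : Bool) (c : List (ℕ × ℕ)) : List (ℕ × ℕ) := if b then c.map Prod.swap else c

/-- The inequalities for a permutation that correspond to inequalities for its image. -/
def symCon (g : Bool × Bool × Bool) (c : List (ℕ × ℕ) × List (ℕ × ℕ)) :
    List (ℕ × ℕ) × List (ℕ × ℕ) :=
  let d := if g.1 then c.swap else c
  (flipCon g.2.1 d.1, flipCon g.2.2 d.2)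

section

variable {n k : ℕ}

theorem homCount_congr {c d : List (ℕ × ℕ) × List (ℕ × ℕ)} {π ρ : Equiv.Perm (Fin n)}
    (e : Equiv.Perm (Fin n)) (h : ∀ f : Fin k → Fin n,
      (Sat c.1 f ∧ Sat c.2 (π ∘ f)) ↔ Sat d.1 (e ∘ f) ∧ Sat d.2 (ρ ∘ e ∘ f)) :
    homCount k c π = homCount k d ρ := by
  classical
  refine card_equiv ((Equiv.refl (Fin k)).arrowCongr e) fun f => ?_
  simp only [mem_filter_univ, h]
  rfl

theorem sat_flipCon {c : List (ℕ × ℕ)} {f : Fin k → Fin n} {b : Bool} :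
    Sat (flipCon b c) ((if b then Fin.revPerm else 1 : Equiv.Perm (Fin n)) ∘ f) ↔ Sat c f := by
  cases b
  · rfl
  · simp only [Sat, flipCon, if_true, List.mem_map, Prod.exists, Prod.swap_prod_mk, Prod.mk.injEq,
      Function.comp_apply, Fin.revPerm_apply, Fin.rev_lt_rev]
    refine ⟨fun h i j hij => h j i ⟨i, j, hij, rfl, rfl⟩, ?_⟩
    rintro h i j ⟨a, b, hab, rfl, rfl⟩
    exact h _ _ hab

theorem homCount_inv (c : List (ℕ × ℕ) × List (ℕ × ℕ)) (π : Equiv.Perm (Fin n)) :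
    homCount k c π⁻¹ = homCount k c.swap π :=
  homCount_congr π⁻¹ fun f => by
    rw [← Function.comp_assoc, show (π ∘ (π⁻¹ : Equiv.Perm (Fin n)) : Fin n → Fin n) = id from
      funext fun x => by simp]
    simp only [Prod.fst_swap, Prod.snd_swap, Function.id_comp]
    exact and_comm

theorem homCount_image (g : Bool × Bool × Bool) (c : List (ℕ × ℕ) × List (ℕ × ℕ))
    (π : Equiv.Perm (Fin n)) : homCount k c (image g π) = homCount k (symCon g c) π := by
  obtain ⟨tr, fx, fy⟩ := g
  have key : ∀ d : List (ℕ × ℕ) × List (ℕ × ℕ),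
      homCount k d ((if fy then Fin.revPerm else 1) * π * (if fx then Fin.revPerm else 1)) =
        homCount k (flipCon fx d.1, flipCon fy d.2) π := fun d =>
    homCount_congr (if fx then Fin.revPerm else 1) fun f => by
      have h : ∀ x, (if fy then Fin.revPerm else 1 : Equiv.Perm (Fin n))
          ((if fy then Fin.revPerm else 1 : Equiv.Perm (Fin n)) x) = x := by cases fy <;> simp
      refine and_congr sat_flipCon.symm ?_
      rw [← sat_flipCon (b := fy)]
      refine iff_of_eq (congrArg _ (funext fun x => ?_))
      simp only [Function.comp_apply, Equiv.Perm.mul_apply, h]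
  cases tr
  · exact key c
  · exact (homCount_inv _ _).trans (key c.swap)

/-! ### Homomorphisms and patterns -/

theorem exists_perm_lt_iff {m : ℕ} (h : Fin m → Fin n) (hh : Function.Injective h) :
    ∃ σ : Equiv.Perm (Fin m), ∀ a b, σ a < σ b ↔ h a < h b := by
  have hc : #(univ.image h) = m := by rw [card_image_of_injective _ hh, card_fin]
  let e := (univ.image h).orderIsoOfFin hc
  let s : Fin m → Fin m := fun a => e.symm ⟨h a, mem_image_of_mem h (mem_univ a)⟩
  have hs : ∀ a b, s a < s b ↔ h a < h b := fun a b => by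
    simp only [s, e.symm.lt_iff_lt, Subtype.mk_lt_mk]
  have hi : Function.Injective s := fun a b hab => by
    refine hh (le_antisymm ?_ ?_) <;> refine not_lt.1 fun hlt => ?_
    · exact absurd ((hs _ _).2 hlt) (by rw [hab]; exact lt_irrefl _)
    · exact absurd ((hs _ _).2 hlt) (by rw [hab]; exact lt_irrefl _)
  exact ⟨Equiv.ofBijective s (Finite.injective_iff_bijective.1 hi), hs⟩

theorem perm_eq_of_lt_iff {m : ℕ} {σ τ : Equiv.Perm (Fin m)} (h : ∀ a b, σ a < σ b ↔ τ a < τ b) :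
    σ = τ := by
  have h₁ : StrictMono (σ * τ⁻¹ : Equiv.Perm (Fin m)) := fun a b hab => by
    simpa [h] using hab
  have h₂ := (h₁.range_inj strictMono_id).1 (by
    rw [(σ * τ⁻¹).surjective.range_eq, Set.range_id])
  refine Equiv.ext fun x => ?_
  simpa using congrFun h₂ (τ x)

open Classical in
/-- The number of surjections onto the points of a permutation whose coordinates satisfy given
inequalities. -/
noncomputable def surjCount (k : ℕ) (c : List (ℕ × ℕ) × List (ℕ × ℕ)) {m : ℕ}
    (σ : Equiv.Perm (Fin m)) : ℕ :=
  #{g : Fin k → Fin m | Function.Surjective g ∧ Sat c.1 g ∧ Sat c.2 (σ ∘ g)}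

theorem homCount_eq_sum (c : List (ℕ × ℕ) × List (ℕ × ℕ)) (π : Equiv.Perm (Fin n)) :
    homCount k c π =
      ∑ m ∈ range (k + 1), ∑ σ : Equiv.Perm (Fin m), patternCount σ π * surjCount k c σ := by
  classical
  let Q : (Σ m : Fin (k + 1), Σ σ : Equiv.Perm (Fin m),
      {i : Fin m ↪o Fin n // ∀ a b : Fin m, π (i a) < π (i b) ↔ σ a < σ b} ×
      {g : Fin k → Fin m // Function.Surjective g ∧ Sat c.1 g ∧ Sat c.2 (σ ∘ g)}) →
      {f : Fin k → Fin n // Sat c.1 f ∧ Sat c.2 (π ∘ f)} := fun x =>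
    ⟨x.2.2.1.1 ∘ x.2.2.2.1, fun a b hab => (x.2.2.1.1.lt_iff_lt).2 (x.2.2.2.2.2.1 a b hab),
      fun a b hab => (x.2.2.1.2 _ _).2 (x.2.2.2.2.2.2 a b hab)⟩
  have hinj : Function.Injective Q := by
    rintro ⟨m, σ, ⟨i, hi⟩, ⟨g, hg, hg'⟩⟩ ⟨m', σ', ⟨i', hi'⟩, ⟨g', hg₁, hg₁'⟩⟩ h
    have h : i ∘ g = i' ∘ g' := congrArg Subtype.val h
    have hr : Set.range i = Set.range i' := by
      rw [← hg.range_comp, h, hg₁.range_comp]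
    have hm : m = m' := by
      have h₁ := Set.ncard_range_of_injective i.injective
      have h₂ := Set.ncard_range_of_injective i'.injective
      rw [hr] at h₁
      simp only [Nat.card_fin] at h₁ h₂
      exact Fin.ext (h₁.symm.trans h₂)
    subst hm
    obtain rfl : i = i' := OrderEmbedding.range_inj.1 hr
    obtain rfl : g = g' := funext fun a => i.injective (congrFun h a)
    obtain rfl : σ = σ' := perm_eq_of_lt_iff fun a b => (hi a b).symm.trans (hi' a b)
    rfl
  have hsurj : Function.Surjective Q := by
    rintro ⟨f, hf, hf'⟩
    have hk : #(univ.image f) < k + 1 := Nat.lt_succ_of_le (card_image_le.trans (card_fin k).le)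
    let i := (univ.image f).orderEmbOfFin rfl
    let e := (univ.image f).orderIsoOfFin rfl
    let g : Fin k → Fin #(univ.image f) := fun a => e.symm ⟨f a, mem_image_of_mem f (mem_univ a)⟩
    have hig : ∀ a, i (g a) = f a := fun a => by
      simp only [i, g, ← coe_orderIsoOfFin_apply]
      exact congrArg Subtype.val (e.apply_symm_apply _)
    obtain ⟨σ, hσ⟩ := exists_perm_lt_iff (π ∘ i) (π.injective.comp i.injective)
    refine ⟨⟨⟨_, hk⟩, σ, ⟨i, fun a b => (hσ a b).symm⟩, g, fun y => ?_, fun a b hab => ?_,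
      fun a b hab => ?_⟩, Subtype.ext (funext hig)⟩
    · obtain ⟨x, -, hx⟩ := mem_image.1 (e y).2
      exact ⟨x, by simp only [g, hx]; exact e.symm_apply_apply y⟩
    · rw [← i.lt_iff_lt, hig, hig]; exact hf a b hab
    · refine (hσ _ _).2 ?_
      simp only [Function.comp_apply, hig]; exact hf' a b hab
  have h := Nat.card_eq_of_bijective Q ⟨hinj, hsurj⟩
  rw [Nat.card_sigma] at h
  simp only [Nat.card_sigma, Nat.card_prod] at h
  rw [homCount, ← Fintype.card_subtype, ← Nat.card_eq_fintype_card, ← h, sum_range]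
  refine sum_congr rfl fun m _ => sum_congr rfl fun σ _ => ?_
  rw [patternCount, surjCount, ← Fintype.card_subtype]
  simp only [Nat.card_eq_fintype_card]

end

/-! ### Digits -/

/-- The digit `i` of `x` in base `b`. -/
def dig (b x i : ℕ) : ℕ := x / Nat.pow b i % b

theorem dig_def (b x i : ℕ) : dig b x i = x / b ^ i % b := rfl

theorem dig_sum_range {b : ℕ} {f : ℕ → ℕ} (hf : ∀ i, f i < b) {K i : ℕ} (hi : i < K) :
    dig b (∑ j ∈ range K, f j * b ^ j) i = f i := by
  have hb : 0 < b := (Nat.zero_le _).trans_lt (hf 0)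
  induction i generalizing f K with
  | zero =>
    obtain ⟨K, rfl⟩ : ∃ K', K = K' + 1 := ⟨K - 1, by omega⟩
    rw [sum_range_succ', dig_def, pow_zero, Nat.div_one, mul_one]
    simp only [pow_succ, ← mul_assoc, ← sum_mul]
    rw [Nat.add_mod, Nat.mul_mod_left, zero_add, Nat.mod_mod, Nat.mod_eq_of_lt (hf 0)]
  | succ i ih =>
    obtain ⟨K, rfl⟩ : ∃ K', K = K' + 1 := ⟨K - 1, by omega⟩
    rw [← ih (f := fun j => f (j + 1)) (fun j => hf _) (K := K) (by omega), sum_range_succ', dig_def, dig_def,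
      pow_zero, mul_one, pow_succ', ← Nat.div_div_eq_div_mul]
    simp only [pow_succ, ← mul_assoc, ← sum_mul]
    rw [Nat.add_div_of_dvd_right (dvd_mul_left _ _), Nat.mul_div_cancel _ hb,
      Nat.div_eq_of_lt (hf 0), add_zero]

theorem dig_sum {ι : Type*} [Fintype ι] {b : ℕ} {e : ι → ℕ} (he : Function.Injective e) {f : ι → ℕ}
    (hf : ∀ i, f i < b) (i : ι) : dig b (∑ j, f j * b ^ e j) (e i) = f i := by
  classical
  have hb : 0 < b := (Nat.zero_le _).trans_lt (hf i)
  let K := univ.sup e + 1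
  have hK : ∀ j, e j < K := fun j => Nat.lt_succ_of_le (le_sup (mem_univ j))
  let g : ℕ → ℕ := fun x => ∑ j, if e j = x then f j else 0
  have hg : ∀ j, g (e j) = f j := fun j => by
    simp only [g, he.eq_iff]; simp
  have hgb : ∀ x, g x < b := fun x => by
    by_cases hx : ∃ j, e j = x
    · obtain ⟨j, rfl⟩ := hx; rw [hg]; exact hf j
    · push Not at hx
      simpa [g, hx] using hb
  have h : ∑ j, f j * b ^ e j = ∑ x ∈ range K, g x * b ^ x := by
    simp only [g, sum_mul, ite_mul, zero_mul]
    rw [sum_comm]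
    refine sum_congr rfl fun j _ => ?_
    rw [sum_ite_eq, if_pos (mem_range.2 (hK j))]
  rw [h, dig_sum_range hgb (hK i), hg]

section

variable {k : ℕ}

theorem dig_outputCell (σ : Equiv.Perm (Fin k)) (i : Fin k) : dig k (outputCell σ) i = σ i :=
  dig_sum Fin.val_injective (fun j => (σ j).2) i

theorem outputCell_injective : Function.Injective (outputCell (k := k)) := fun σ τ h =>
  Equiv.ext fun i => Fin.ext (by rw [← dig_outputCell, h, dig_outputCell])

theorem outputCell_lt (σ : Equiv.Perm (Fin k)) : outputCell σ < k ^ k := by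
  have : ∀ (m : ℕ) (f : Fin m → ℕ), (∀ i, f i < k) → ∑ j, f j * k ^ (j : ℕ) < k ^ m := by
    intro m
    induction m with
    | zero => simp
    | succ m ih =>
      intro f hf
      rw [Fin.sum_univ_castSucc, pow_succ']
      have h₁ := ih (fun i => f i.castSucc) fun i => hf _
      have h₂ := Nat.mul_le_mul_right (k ^ m) (show f (Fin.last m) + 1 ≤ k from hf _)
      simp only [Fin.val_castSucc, Fin.val_last] at h₁ ⊢
      rw [Nat.succ_mul] at h₂
      omega
  exact this k _ fun i => (σ i).2

theorem exists_outputCell {x : ℕ} (hx : x < k ^ k)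
    (h : ∀ i < k, ∀ j < i, dig k x i ≠ dig k x j) :
    ∃ σ : Equiv.Perm (Fin k), outputCell σ = x := by
  have hlt : ∀ i : Fin k, dig k x i < k := fun i => Nat.mod_lt _ (by have := i.2; omega)
  have hinj : Function.Injective fun i : Fin k => (⟨dig k x i, hlt i⟩ : Fin k) := by
    intro i j hij
    have hij := congrArg Fin.val hij
    refine Fin.ext ?_
    rcases lt_trichotomy (i : ℕ) j with hl | hl | hl
    · exact absurd hij.symm (h j j.2 i hl)
    · exact hl
    · exact absurd hij (h i i.2 j hl)
  refine ⟨Equiv.ofBijective _ (Finite.injective_iff_bijective.1 hinj), ?_⟩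
  have : ∀ m x, x < k ^ m → ∑ j : Fin m, dig k x j * k ^ (j : ℕ) = x := by
    intro m
    induction m with
    | zero => intro x hx; simp at hx; simp [hx]
    | succ m ih =>
      intro x hx
      rw [Fin.sum_univ_succ]
      have h₁ := ih (x / k) (Nat.div_lt_of_lt_mul (by rwa [pow_succ'] at hx))
      simp only [dig_def, Nat.div_div_eq_div_mul, ← pow_succ'] at h₁
      simp only [dig_def, Fin.val_succ, Fin.val_zero, pow_zero, Nat.div_one, mul_one]
      simp only [pow_succ k, ← mul_assoc, ← sum_mul]
      simp only [← pow_succ]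
      rw [h₁, mul_comm, Nat.mod_add_div]
  exact this k x hx

/-! ### The check of a certificate -/

/-- The digits of `x` satisfy the inequalities of `c`. -/
def satDig (k : ℕ) (c : List (ℕ × ℕ)) (x : ℕ) : Bool :=
  c.all fun p => Nat.blt (dig k x p.1) (dig k x p.2)

/-- The code of the quotient of the permutations with codes `b` and `a`. -/
def quotCode (k a b : ℕ) : ℕ → ℕ
  | 0 => 0
  | v + 1 => quotCode k a b v + dig k b v * Nat.pow k (dig k a v)

/-- The value of `f` at the list of all elements of `l` with the property `p`. -/
def select (p : ℕ → Bool) : List ℕ → List ℕ → (List ℕ → ℕ) → ℕ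
  | [], acc, f => f acc
  | a :: l, acc, f => bif p a then select p l (a :: acc) f else select p l acc f

/-- The numbers of pairs of linear extensions of the inequalities `c` with given quotient, as
digits of a number. -/
def rowNum (k : ℕ) (codes : List ℕ) (c : List (ℕ × ℕ) × List (ℕ × ℕ)) : ℕ :=
  select (satDig k c.1) codes [] fun xs => select (satDig k c.2) codes [] fun ys =>
    (xs.map fun a => (ys.map fun b => Nat.pow 65536 (quotCode k a b k)).sum).sum

/-- The linear combination of `rows` whose coefficients are the digits of `N` in base `5`. -/
def dotDig : ℕ → List ℕ → ℕ
  | _, [] => 0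
  | 0, _ :: _ => 0
  | N + 1, r :: rs => (N + 1) % 5 * r + dotDig ((N + 1) / 5) rs

/-- Modulo `5`, the digit of `S` with index `x` is `1` and the other digits with indices in `codes`
are `0`. -/
def isUnit (codes : List ℕ) (x : ℕ) : ℕ → Bool
  | 0 => false
  | S + 1 => codes.all fun y => Nat.beq (dig 65536 (S + 1) y % 5) (bif Nat.beq x y then 1 else 0)

/-- The value of `f` at the list of `rowNum` for the members of a list. -/
def withRows (k : ℕ) (codes : List ℕ) :
    List (List (ℕ × ℕ) × List (ℕ × ℕ)) → List ℕ → (List ℕ → Bool) → Bool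
  | [], acc, f => f acc
  | c :: cs, acc, f =>
    match rowNum k codes c with
    | 0 => false
    | r + 1 => withRows k codes cs ((r + 1) :: acc) f

/-- The codes of the permutations. -/
def permCodes (k : ℕ) : List ℕ := (List.range (k ^ k)).filter fun x =>
  (List.range k).all fun i => (List.range i).all fun j => !Nat.beq (dig k x i) (dig k x j)

/-- The matrix of `rowNum` for the list `cs` has a left inverse modulo `5`, whose rows are the
second components of `cert`. -/
def certifies (k : ℕ) (cs : List (List (ℕ × ℕ) × List (ℕ × ℕ))) (cert : List (ℕ × ℕ)) : Bool :=
  withRows k (cert.map Prod.fst) cs [] fun rows =>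
    cert.all fun t => isUnit (cert.map Prod.fst) t.1 (dotDig t.2 rows)

theorem select_eq (p : ℕ → Bool) (l acc : List ℕ) (f : List ℕ → ℕ) :
    select p l acc f = f ((l.filter p).reverse ++ acc) := by
  induction l generalizing acc with
  | nil => rfl
  | cons a l ih => cases h : p a <;> simp [select, ih, h]

theorem withRows_eq {codes : List ℕ} {cs : List (List (ℕ × ℕ) × List (ℕ × ℕ))} {acc : List ℕ}
    {f : List ℕ → Bool} (h : withRows k codes cs acc f = true) :
    f ((cs.map (rowNum k codes)).reverse ++ acc) = true := by
  induction cs generalizing acc with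
  | nil => exact h
  | cons c cs ih =>
    rw [withRows] at h
    split at h
    · cases h
    · next r hr => simpa [hr] using ih h

theorem sum_permCodes (F : ℕ → ℕ) :
    ((permCodes k).map F).sum = ∑ σ : Equiv.Perm (Fin k), F (outputCell σ) := by
  have hnd : (permCodes k).Nodup := List.nodup_range.filter _
  rw [← List.sum_toFinset F hnd]
  symm
  refine sum_nbij outputCell (fun σ _ => ?_) outputCell_injective.injOn (fun x hx => ?_)
    fun _ _ => rfl
  · simp only [permCodes, List.mem_toFinset, List.mem_filter, List.mem_range, List.all_eq_true,
      Bool.not_eq_true', Bool.eq_false_iff, ne_eq, Nat.beq_eq]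
    refine ⟨outputCell_lt σ, fun i hi j hj he => ?_⟩
    rw [← Fin.val_mk hi, ← Fin.val_mk (hj.trans hi), dig_outputCell, dig_outputCell] at he
    have := congrArg Fin.val (σ.injective (Fin.ext he))
    simp only at this
    omega
  · simp only [permCodes, mem_coe, List.mem_toFinset, List.mem_filter, List.mem_range,
      List.all_eq_true, Bool.not_eq_true', Bool.eq_false_iff, ne_eq, Nat.beq_eq] at hx
    obtain ⟨σ, rfl⟩ := exists_outputCell hx.1 hx.2
    exact ⟨σ, by simp, rfl⟩

theorem satDig_outputCell {c : List (ℕ × ℕ)} (hc : ∀ p ∈ c, p.1 < k ∧ p.2 < k)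
    (σ : Equiv.Perm (Fin k)) : satDig k c (outputCell σ) = true ↔ Sat c σ := by
  simp only [satDig, List.all_eq_true, Nat.blt_eq]
  refine ⟨fun h i j hij => ?_, fun h p hp => ?_⟩
  · have := h _ hij
    rwa [dig_outputCell, dig_outputCell] at this
  · obtain ⟨h₁, h₂⟩ := hc p hp
    rw [← Fin.val_mk h₁, ← Fin.val_mk h₂, dig_outputCell, dig_outputCell]
    exact h ⟨_, h₁⟩ ⟨_, h₂⟩ hp

theorem quotCode_outputCell (σ τ : Equiv.Perm (Fin k)) :
    quotCode k (outputCell σ) (outputCell τ) k = outputCell (τ * σ⁻¹) := by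
  have : ∀ m, quotCode k (outputCell σ) (outputCell τ) m =
      ∑ v ∈ range m, dig k (outputCell τ) v * k ^ dig k (outputCell σ) v := fun m => by
    induction m with
    | zero => rfl
    | succ m ih => rw [quotCode, ih, sum_range_succ, Nat.pow_eq]
  rw [this, sum_range]
  simp only [dig_outputCell]
  rw [outputCell, ← Equiv.sum_comp σ fun j => ((τ * σ⁻¹) j : ℕ) * k ^ (j : ℕ)]
  simp

theorem surjCount_self (c : List (ℕ × ℕ) × List (ℕ × ℕ)) (σ : Equiv.Perm (Fin k)) [DecidablePred
    fun a : Equiv.Perm (Fin k) => Sat c.1 a ∧ Sat c.2 (σ ∘ a)] :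
    surjCount k c σ = #{a : Equiv.Perm (Fin k) | Sat c.1 a ∧ Sat c.2 (σ ∘ a)} := by
  classical
  rw [surjCount]
  symm
  refine card_nbij (fun a => (a : Fin k → Fin k)) (fun a ha => ?_) (fun a _ b _ h => ?_)
    fun g hg => ?_
  · simp only [coe_filter, mem_univ, true_and, Set.mem_ofPred_eq] at ha ⊢
    exact ⟨a.surjective, ha⟩
  · exact DFunLike.coe_injective h
  · simp only [coe_filter, mem_univ, true_and, Set.mem_ofPred_eq] at hg
    refine ⟨Equiv.ofBijective g (Finite.surjective_iff_bijective.1 hg.1), ?_, rfl⟩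
    simp only [coe_filter, mem_univ, true_and, Set.mem_ofPred_eq]
    exact hg.2

theorem sum_map_filter_reverse (p : ℕ → Bool) (F : ℕ → ℕ) (l : List ℕ) :
    (((l.filter p).reverse).map F).sum = (l.map fun x => if p x = true then F x else 0).sum := by
  rw [List.map_reverse, List.sum_reverse]
  induction l with
  | nil => rfl
  | cons a l ih => cases h : p a <;> simp [h, ih]

theorem rowNum_eq {c : List (ℕ × ℕ) × List (ℕ × ℕ)}
    (hc : ∀ p, p ∈ c.1 ∨ p ∈ c.2 → p.1 < k ∧ p.2 < k) :
    rowNum k (permCodes k) c = ∑ σ : Equiv.Perm (Fin k), surjCount k c σ * 65536 ^ outputCell σ := by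
  classical
  simp only [rowNum, select_eq, List.append_nil, sum_map_filter_reverse, sum_permCodes,
    satDig_outputCell fun p hp => hc p (.inl hp), satDig_outputCell fun p hp => hc p (.inr hp),
    quotCode_outputCell, Nat.pow_eq]
  have : ∀ σ : Equiv.Perm (Fin k), surjCount k c σ * 65536 ^ outputCell σ =
      ∑ a : Equiv.Perm (Fin k), if Sat c.1 a then if Sat c.2 (σ * a) then
        65536 ^ outputCell σ else 0 else 0 := fun σ => by
    rw [surjCount_self, card_filter, sum_mul]
    refine sum_congr rfl fun a _ => ?_
    simp only [ite_and, ite_mul, one_mul, zero_mul]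
    rfl
  simp only [this]
  rw [sum_comm]
  refine sum_congr rfl fun a _ => ?_
  split_ifs with h
  · rw [← Equiv.sum_comp (Equiv.mulRight a)]
    simp only [Equiv.coe_mulRight, mul_inv_cancel_right, Equiv.Perm.coe_mul]
    exact sum_congr rfl fun x _ => if_congr Iff.rfl rfl rfl
  · simp

end

/-- The linear combination of the values of `F` on `L` whose coefficients are the digits of `N` in
base `5`. -/
def digComb {α A : Type*} [AddCommMonoid A] (F : α → A) : ℕ → List α → A
  | _, [] => 0
  | N, c :: L => (N % 5) • F c + digComb F (N / 5) L

section

variable {α A ι : Type*} [AddCommMonoid A] {k : ℕ}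

theorem digComb_sum (s : Finset ι) (F : ι → α → A) (N : ℕ) (L : List α) :
    digComb (fun c => ∑ i ∈ s, F i c) N L = ∑ i ∈ s, digComb (F i) N L := by
  induction L generalizing N with
  | nil => simp [digComb]
  | cons c L ih => simp only [digComb, ih, smul_sum, sum_add_distrib]

theorem digComb_map {B : Type*} [AddCommMonoid B] (φ : A →+ B) (F : α → A) (N : ℕ) (L : List α) :
    digComb (fun c => φ (F c)) N L = φ (digComb F N L) := by
  induction L generalizing N with
  | nil => simp [digComb]
  | cons c L ih => simp only [digComb, ih, map_add, map_nsmul]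

theorem digComb_congr {F G : α → A} (N : ℕ) {L : List α} (h : ∀ c ∈ L, F c = G c) :
    digComb F N L = digComb G N L := by
  induction L generalizing N with
  | nil => rfl
  | cons c L ih =>
    simp only [digComb, h c (by simp), ih _ fun c hc => h c (List.mem_cons_of_mem _ hc)]

theorem digComb_mem {S : Type*} [SetLike S A] [AddSubmonoidClass S A] (W : S) {F : α → A} (N : ℕ)
    {L : List α} (h : ∀ c ∈ L, F c ∈ W) : digComb F N L ∈ W := by
  induction L generalizing N with
  | nil => exact zero_mem W
  | cons c L ih =>
    exact add_mem (nsmul_mem (h c (by simp)) _) (ih _ fun c hc => h c (List.mem_cons_of_mem _ hc))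

theorem digComb_zero (F : α → A) (L : List α) : digComb F 0 L = 0 := by
  induction L with
  | nil => rfl
  | cons c L ih => simp [digComb, ih]

theorem dotDig_map (F : α → ℕ) (N : ℕ) (L : List α) : dotDig N (L.map F) = digComb F N L := by
  induction L generalizing N with
  | nil => rw [List.map_nil, dotDig, digComb]
  | cons c L ih =>
    cases N with
    | zero => rw [digComb_zero]; rfl
    | succ N => simp [dotDig, digComb, ih]

theorem digComb_le {F : α → ℕ} {b : ℕ} (h : ∀ c, F c ≤ b) (N : ℕ) (L : List α) :
    digComb F N L ≤ L.length * (4 * b) := by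
  induction L generalizing N with
  | nil => simp [digComb]
  | cons c L ih =>
    have h₁ := Nat.mul_le_mul (show N % 5 ≤ 4 by omega) (h c)
    have h₂ := ih (N / 5)
    simp only [digComb, smul_eq_mul, List.length_cons, Nat.succ_mul L.length] at h₁ ⊢
    omega

/-- A module generated by the linear combinations of the elements `P i` with the coefficients `M c`
contains the elements `P i`, provided that the matrix `M` has a left inverse modulo a prime. -/
theorem mem_of_mul_eq_one {ι E : Type*} [Fintype ι] [DecidableEq ι] [AddCommGroup E] [Module ℚ E]
    (W : Submodule ℚ E) (P : ι → E) (p : ℕ) [Fact p.Prime] (Q : Matrix ι ι ℤ)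
    (hQ : Q.map (Int.cast : ℤ → ZMod p) = 1) (h : ∀ i, ∑ j, Q i j • P j ∈ W) (i : ι) : P i ∈ W := by
  have hdet : Q.det ≠ 0 := fun h0 => by
    have h₁ := Int.cast_det (R := ZMod p) Q
    rw [h0, hQ, Matrix.det_one] at h₁
    simp at h₁
  have h₂ : ∑ j, Q.adjugate i j • ∑ l, Q j l • P l = Q.det • P i := by
    simp only [smul_sum, smul_smul]
    rw [sum_comm]
    simp only [← sum_smul]
    have : ∀ l, ∑ j, Q.adjugate i j * Q j l = if i = l then Q.det else 0 := fun l => by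
      have := congrFun (congrFun Q.adjugate_mul i) l
      rwa [Matrix.mul_apply, Matrix.smul_apply, Matrix.one_apply, smul_eq_mul, mul_ite, mul_one,
        mul_zero] at this
    simp [this]
  have h₃ : Q.det • P i ∈ W := h₂ ▸ W.sum_mem fun j _ => zsmul_mem (h j) _
  have h₄ := W.smul_mem (Q.det : ℚ)⁻¹ h₃
  rwa [← Int.cast_smul_eq_zsmul ℚ, smul_smul, inv_mul_cancel₀ (by exact_mod_cast hdet),
    one_smul] at h₄

theorem mem_of_certifies {cs : List (List (ℕ × ℕ) × List (ℕ × ℕ))} {cert : List (ℕ × ℕ)}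
    (hcert : certifies k cs cert = true) (hcodes : cert.map Prod.fst = permCodes k)
    (hlen : cs.length * (4 * k.factorial) < 65536)
    (hc : ∀ c ∈ cs, ∀ p, p ∈ c.1 ∨ p ∈ c.2 → p.1 < k ∧ p.2 < k)
    {E : Type*} [AddCommGroup E] [Module ℚ E] (W : Submodule ℚ E) (P : Equiv.Perm (Fin k) → E)
    (h : ∀ c ∈ cs, ∑ σ : Equiv.Perm (Fin k), surjCount k c σ • P σ ∈ W)
    (σ : Equiv.Perm (Fin k)) : P σ ∈ W := by
  classical
  have h₁ := withRows_eq hcert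
  rw [List.append_nil, ← List.map_reverse, hcodes, List.all_eq_true] at h₁
  have h₂ : ∀ τ : Equiv.Perm (Fin k), ∃ N, (outputCell τ, N) ∈ cert := fun τ => by
    have : outputCell τ ∈ permCodes k := by
      have hs := sum_permCodes (k := k) fun x => if x = outputCell τ then 1 else 0
      by_contra hn
      rw [List.sum_eq_zero] at hs
      · simp [outputCell_injective.eq_iff] at hs
      · intro x hx
        obtain ⟨y, hy, rfl⟩ := List.mem_map.1 hx
        exact if_neg fun e : y = outputCell τ => hn (e ▸ hy)
    rw [← hcodes] at this
    obtain ⟨t, ht, he⟩ := List.mem_map.1 this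
    exact ⟨t.2, by rw [← he]; exact ht⟩
  choose N hN using h₂
  let Q : Matrix (Equiv.Perm (Fin k)) (Equiv.Perm (Fin k)) ℤ := fun τ ρ =>
    (digComb (fun c => surjCount k c ρ) (N τ) cs.reverse : ℕ)
  have hrow : ∀ τ, dotDig (N τ) (cs.reverse.map (rowNum k (permCodes k))) =
      ∑ ρ, digComb (fun c => surjCount k c ρ) (N τ) cs.reverse * 65536 ^ outputCell ρ := fun τ => by
    rw [dotDig_map, digComb_congr _ fun c hcm => rowNum_eq (hc c (List.mem_reverse.1 hcm)),
      digComb_sum]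
    exact sum_congr rfl fun ρ _ => digComb_map (AddMonoidHom.mulRight (65536 ^ outputCell ρ)) _ _ _
  have hlt : ∀ τ ρ : Equiv.Perm (Fin k),
      digComb (fun c => surjCount k c ρ) (N τ) cs.reverse < 65536 := fun τ ρ => by
    refine (digComb_le (b := k.factorial) (fun c => ?_) _ _).trans_lt (by rwa [List.length_reverse])
    rw [surjCount_self]
    exact (card_filter_le _ _).trans (by rw [card_univ, Fintype.card_perm, Fintype.card_fin])
  have : Fact (Nat.Prime 5) := ⟨by norm_num⟩
  refine mem_of_mul_eq_one W P 5 Q ?_ (fun τ => ?_) σ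
  · ext τ ρ
    have h₃ := h₁ _ (hN τ)
    have hS : ∀ S, isUnit (permCodes k) (outputCell τ) S = true →
        dig 65536 S (outputCell ρ) % 5 = if τ = ρ then 1 else 0 := fun S hS => by
      cases S with
      | zero => cases hS
      | succ S =>
        rw [isUnit, List.all_eq_true] at hS
        have := hS (outputCell ρ) (by
          rw [← hcodes]; exact List.mem_map.2 ⟨_, hN ρ, rfl⟩)
        rw [Nat.beq_eq] at this
        rw [this]
        by_cases hτ : τ = ρ
        · simp [hτ]
        · rw [if_neg hτ, Bool.eq_false_iff.2 fun e => hτ (outputCell_injective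
            (Nat.eq_of_beq_eq_true e))]
          rfl
    have h₄ := hS _ h₃
    rw [hrow, dig_sum outputCell_injective fun ρ => hlt τ ρ] at h₄
    rw [Matrix.map_apply, Matrix.one_apply, Int.cast_natCast, ← ZMod.natCast_mod, h₄]
    split_ifs <;> simp
  · have h₃ : ∑ ρ, Q τ ρ • P ρ =
        digComb (fun c => ∑ ρ : Equiv.Perm (Fin k), surjCount k c ρ • P ρ) (N τ) cs.reverse := by
      rw [digComb_sum]
      refine sum_congr rfl fun ρ _ => ?_
      rw [natCast_zsmul]
      exact (digComb_map (multiplesHom E (P ρ)) (fun c => surjCount k c ρ) _ _).symm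
    rw [h₃]
    exact digComb_mem W _ fun c hcm => h c (List.mem_reverse.1 hcm)

end

/-! ### Items that determine all pattern counts -/

/-- The pair of bits with a given number. -/
def bits (x : ℕ) : Bool × Bool := (Nat.beq (x / 2 % 2) 1, Nat.beq (x % 2) 1)

/-- The symmetry with a given number. -/
def symOfNum (x : ℕ) : Bool × Bool × Bool := (Nat.beq (x / 4 % 2) 1, bits x)

/-- The tree with `m + 1` vertices and a given number. -/
def treeOfNum : ℕ → ℕ → List (ℕ × Bool × Bool)
  | 0, _ => []
  | m + 1, x => (x / 4 % 4, bits x) :: treeOfNum m (x / 16)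

/-- An item, to be evaluated at the image under a symmetry. -/
abbrev Job : Type := (Bool × Bool × Bool) × Item

/-- The inequalities for a job. -/
def Job.con (j : Job) : List (ℕ × ℕ) × List (ℕ × ℕ) := symCon j.1 j.2.con

/-- The jobs for the trees with given numbers. -/
def treeJobs (m : ℕ) (l : List ℕ) : List Job :=
  l.map fun x => ((false, false, false), .tree (treeOfNum m x))

/-- Items for the patterns of size `1`. -/
def jobsOne : List Job :=
  treeJobs 0 [
    0x0]

/-- The certificate for `jobsOne`. -/
def certOne : List (ℕ × ℕ) := [
  (0, 0x1)]

/-- Items for the patterns of size `2`. -/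
def jobsTwo : List Job :=
  treeJobs 1 [
    0x0, 0x1]

/-- The certificate for `jobsTwo`. -/
def certTwo : List (ℕ × ℕ) := [
  (1, 0x1), (2, 0x5)]

/-- Items for the patterns of size `3`. -/
def jobsThree : List Job :=
  treeJobs 2 [
    0x3, 0x12, 0x1, 0x2, 0x13, 0x0]

/-- The certificate for `jobsThree`. -/
def certThree : List (ℕ × ℕ) := [
  (5, 0x271), (7, 0xe49), (11, 0xc3c), (15, 0x3168), (19, 0x30d7), (21, 0xc35)]

/-- Items for the patterns of size `4`. -/
def jobsFour : List Job :=
  treeJobs 3 [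
    0x34, 0x125, 0x14, 0x24, 0x35, 0x36, 0x105, 0x124, 0x127, 0x135, 0x3, 0x12, 0x13, 0x33, 0x112,
    0x122, 0x16, 0x25, 0x107, 0x15] ++
  [0, 1, 2, 3].map fun x => (symOfNum x, .mid₂)

/-- The certificate for `jobsFour`. -/
def certFour : List (ℕ × ℕ) := [
  (27, 0x878678326eac9), (30, 0x21e19e0cf51353), (39, 0x21e22c375dfe5f), (45, 0x2ea121ec5a4),
  (54, 0x3b9ae3), (57, 0x2a5d7dbd6f81ba), (75, 0x21e19e0cad8cc7), (78, 0xb90e9ac0ec88b2),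
  (99, 0xbebc7), (108, 0x8791925e319a2), (114, 0x7b04dd69ad64a4), (120, 0x649d2dc08404),
  (135, 0x1dd7cd53f8), (141, 0x7b0629f263c8ef), (147, 0x2c0bb3dd30c4e6), (156, 0x12a05f3),
  (177, 0x95ceb62a6700f3), (180, 0xa9681640c9609f), (198, 0x8786e9e2434ba), (201, 0x9184e7a7),
  (210, 0x6d812ab9e343c), (216, 0xa9ad7aaf7c0f33), (225, 0xa968171951b273), (228, 0x2a5a058fc295ed)]

/-- Items for the patterns of size `5`. -/
def jobsFive : List Job :=
  treeJobs 4 [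
    0x34b, 0x125a, 0x334, 0x1225, 0x2116, 0x3007, 0x349, 0x34a, 0x35b, 0x36b, 0x124a, 0x1258,
    0x125b, 0x127a, 0x134, 0x234, 0x1025, 0x1235, 0x2016, 0x3017, 0x149, 0x24a, 0x135b, 0x236b,
    0x34, 0x124, 0x1035, 0x1125, 0x2036, 0x3127, 0x14b, 0x169, 0x24b, 0x25a, 0x134b, 0x135a, 0x234b,
    0x2369, 0x35a, 0x369, 0x124b, 0x1278, 0x136, 0x235, 0x1027, 0x1234, 0x2017, 0x2134, 0x3016,
    0x33, 0x123, 0x1122, 0x335, 0x336, 0x1224, 0x1227, 0x2114, 0x2117, 0x3005, 0x3006, 0x359, 0x36a,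
    0x1248, 0x127b, 0x35, 0x36, 0x125, 0x126, 0x1034, 0x1037, 0x1124, 0x1127, 0x2034, 0x2037,
    0x2124, 0x2127, 0x3035, 0x3125, 0x13, 0x23, 0x135, 0x236, 0x1024, 0x2014, 0x148, 0x159, 0x26a,
    0x137b, 0x3, 0x12, 0x15b] ++
  [3, 7, 11, 15, 19, 23, 27, 31, 1, 5, 9, 13, 17, 21, 25, 29, 2, 6, 10, 14, 18, 22, 26, 30, 0].map (fun x => (symOfNum (x / 4), .leafMid₂ (bits x))) ++
  [0, 1, 2, 3].map fun x => (symOfNum x, .mid₃)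

/-- The certificate for `jobsFive`. -/
def certFive : List (ℕ × ℕ) := [
  (194, 0x3f72d3e800858a98dcf65ccbf1f23dfdae003bb590c66a6b47769de0ff2156de6cd49),
  (198, 0xff51238f0c56cf81bec8d5ab75871a3832f6b2d479c65c5bb92b233d9c3e7a3b7465b),
  (214, 0x7ee5a7d0010b153aee4a21470131df3627c640497d46ffc71dfdad128f9f00a5574d9),
  (222, 0x103e29f5c2b18bedc9f96fd1e7ec180fca3d7fecf1dcc74678b1d29101bc2d2aa167),
  (238, 0x103e29f5c2b18bedc9f96fd1e7ec180fca3d7fecf1dcc74678b239cc6f4a97781317),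
  (242, 0x1dddd3b0da0a64c32ba8b06fa18ac4d73306d3df9c96546a5734f08b891e60b4d65a64),
  (294, 0x8786ae1a9ad522a38ad95e6fa5b8ae3203ebb130fc96da254e1cc6b6337e1103f2fb8),
  (298, 0x303bf56ff44bd4a501d0faaada54db59c6c63abfafd3d32c953324e817b1ae3002d6d6),
  (334, 0x806b84431ef713c04938005eccbc21ee89f8d77d95690941c19af530a80d6d3cf405f),
  (346, 0x3d508b0c276fa7e9c9440f4c493989ca248d480a90ce84fb97a91e1a674fbf12),
  (358, 0x625c2f9cb24ee3019e5be5a9bc60fd115d8495abf305fb985f5e8241adc3c669093fa6),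
  (366, 0x126b4fbc6e04f39ec81a2b8275bb5947a970b5b0d8d7ed2be7b726d13353741558662b),
  (414, 0x806b7c16652137a555fa8872ae6fdf2e788e8844ce62041793318080c909318cd25bc),
  (422, 0x5593faf2701be611f9ed061f0ac766fe7a6d0cd679b5684b7fc632fe600a9e53952a86),
  (434, 0x5f1d55e32bb224934a9d65ca2ae1479f81ab230d651984d448302c3fecde98024fb56a),
  (446, 0x51ff98b11d3a4ebc325764e54dbe56a759c74adf769f3bad2ab4a54b5686bdacdfe44c),
  (482, 0x4933ef4731cf3e643b5803909e5d1ed1c16d1fa11ee740183e3f91e26cdeedfd2bd282),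
  (486, 0x32142b0217d8369c6eaacbe1d0f1bb7d0d1231b71638073e4ea20b01c97da5bd748455),
  (538, 0x19d971e4fe8401e8d),
  (542, 0x5e3b246eaa7374db906a1ec1064e7edfa6c6e90de677fdbdf55697bd6b8de90ea9b962),
  (558, 0x201294b2a62ad42c1d4aaf596b29f0cc73a1ced9197ac83d89552fab34cd73fe008648),
  (566, 0x2db02dd4df068d8f7c5054396f1c317d7fbd731cedcf1fa79c7c753db0324381d353fb),
  (582, 0x115ce9d74d57e6842ef2c4488b38d4b69fc1edf528488639b89e908ce901b6c5a462e3),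
  (586, 0x13d3e2e2d1abf9846cfbdbbd06e2a3b8e63427b8f05b73f035c676dd4eece878ed78ca),
  (694, 0x10568734b355963faea865f9a2c7fa33e1ecdc2cd54792716266dd2241b22f54278b37),
  (698, 0x458a23a429881f1208b3e6baa8ead5d9d3fa68fabb2ba9f02f63d30662c3a66add7e9),
  (714, 0x303d5f93a74a620d984b741fd23082eae308cc425ac734d6f2ab08795f277f7cd6cc59),
  (722, 0x14d6c42c0a179dde1197491e6f7259a2aa61ad7cc41d08189a28d2cfe167a7a85982f5),
  (738, 0x1f0dc57fc04249a7dfc6960743ccd052b0ebc2745b1b71c596fb1bbb2f12bcda1cd1fa),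
  (742, 0x1453f137b68464a24c583ea5f92c1dd62ea91d8149f2fb4720fd4c8103088d6dee4ca1),
  (894, 0x5136d1cccd77bba4f1df2f19879c784ef3337fa0b94fe4605b7930af3b48450b6e1b),
  (898, 0x14b6dfe45eac04325a4b17ad56b8c4cac6326d5d14a51765d731d379457164e68b32c1),
  (954, 0x52b7d2dcc80cd2e9),
  (970, 0x3f72d455017cbca6153d51bff929e20e144a86a1369bd289286307d0fe9dd00992e2e),
  (978, 0x797ca045b4fc3ecd264c9a0197be3bd28ca72ca6b61b517cc07a30e8ac1f9faf553ec),
  (990, 0x5b6f45b3e5c76e693de4f9d69a9367d889cced605dcc09d18476a29e8461c5162ca5fa),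
  (1014, 0x5593daab9717ce50c248aaa14957783d543dcf8168f57a46108ed0ac1f3b1df95dad3d),
  (1022, 0x449d092afdd4f9e358157fcf3eed78482831e66993b428e4c031536a5d9ec3203f1e78),
  (1054, 0x526165e9972500e429996a8cb6e25ea7e02da83b21d64ca0900414df8569316be3aa0d),
  (1070, 0x436856a24ef65e254ca946159957d95b013a458c2cd610fa55d68845bb49fa111f4e6),
  (1102, 0x17353cb061471952782048fe9a6f4e63ba9703d4508c9a9bdcab099dae1dd19825dab),
  (1110, 0x21e07ff3976b3c12ba6ec4e8e4902086f6c2369f56a0778592ceac6cbbfd6ca2e1de66),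
  (1138, 0x44aad06f0f3eecd59a87f24bf5e2ca180590cb5de575a1c4b024c0ce7349ba0c1678ef),
  (1142, 0x21f8fe018a40c5366261d03060555a6ae0d48595740134288e94ddf1abe3ff821c5687),
  (1178, 0x378dd6c287b3ce251deec37e62849f15fa346089392dda65352ae697d982a1c09c9393),
  (1190, 0x57cfd81d68018c995364d01f651f08cedd1b1eb58cd657716be99d76620ce19bab252d),
  (1202, 0x180289baaa19c60bff9cddfdd50c0716547d92d55c77665df596175d76e101f9901e82),
  (1210, 0x134b3bc10bf7060f3b7187093a271b0662d5ca55fdc9dfd8804aef7eeba8e4ec36),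
  (1294, 0x5136d1cccd77bba4f1df2f19879c784ef3337fa0b94fe4605b791c09bef8962f242b),
  (1298, 0x1f4f1888bbd6325a5f58526b97ae3ff998c8799f5bfce8dd9f5ca7da973ef643134f30),
  (1334, 0x62c6c10e95eed4f767b5588880dcfe07afe4b101273f213c4030d2bcbed6c560b250bb),
  (1346, 0x7b788bb7dad02e04767058826d60c52828868a3a4998140702ff8b3b48dbb0915371a),
  (1358, 0x39b1bc6950e304e7602f51aefa3511633cd13bb706e0d5fede708f8649630585aaca59),
  (1366, 0x11044994e3f188f0022d86daf80a5b0cba211a11aca1ff0bf9c540337e537f1d1e7a53),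
  (1394, 0x1d7c1f47b855f75f9aae8b091e03f67ca7ad0824752409630f3f4519386149050e6c5a),
  (1398, 0x149c3465f077a82ec14f5c9cef68f225ba6731f8da3efced22aa945caa9f95e2105448),
  (1454, 0x12f64b886ba05821555b64bff07e522e0af81bf23ca17f99f3d3b30b5feac0234876d8),
  (1470, 0x5bf8fb0c229a0c7a4613bad0e6a8a8d3650209ec485499476576dc2d8c03a00a8c649e),
  (1478, 0x10c1fe49ff6317fc78f2b92ebf3a4d5ea8b1677096afa517ba04231c0dd5acb0c4fbbb),
  (1490, 0x3a374d18de01441f2e64cfcadb730a4da7902ff3f9264e6679f5989e6c58a7fb2850d6),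
  (1634, 0x49554d7eb52be967009a9e8b9b83461ee4a20906a46a4431afbac6c8e581b9d51bf1d0),
  (1646, 0xf1e0a9d7804bc216ba44683d7f8f69d32bb8219a4d3b4990fa2f0fc92bb5cd3cbf40),
  (1654, 0x32548c159623220c0bca406c823b67792ae411d69a8540999ed551c6356f4bc7c513c4),
  (1670, 0x21e106ff966527d8611be6d3380d50189d25b8219b6ff3353a8a1c5505e34eb07f1a07),
  (1726, 0x4b2ba9a77fc91f6440820de7735eb987780ed4a93a2f4c885fe8baa5d360a2dadac1a9),
  (1730, 0x2c0735e90da70ca80264db95c918ab6eb4081924c5369cc6c3e7118ba76d253d294c8c),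
  (1758, 0x1ff1554ffc9f7204897519bfa17fcac278d22e583613a92211740975013488b5939e86),
  (1766, 0x3329cd726aa077c6588f6fa63457e49e00cb6e3b9f64e027b3f25a366798452f1bec00),
  (1778, 0x56ba8f3bdeee880a613a237e338214d41a788d191b7e7777b76829b882626b4f890dcd),
  (1790, 0x555b65707790184e84089bdc0ce3f96428ffe353e80a7835d586152438a421453d2812),
  (1826, 0x3d28116f01bd2e92ee31a43119ecce83911e145785eafe21caa7a2e473e640bf7a4a44),
  (1830, 0x1961219000356aa38b95beb7fa60e598ac0017e239e8f75e1c95d8c081283ac974ddf),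
  (1914, 0x273dc9a160eb4cbe954a473b1024d310bb3bb339f646bb824e46e049d94347e),
  (1922, 0x44cae3fe311f71ff18194b4c779326cfd4b5d59d9c1625edf94155c31e4cdc6ca13489),
  (1934, 0x1fd0d1ad7c8cf7cb48c0f10a636e21b66d9afcefc3d4530314195d775e860d74772c2c),
  (1946, 0x378d43ba2a43f015b5bca85021f38a63ab1fb01d69d8e17794df4fd8ed5a63845591a1),
  (1982, 0x1ff12fb596cffe75578e8dcc090a94fa94b69ca205ec99dcd3d0e584f7e73b4d1d339b),
  (1986, 0x569a7c5a5f856ec1eaabca38bfdde87dba40c7fa2a1595f6673815e3b23c27b2960f71),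
  (2014, 0x5e3b79956ce9891685ac1451ed4fc1e1110edef075371a88426ff56112c5a40cefb8ff),
  (2022, 0x21d951060d164e872af0cb0b9cba82c7edff7eca87b36079cc442c66a8e634fd6d646d),
  (2054, 0x2daf7d2b7a8e50b4470b2fbb7ce1ee1b25fc1243bc48cf3a0d04cce759899028e447f5),
  (2070, 0x574482f6921d99a14074f7fc952e0396efecf8204541b63fe1d484daa573d95b29d2e4),
  (2102, 0x3308670c4f079474cee9d06f352dede4885f6dde663cb18ae4ac55f01258d54371bcd8),
  (2110, 0x555b6a1e46dbc2d80d5c23081fcc61891cc8c827e17617070601e72065d64dedb1f002),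
  (2134, 0x10d34dfc8db504f35aaca3ed0e8026232cf20786fd5d1dfc55c4d3e666ee8c29b04f00),
  (2146, 0x188d29b6a110272a7023ddb8f1cd9c989d765657eac3b1b6d1cfd35238d0a3ff224f60),
  (2154, 0x13d435624cc21b05c4afbf6d7d3f0f2250ee5b91b29f008d30b3a440eb619ce0f9d9b6),
  (2170, 0x108b2a2c28029095),
  (2226, 0x3d28061f81c41b57ffe5da52166ac544755d55a2e7a915a47c1b0d2bd0d4eac0d27b15),
  (2230, 0x1961219000356aa38b95beb7fa60e598ac0017e239e8f75e1c95d90292b606929c30f),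
  (2382, 0x57785a18e950a42d58a0e6823720d7bfa095b24965cb017fe76043ed8889d4abb68473),
  (2386, 0x4451ffc9602788d761a752b569e59964bc662b1496bbe2ab1cf883ab5b095cbb788e16),
  (2402, 0x4492aab53531a6b669e03753c18cb0db8c5ba931a35dc214107ed3a2f3bb4b824b5167),
  (2410, 0x8e991fc1eb1da2f71adb4522388fd715c9d0d64a0fba84ea5c9378aa59561ffc7ca20),
  (2426, 0x156d33f37e20cf15fa21f134cba36e85f585cb07b32d60286f7a9dceb00bcde7d2da2d),
  (2430, 0x51b0a40780abef3e6949fde02de7e30369a04ce02a65dc36ec0251ab487aeca4c5b813),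
  (2538, 0x3f72d3ec5cb863a3a1c60031ddc1448db217af5897688d4dc119ac5b3c8cb7e026b26),
  (2542, 0x1475677e85369875d4221c2c9fac737b3fd0ed82ed852c0330aa4cbf68879ac918b1c5),
  (2558, 0x54baeb4ba9cc414baa1ce867fab5cbedcf551a6e31546721c7c87b33623ed39509a2a8),
  (2566, 0x27d0b8afec46784a00557042491788dd764d37246ec1138b62e8fbf6695dc849f9b801),
  (2582, 0x1b3fd07eb146fe86141e46d49c17cb0b2345a4c7b80a5ade9d7a5c73c236c04ea63435),
  (2586, 0x813f3978f894098c1),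
  (2638, 0x140bcc35449a0b0a49cfee7aebd895e4969e796c52358069eaac83e1b8c2026e2f9b59),
  (2642, 0xacafbbf33dd380d8e7949d8182615dbf41bf6b6549395d0eef615bf969d47c57ad0ac),
  (2678, 0x283a67b1778ff5ada23bb18cc52b2e2c30af3b10c6272bc3417105d56dda7114632d1a),
  (2690, 0x27db167fcff06a962f903160920944b97f2a6e1949453763d7e825b9120682a2cd59aa),
  (2702, 0x4c204a814eee05cc627d56d37535d6bef8c33e5b706766e87bad35ab07bf5b34198719),
  (2710, 0x27ace66c0ebc39485d482729a7fc286e57b5a8108bc9834acee1bb85f751c9c281bc08),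
  (2758, 0x1ba0831925b5046891e7ddc76b974bea3f174397d2106f7812cc7a81b99300d78b7b7e),
  (2766, 0x4b9742595a25b9669566fef3b6e7061ba464182eae0bb749af11702cf50191d4654b0b),
  (2778, 0x14ffac9ecb5df463563697ef020cc495d8cf4d5173a9816b14750b9a1a8ca2c59a6),
  (2790, 0x27acb1325b6f13316661e2ca38a2facc83f0672bda8e714588426599b7fa2a33b954e3),
  (2826, 0x2a220adfcc8af18fddefd46613f383046ffde248322d2e71f540608050bf9a3df25667),
  (2830, 0x2a0c1f388c449e57ca19ec4fa9b4097b360f332d2b8172b30e85dc8e39f0f32032a714),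
  (2882, 0x3b80861c7d6acdc93a6c2cc8440334b30171f3d160d298d877aadafef56c551058349d),
  (2886, 0x33fa1fdf3bd1bfc5b98499061959e698ed91995c9f8f4a7b1bf2f116dd534fe8ec3),
  (2902, 0x33fa1fdf3bd1bfc5b98499061959e698ed91995c9f8f4a7b1bd2ae84a0d217b5653),
  (2910, 0x27a7c471005376e77333b4078c23fdf9e4b9569aa71a71fa6a5a36daef962ccde5e825),
  (2926, 0x4f546854fd9488e90ebd586d47012deab7d6904955a6fa7514dee1185db596920da6bf),
  (2930, 0x13d3e2388029bb4fc50cfcffbb9bb35f466012a8bd3e0141865511564fba6b2582026d)]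

theorem certifies_jobsOne : certifies 1 (jobsOne.map Job.con) certOne = true := by
  decide +kernel

theorem codes_certOne : certOne.map Prod.fst = permCodes 1 := by
  decide +kernel

theorem certifies_jobsTwo : certifies 2 (jobsTwo.map Job.con) certTwo = true := by
  decide +kernel

theorem codes_certTwo : certTwo.map Prod.fst = permCodes 2 := by
  decide +kernel

theorem certifies_jobsThree : certifies 3 (jobsThree.map Job.con) certThree = true := by
  decide +kernel

theorem codes_certThree : certThree.map Prod.fst = permCodes 3 := by
  decide +kernel

theorem certifies_jobsFour : certifies 4 (jobsFour.map Job.con) certFour = true := by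
  decide +kernel

theorem codes_certFour : certFour.map Prod.fst = permCodes 4 := by
  decide +kernel

theorem certifies_jobsFive : certifies 5 (jobsFive.map Job.con) certFive = true := by
  decide +kernel

theorem codes_certFive : certFive.map Prod.fst = permCodes 5 := by
  decide +kernel

instance IsTree.decidable : ∀ T : List (ℕ × Bool × Bool), Decidable (IsTree T)
  | [] => .isTrue trivial
  | (p, _) :: T => @instDecidableAnd (p ≤ T.length) (IsTree T) _ (IsTree.decidable T)

instance (i : Item) : Decidable i.Valid := by
  cases i <;> unfold Item.Valid <;> infer_instance

/-- The number of homomorphisms of a job, as a function on all permutations. -/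
noncomputable def jobFun (j : Job) (n : ℕ) (π : Equiv.Perm (Fin n)) : ℚ :=
  homCount j.2.size j.2.con (image j.1 π)

/-- The number of occurrences of a pattern, as a function on all permutations. -/
noncomputable def patFun {k : ℕ} (σ : Equiv.Perm (Fin k)) (n : ℕ) (π : Equiv.Perm (Fin n)) : ℚ :=
  patternCount σ π

/-- The linear combinations of the functions of jobs. -/
noncomputable def jobSpan : Submodule ℚ ((n : ℕ) → Equiv.Perm (Fin n) → ℚ) :=
  Submodule.span ℚ (jobFun '' {j | j.2.Valid})

theorem symCon_lt {k : ℕ} {c : List (ℕ × ℕ) × List (ℕ × ℕ)}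
    (hc : ∀ p, p ∈ c.1 ∨ p ∈ c.2 → p.1 < k ∧ p.2 < k) (g : Bool × Bool × Bool) (p : ℕ × ℕ)
    (hp : p ∈ (symCon g c).1 ∨ p ∈ (symCon g c).2) : p.1 < k ∧ p.2 < k := by
  have hf : ∀ b l, p ∈ flipCon b l → p ∈ l ∨ p.swap ∈ l := fun b l h => by
    cases b
    · exact .inl h
    · obtain ⟨q, hq, rfl⟩ := List.mem_map.1 h
      exact .inr (by simpa using hq)
  have hd : ∀ q, q ∈ (if g.1 then c.swap else c).1 ∨ q ∈ (if g.1 then c.swap else c).2 →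
      q.1 < k ∧ q.2 < k := fun q hq => by
    refine hc q ?_
    split_ifs at hq
    · exact hq.symm
    · exact hq
  have : ∀ l : List (ℕ × ℕ), (∀ q ∈ l, q.1 < k ∧ q.2 < k) → p ∈ l ∨ p.swap ∈ l → p.1 < k ∧ p.2 < k :=
    fun l hl h => by
      rcases h with h | h
      · exact hl _ h
      · exact (hl _ h).symm
  rcases hp with hp | hp
  · exact this _ (fun q hq => hd q (.inl hq)) (hf _ _ hp)
  · exact this _ (fun q hq => hd q (.inr hq)) (hf _ _ hp)

theorem patFun_mem_of_certifies {k : ℕ} (hk : 0 < k) {jobs : List Job} {cert : List (ℕ × ℕ)}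
    (hcert : certifies k (jobs.map Job.con) cert = true)
    (hcodes : cert.map Prod.fst = permCodes k) (hlen : jobs.length * (4 * k.factorial) < 65536)
    (hjobs : ∀ j ∈ jobs, j.2.size = k ∧ j.2.Valid)
    (ih : ∀ m, 0 < m → m < k → ∀ σ : Equiv.Perm (Fin m), patFun σ ∈ jobSpan)
    (σ : Equiv.Perm (Fin k)) : patFun σ ∈ jobSpan := by
  refine mem_of_certifies hcert hcodes (by rwa [List.length_map]) (fun c hc => ?_) jobSpan patFun
    (fun c hc => ?_) σ
  · obtain ⟨j, hj, rfl⟩ := List.mem_map.1 hc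
    exact symCon_lt (fun p hp => by
      have := Item.con_lt (hjobs j hj).2 p hp
      rwa [(hjobs j hj).1] at this) _
  · obtain ⟨j, hj, rfl⟩ := List.mem_map.1 hc
    have h₁ : jobFun j = ∑ m ∈ range k, ∑ σ : Equiv.Perm (Fin m), surjCount k j.con σ • patFun σ +
        ∑ σ : Equiv.Perm (Fin k), surjCount k j.con σ • patFun σ := by
      funext n π
      rw [jobFun, (hjobs j hj).1, homCount_image, homCount_eq_sum, sum_range_succ]
      simp only [Pi.add_apply, Finset.sum_apply, Pi.smul_apply]
      simp only [patFun, nsmul_eq_mul, Job.con]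
      push_cast
      simp only [mul_comm]
    rw [← sub_eq_iff_eq_add'] at h₁
    rw [← h₁]
    refine sub_mem (Submodule.subset_span ⟨j, (hjobs j hj).2, rfl⟩) (sum_mem fun m hm =>
      sum_mem fun τ _ => ?_)
    rcases m.eq_zero_or_pos with rfl | hm'
    · have : surjCount k j.con τ = 0 := by
        classical
        unfold surjCount
        refine card_eq_zero.2 (filter_eq_empty_iff.2 fun g _ => ?_)
        exact absurd (g ⟨0, hk⟩).2 (by simp)
      rw [this, zero_smul]
      exact zero_mem _
    · exact nsmul_mem (ih m hm' (mem_range.1 hm) τ) _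

theorem patFun_mem_jobSpan (σ : Equiv.Perm (Fin 5)) : patFun σ ∈ jobSpan := by
  have h₁ : ∀ σ : Equiv.Perm (Fin 1), patFun σ ∈ jobSpan :=
    patFun_mem_of_certifies one_pos certifies_jobsOne codes_certOne (by decide +kernel)
      (by decide +kernel) fun m h h' => by omega
  have h₂ : ∀ σ : Equiv.Perm (Fin 2), patFun σ ∈ jobSpan :=
    patFun_mem_of_certifies two_pos certifies_jobsTwo codes_certTwo (by decide +kernel)
      (by decide +kernel) fun m h h' => by
        obtain rfl : m = 1 := by omega
        exact h₁
  have h₃ : ∀ σ : Equiv.Perm (Fin 3), patFun σ ∈ jobSpan :=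
    patFun_mem_of_certifies three_pos certifies_jobsThree codes_certThree (by decide +kernel)
      (by decide +kernel) fun m h h' => by
        interval_cases m
        exacts [h₁, h₂]
  have h₄ : ∀ σ : Equiv.Perm (Fin 4), patFun σ ∈ jobSpan :=
    patFun_mem_of_certifies four_pos certifies_jobsFour codes_certFour (by decide +kernel)
      (by decide +kernel) fun m h h' => by
        interval_cases m
        exacts [h₁, h₂, h₃]
  exact patFun_mem_of_certifies (by norm_num) certifies_jobsFive codes_certFive (by decide +kernel)
    (by decide +kernel) (fun m h h' => by
        interval_cases m
        exacts [h₁, h₂, h₃, h₄]) σ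

theorem exists_jobs (σ : Equiv.Perm (Fin 5)) : ∃ (D : ℕ) (L : List (ℤ × Job)), 0 < D ∧
    (∀ p ∈ L, p.2.2.Valid) ∧ ∀ (n : ℕ) (π : Equiv.Perm (Fin n)), (D * patternCount σ π : ℤ) =
      (L.map fun p => p.1 * (homCount p.2.2.size p.2.2.con (image p.2.1 π) : ℤ)).sum := by
  suffices h : ∃ (D : ℕ) (L : List (ℤ × Job)), 0 < D ∧ (∀ p ∈ L, p.2.2.Valid) ∧
      ∀ n π, D * patFun σ n π = (L.map fun p => p.1 * jobFun p.2 n π).sum by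
    obtain ⟨D, L, hD, hL, h⟩ := h
    refine ⟨D, L, hD, hL, fun n π => ?_⟩
    have := h n π
    simp only [patFun, jobFun] at this
    refine Int.cast_injective (α := ℚ) ?_
    push_cast
    rw [this, List.map_map]
    refine congrArg List.sum (List.map_congr_left fun p _ => ?_)
    simp
  refine Submodule.span_induction (p := fun F _ => ∃ (D : ℕ) (L : List (ℤ × Job)), 0 < D ∧
    (∀ p ∈ L, p.2.2.Valid) ∧ ∀ n π, D * F n π = (L.map fun p => p.1 * jobFun p.2 n π).sum)
    ?_ ?_ ?_ ?_ (patFun_mem_jobSpan σ)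
  · rintro _ ⟨j, hj, rfl⟩
    exact ⟨1, [(1, j)], one_pos, by simpa using hj, fun n π => by simp⟩
  · exact ⟨1, [], one_pos, by simp, fun n π => by simp⟩
  · rintro F G - - ⟨D, L, hD, hL, h⟩ ⟨D', L', hD', hL', h'⟩
    refine ⟨D * D', L.map (fun p => (p.1 * (D' : ℤ), p.2)) ++ L'.map (fun p => (p.1 * (D : ℤ), p.2)),
      Nat.mul_pos hD hD', fun p hp => ?_, fun n π => ?_⟩
    · simp only [List.mem_append, List.mem_map] at hp
      rcases hp with ⟨q, hq, rfl⟩ | ⟨q, hq, rfl⟩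
      exacts [hL q hq, hL' q hq]
    · have : ∀ (M : List (ℤ × Job)) (d : ℕ), ((M.map fun p => (p.1 * (d : ℤ), p.2)).map fun p =>
          (p.1 : ℚ) * jobFun p.2 n π).sum = d * (M.map fun p => p.1 * jobFun p.2 n π).sum := by
        intro M d
        rw [← List.sum_map_mul_left, List.map_map]
        refine congrArg List.sum (List.map_congr_left fun p _ => ?_)
        simp only [Function.comp_apply]
        push_cast
        ring
      rw [List.map_append, List.sum_append, this, this, ← h, ← h']
      simp only [Pi.add_apply]
      push_cast
      ring
  · rintro a F - ⟨D, L, hD, hL, h⟩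
    refine ⟨D * a.den, L.map fun p => (p.1 * a.num, p.2), Nat.mul_pos hD a.pos, fun p hp => ?_,
      fun n π => ?_⟩
    · obtain ⟨q, hq, rfl⟩ := List.mem_map.1 hp
      exact hL q hq
    · have h₁ : ((L.map fun p => (p.1 * a.num, p.2)).map fun p =>
          (p.1 : ℚ) * jobFun p.2 n π).sum = a.num * (L.map fun p => p.1 * jobFun p.2 n π).sum := by
        rw [← List.sum_map_mul_left, List.map_map]
        refine congrArg List.sum (List.map_congr_left fun p _ => ?_)
        simp only [Function.comp_apply]
        push_cast
        ring
      rw [h₁, ← h]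
      simp only [Pi.smul_apply, smul_eq_mul]
      push_cast
      have h₂ : a * a.den = a.num := Rat.mul_den_eq_num a
      linear_combination D * F n π * h₂

/-! ### The program for one pattern -/

/-- The reflected index `n - 1 - e`, or `e`. -/
def Ex.flip (b : Bool) (e : Ex) : Ex := if b then .par 0 - (e + .lit 1) else e

/-- The program that writes the image of the permutation in array `0` under a symmetry and its
inverse to the arrays `1` and `2`. -/
def imageProg (g : Bool × Bool × Bool) : St :=
  let k := if g.1 then 2 else 1
  .seq (.table k 0 ((Ex.rd 0 ((Ex.var 0).flip g.2.1)).flip g.2.2))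
    (.loop 1 0 (.store (3 - k) (.rd k (.var 1)) (.var 1)))

/-- The program that adds a multiple of the number of homomorphisms of a job to the entry `0` of
array `4`. -/
def jobProg (p : ℤ × Job) : St :=
  .seq (imageProg p.2.1) <| .seq cntTables <| .seq p.2.2.prog <| .store 4 (.lit 0)
    (.rd 4 (.lit 0) + (.lit p.1.toNat - .lit (-p.1).toNat) * p.2.2.result)

/-- The program for a list of jobs. -/
def jobsProg : List (ℤ × Job) → St
  | [] => .skip
  | p :: L => .seq (jobProg p) (jobsProg L)

section

variable {w κ n q lg : ℕ} {P Y X V : ℕ → ℕ} {A : ℕ → ℕ → ℕ}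

theorem Sizes.eval_flip (hs : Sizes w κ P n q lg) {b : Bool} {e : Ex} {x : Fin n}
    (he : e.eval w κ P A V = x) :
    (e.flip b).eval w κ P A V = (if b then Fin.revPerm else 1 : Equiv.Perm (Fin n)) x := by
  cases b
  · exact he
  · have hn := le_sq n
    have e₁ : (e + .lit 1).eval w κ P A V = x + 1 := by
      rw [Ex.eval_add] <;> rw [he, hs.lit_one]
      exact hs.lt_word (by omega)
    have e₂ : (Ex.par 0).eval w κ P A V = n := hs.p0
    rw [Ex.flip, if_pos rfl, Ex.eval_sub (by rw [e₂]; exact hs.lt_word (by omega))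
      (by rw [e₁, e₂]; omega), e₁, e₂]
    simp [Fin.rev]

theorem Ex.reads_flip {R : ℕ → Prop} {b : Bool} {e : Ex} (he : e.Reads R) : (e.flip b).Reads R := by
  cases b
  · exact he
  · simp [Ex.flip, he]

/-- A loop that inverts a permutation. -/
theorem exec_invert (hs : Sizes w κ P n q lg) (h : PermPair n Y X) {k k' : ℕ} (hk : k ≠ k')
    (hA : ∀ x < n, A k x = Y x) {y : ℕ} (hy : y < n) :
    (St.loop 1 0 (.store k' (.rd k (.var 1)) (.var 1))).exec w κ P V A k' y = X y := by
  have key := iter_induction (f := fun i A => (St.store k' (.rd k (.var 1)) (.var 1)).exec w κ P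
    (Function.update V 1 i) A) (N := n) (a := A)
    (fun i B => B k = A k ∧ ∀ x < i, B k' (Y x) = x) ⟨rfl, fun x hx => by omega⟩
    fun i hi B ⟨h₁, h₂⟩ => by
      have hn := le_sq n
      have e₁ : (Ex.var 1).eval w κ P B (Function.update V 1 i) = i := Function.update_self ..
      have e₂ := hs.eval_rd_pt (A := B) k e₁ hi
      rw [h₁, hA i hi] at e₂
      have hi' := h.y_lt i hi
      simp only [St.exec]
      rw [e₁, e₂, Nat.mod_eq_of_lt (hs.lt_index (by omega : Y i ≤ _))]
      refine ⟨by rw [Function.update_of_ne hk, h₁], fun x hx => ?_⟩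
      rw [Function.update_self]
      by_cases hxi : x = i
      · rw [hxi, Function.update_self]
      · rw [Function.update_of_ne fun he => hxi ((h.y_inj (by omega) hi).1 he), h₂ x (by omega)]
  rw [St.exec, hs.p0]
  have := key.2 (X y) (h.x_lt y hy)
  rwa [h.yx y hy] at this

theorem exec_imageProg (hs : Sizes w κ P n q lg) {π : Equiv.Perm (Fin n)}
    (hA : ∀ x < n, A 0 x = oneLine π x) (g : Bool × Bool × Bool) :
    (∀ x < n, (imageProg g).exec w κ P V A 1 x = oneLine (image g π) x) ∧
      ∀ y < n, (imageProg g).exec w κ P V A 2 y = oneLine (image g π)⁻¹ y := by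
  obtain ⟨tr, fx, fy⟩ := g
  set ρ : Equiv.Perm (Fin n) :=
    (if fy then Fin.revPerm else 1) * π * (if fx then Fin.revPerm else 1) with hρ
  have h₁ : ∀ k ≠ 0, ∀ x < n, (St.table k 0 ((Ex.rd 0 ((Ex.var 0).flip fx)).flip fy)).exec
      w κ P V A k x = oneLine ρ x := fun k hk x hx => by
    rw [hs.exec_table_pt (Ex.reads_flip (by exact ⟨hk.symm, Ex.reads_flip trivial⟩)) hx]
    have e₁ : (Ex.var 0).eval w κ P A (Function.update V 0 x) = (⟨x, hx⟩ : Fin n) :=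
      Function.update_self ..
    have e₂ := hs.eval_rd_pt 0 (hs.eval_flip (b := fx) e₁) (Fin.is_lt _)
    rw [hA _ (Fin.is_lt _), oneLine_coe] at e₂
    rw [hs.eval_flip e₂, oneLine, dif_pos hx]
    rfl
  have h₂ : ∀ k k', k ≠ 0 → k ≠ k' → ∀ y < n,
      (St.loop 1 0 (.store k' (.rd k (.var 1)) (.var 1))).exec w κ P V
        ((St.table k 0 ((Ex.rd 0 ((Ex.var 0).flip fx)).flip fy)).exec w κ P V A) k' y =
      oneLine ρ⁻¹ y := fun k k' hk hk' y hy =>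
    exec_invert hs (permPair_oneLine ρ) hk' (h₁ k hk) hy
  have h₃ : ∀ k k', k ≠ k' → ∀ B : ℕ → ℕ → ℕ,
      (St.loop 1 0 (.store k' (.rd k (.var 1)) (.var 1))).exec w κ P V B k = B k :=
    fun k k' hk B => St.exec_of_writes (.loop 1 0 (.store k' _ _)) hk.symm _ _
  cases tr <;> simp only [imageProg, image, St.exec, Bool.false_eq_true, if_false, if_true,
    inv_inv, ← hρ]
  · exact ⟨fun x hx => (congrFun (h₃ 1 2 (by norm_num) _) x).trans (h₁ 1 (by norm_num) x hx),
      h₂ 1 2 (by norm_num) (by norm_num)⟩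
  · exact ⟨h₂ 2 1 (by norm_num) (by norm_num),
      fun x hx => (congrFun (h₃ 2 1 (by norm_num) _) x).trans (h₁ 2 (by norm_num) x hx)⟩

theorem imageProg_apply_of_ne {k : ℕ} (h₁ : k ≠ 1) (h₂ : k ≠ 2) (g : Bool × Bool × Bool) :
    (imageProg g).exec w κ P V A k = A k := by
  refine St.exec_of_writes _ ?_ _ _
  obtain ⟨tr, g⟩ := g
  cases tr <;> simp [imageProg, St.Writes, St.table, h₁.symm, h₂.symm]

theorem eval_rd_zero (k : ℕ) : (Ex.rd k (.lit 0)).eval w κ P A V = A k 0 := by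
  simp [Ex.eval]

theorem exec_jobProg (hs : Sizes w κ P n q lg) {π : Equiv.Perm (Fin n)}
    (hA : ∀ x < n, A 0 x = oneLine π x) {p : ℤ × Job} (hp : p.2.2.Valid) :
    (jobProg p).exec w κ P V A 0 = A 0 ∧ (jobProg p).exec w κ P V A 4 0 < 2 ^ w ∧
      ((jobProg p).exec w κ P V A 4 0 : ZMod (2 ^ w)) =
        A 4 0 + p.1 * homCount p.2.2.size p.2.2.con (image p.2.1 π) := by
  obtain ⟨c, g, i⟩ := p
  simp only [jobProg, St.exec]
  set A₁ := (imageProg g).exec w κ P V A with hA₁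
  set A₂ := cntTables.exec w κ P V A₁ with hA₂
  set A₃ := i.prog.exec w κ P V A₂ with hA₃
  have hf : ∀ k, k = 0 ∨ k = 4 → A₃ k = A k := fun k hk => by
    rw [hA₃, Item.prog_apply_of_lt (by omega) (by omega), hA₂,
      St.exec_of_writes _ (writes_cntTables.mono fun j hj => ?_), hA₁,
      imageProg_apply_of_ne (by omega) (by omega)]
    simp only [Set.mem_insert_iff, Set.mem_singleton_iff] at hj
    omega
  obtain ⟨h₁, h₂⟩ := exec_imageProg (V := V) hs hA g
  have hb := exec_cntTables (V := V) hs (permPair_oneLine (image g π)) h₁ h₂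
  have hr := Item.cast_eval_result (V := V) hs (permPair_oneLine (image g π)) hb i hp
  rw [i.value_eq hp] at hr
  refine ⟨?_, ?_, ?_⟩
  · rw [Function.update_of_ne (by norm_num), hf 0 (.inl rfl)]
  · rw [Function.update_self, lit_zero, Nat.zero_mod, Function.update_self]
    exact BinOp.eval_lt _ _ _ _
  · rw [Function.update_self, lit_zero, Nat.zero_mod, Function.update_self, Ex.cast_eval_add,
      Ex.cast_eval_mul, Ex.cast_eval_sub, Ex.cast_eval_lit, Ex.cast_eval_lit, eval_rd_zero,
      hf 4 (.inr rfl), hr]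
    congr 2
    conv_rhs => rw [← Int.toNat_sub_toNat_neg c]
    push_cast
    rfl

theorem exec_jobsProg (hs : Sizes w κ P n q lg) {π : Equiv.Perm (Fin n)} (L : List (ℤ × Job))
    (hL : ∀ p ∈ L, p.2.2.Valid) : ∀ A : ℕ → ℕ → ℕ, (∀ x < n, A 0 x = oneLine π x) →
      A 4 0 < 2 ^ w → (jobsProg L).exec w κ P V A 0 = A 0 ∧
        (jobsProg L).exec w κ P V A 4 0 < 2 ^ w ∧
        ((jobsProg L).exec w κ P V A 4 0 : ZMod (2 ^ w)) = A 4 0 +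
          (L.map fun p => p.1 * (homCount p.2.2.size p.2.2.con (image p.2.1 π) : ℤ)).sum := by
  induction L with
  | nil => exact fun A _ h => ⟨rfl, h, by simp [jobsProg, St.exec]⟩
  | cons p L ih =>
    intro A hA h
    obtain ⟨h₁, h₂, h₃⟩ := exec_jobProg (V := V) hs hA (hL p (by simp))
    obtain ⟨h₄, h₅, h₆⟩ := ih (fun p hp => hL p (by simp [hp])) _ (by rwa [h₁]) h₂
    refine ⟨h₄.trans h₁, h₅, ?_⟩
    rw [jobsProg, St.exec, h₆, h₃]
    push_cast
    simp only [List.map_cons, List.sum_cons]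
    push_cast
    ring

/-- The program for a list of jobs, from zero. -/
def patternProg (L : List (ℤ × Job)) : St := .seq (.store 4 (.lit 0) (.lit 0)) (jobsProg L)

/-- The result of `patternProg`. -/
def patternEx (D : ℕ) : Ex := .rd 4 (.lit 0) / .lit D

theorem patternCount_le {k : ℕ} (σ : Equiv.Perm (Fin k)) (π : Equiv.Perm (Fin n)) :
    patternCount σ π ≤ n ^ k := by
  have := Nat.card_le_card_of_injective (fun i : {i : Fin k ↪o Fin n //
    ∀ a b : Fin k, π (i a) < π (i b) ↔ σ a < σ b} => (i.1 : Fin k → Fin n))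
    fun i j h => Subtype.ext (DFunLike.coe_injective h)
  simpa [patternCount] using this

theorem exec_patternProg (hs : Sizes w κ P n q lg) {π : Equiv.Perm (Fin n)}
    (hA : ∀ x < n, A 0 x = oneLine π x) {σ : Equiv.Perm (Fin 5)} {D : ℕ} {L : List (ℤ × Job)}
    (hD : 0 < D) (hL : ∀ p ∈ L, p.2.2.Valid)
    (h : (D * patternCount σ π : ℤ) =
      (L.map fun p => p.1 * (homCount p.2.2.size p.2.2.con (image p.2.1 π) : ℤ)).sum)
    (hw : D * (n ^ 5 + 1) < 2 ^ w) :
    (patternProg L).exec w κ P V A 0 = A 0 ∧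
      (patternEx D).eval w κ P ((patternProg L).exec w κ P V A) V = patternCount σ π := by
  simp only [patternProg, St.exec]
  set A₁ := Function.update A 4 (Function.update (A 4) ((Ex.lit 0).eval w κ P A V % 2 ^ (w - κ))
    ((Ex.lit 0).eval w κ P A V)) with hA₁
  have h0 : A₁ 0 = A 0 := Function.update_of_ne (by norm_num) _ _
  have h4 : A₁ 4 0 = 0 := by
    rw [hA₁, Function.update_self, lit_zero, Nat.zero_mod, Function.update_self]
  obtain ⟨h₁, h₂, h₃⟩ := exec_jobsProg (V := V) hs L hL A₁ (by rwa [h0]) (by rw [h4]; positivity)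
  refine ⟨h₁.trans h0, ?_⟩
  have hle := Nat.mul_le_mul_left D (patternCount_le σ π)
  rw [← h, h4, Nat.cast_zero, zero_add] at h₃
  have e := natCast_inj_of_lt (y := D * patternCount σ π) h₂ (by rw [mul_add] at hw; omega)
    (by rw [h₃]; push_cast; rfl)
  rw [patternEx, Ex.eval_div, eval_rd_zero, Ex.eval_lit, e, Nat.mul_div_cancel_left _ hD]
  · exact (Nat.le_mul_of_pos_right D (Nat.succ_pos _)).trans_lt hw
  · rwa [eval_rd_zero]

end

/-! ### Arrays that are used -/

section Uses

variable {R : ℕ → Prop} {a b : St} {e : Ex} {k j : ℕ}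

@[simp] theorem St.uses_seq : (St.seq a b).Uses R ↔ a.Uses R ∧ b.Uses R := Iff.rfl
@[simp] theorem St.uses_skip : St.skip.Uses R := trivial
@[simp] theorem St.uses_loop {r : ℕ} : (St.loop r j b).Uses R ↔ b.Uses R := Iff.rfl
@[simp] theorem St.uses_store {i : Ex} : (St.store k i e).Uses R ↔ R k ∧ i.Reads R ∧ e.Reads R :=
  Iff.rfl
@[simp] theorem St.uses_table : (St.table k j e).Uses R ↔ R k ∧ e.Reads R := by
  simp [St.table]

end Uses

theorem uses_dom {l : Bool × Bool} {src dst : ℕ} (hs : src < 32) (hd : dst < 32) :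
    (dom l src dst).Uses (· < 32) := by
  obtain ⟨l₁, l₂⟩ := l
  cases l₁ <;> cases l₂ <;>
    simp [dom, Dom.step, Dom.idx, Dom.blk, Dom.pt, hs, hd]

theorem reads_cnt {x y : Ex} (hx : x.Reads (· < 32)) (hy : y.Reads (· < 32)) :
    (Ex.cnt x y).Reads (· < 32) := by
  simp [Ex.cnt, Ex.slabs, hx, hy]

theorem uses_cntTables : cntTables.Uses (· < 32) := by
  simp [cntTables, uses_dom, Ex.slabs, Ex.row, Ex.col, Ex.slabPt]

theorem uses_push₂ {e : Ex} (he : e.Reads (· < 32)) {l l' : Bool × Bool} {dst : ℕ}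
    (hd : dst < 32) : (push₂ e l l' dst).Uses (· < 32) := by
  simp [push₂, uses_dom, he, hd]

theorem uses_fullTables : fullTables.Uses (· < 32) :=
  ⟨uses_push₂ (by simp [Ex.slabs, Ex.row, Ex.col]) (by norm_num),
    uses_push₂ (by simp [Ex.ySlab, Ex.row, Ex.col]) (by norm_num)⟩

theorem uses_mid₃Tables : mid₃Tables.Uses (· < 32) :=
  ⟨uses_push₂ (by simp [Ex.ySlab, Ex.row, Ex.col]) (by norm_num),
    uses_push₂ (by simp [Ex.row, Ex.col]) (by norm_num),
    uses_push₂ (by simp [Ex.row, Ex.col]) (by norm_num), by simp [uses_dom]⟩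

theorem uses_onesProg {m : ℕ} (hm : m ≤ 4) : (onesProg m).Uses (· < 32) := by
  induction m with
  | zero => simp [onesProg]
  | succ m ih =>
    simp only [onesProg, St.uses_seq, St.uses_table, Ex.reads_lit, and_true]
    exact ⟨ih (by omega), by omega⟩

theorem uses_treeProg {T : List (ℕ × Bool × Bool)} (hT : IsTree T) (hl : T.length ≤ 4) :
    (treeProg T).Uses (· < 32) := by
  induction T with
  | nil => simp [treeProg]
  | cons t T ih =>
    obtain ⟨p, l⟩ := t
    have hp : p ≤ T.length := hT.1
    rw [List.length_cons] at hl
    refine ⟨uses_dom (by omega) (by norm_num), ?_, ?_, ih hT.2 (by omega)⟩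
    · simp; omega
    · simp; omega

theorem uses_itemProg {i : Item} (hi : i.Valid) : i.prog.Uses (· < 32) := by
  cases i with
  | tree T => exact ⟨uses_onesProg hi.2, uses_treeProg hi.1 hi.2⟩
  | mid₂ => exact ⟨by simp, uses_fullTables⟩
  | leafMid₂ l => exact ⟨by simp, uses_dom (by norm_num) (by norm_num), uses_fullTables⟩
  | mid₃ =>
    exact ⟨by simp, uses_fullTables, uses_dom (by norm_num) (by norm_num),
      uses_dom (by norm_num) (by norm_num), uses_mid₃Tables⟩

theorem reads_mid₂ {a c : Ex} (ha : a.Reads (· < 32)) (hc : c.Reads (· < 32)) :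
    (Ex.mid₂ a c).Reads (· < 32) := by
  simp [Ex.mid₂, reads_cnt, ha, hc]

theorem reads_mid₃ {a c : Ex} (ha : a.Reads (· < 32)) (hc : c.Reads (· < 32)) :
    (Ex.mid₃ a c).Reads (· < 32) := by
  simp [Ex.mid₃, Ex.sumSlab, Ex.slabPt, Ex.min, reads_cnt, reads_mid₂, ha, hc]

theorem reads_itemResult (i : Item) : i.result.Reads (· < 32) := by
  cases i <;> simp [Item.result, slabSum, Ex.sumSlab, Ex.slabPt, reads_mid₂, reads_mid₃]

theorem uses_imageProg (g : Bool × Bool × Bool) : (imageProg g).Uses (· < 32) := by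
  obtain ⟨tr, fx, fy⟩ := g
  cases tr <;> cases fx <;> cases fy <;> simp [imageProg, Ex.flip]

theorem uses_jobsProg {L : List (ℤ × Job)} (hL : ∀ p ∈ L, p.2.2.Valid) :
    (jobsProg L).Uses (· < 32) := by
  induction L with
  | nil => trivial
  | cons p L ih =>
    exact ⟨⟨uses_imageProg _, uses_cntTables, uses_itemProg (hL p (by simp)),
      by simp [reads_itemResult]⟩, ih fun p hp => hL p (by simp [hp])⟩

theorem uses_patternProg {L : List (ℤ × Job)} (hL : ∀ p ∈ L, p.2.2.Valid) :
    (patternProg L).Uses (· < 32) := ⟨by simp, uses_jobsProg hL⟩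

theorem reads_patternEx (D : ℕ) : (patternEx D).Reads (· < 32) := by simp [patternEx]

/-! ### Sizes -/

/-- The sizes of an instance with `n` points. -/
def params (n : ℕ) : ℕ → ℕ
  | 0 => n
  | 1 => n.sqrt.sqrt
  | 2 => n / n.sqrt.sqrt + 2
  | 3 => (n / n.sqrt.sqrt + 2) * n
  | 4 => n * (n.sqrt.sqrt + 1)
  | 5 => n.size
  | 6 => n + 1
  | _ => 0

theorem le_sqrt_sqrt_iff {m n : ℕ} : m ≤ n.sqrt.sqrt ↔ m * m * (m * m) ≤ n := by
  rw [Nat.le_sqrt, Nat.le_sqrt]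

theorem sqrt_sqrt_le (n : ℕ) : n.sqrt.sqrt ≤ n := (Nat.sqrt_le_self _).trans (Nat.sqrt_le_self _)

theorem size_le_self (n : ℕ) : n.size ≤ n := Nat.size_le.2 n.lt_two_pow_self

theorem params_le (n j : ℕ) : params n j ≤ (n + 2) ^ 2 := by
  have h₁ := sqrt_sqrt_le n
  have h₂ := size_le_self n
  have h₃ : n / n.sqrt.sqrt ≤ n := Nat.div_le_self _ _
  match j with
  | 0 | 1 | 2 | 5 | 6 => simp only [params]; nlinarith
  | 3 => simp only [params]; nlinarith [Nat.mul_le_mul_right n h₃]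
  | 4 => simp only [params]; nlinarith [Nat.mul_le_mul_left n h₁]
  | j + 7 => exact Nat.zero_le _

theorem sizes_params {w κ n : ℕ} (h : (n + 2) ^ 3 ≤ 2 ^ (w - κ)) :
    Sizes w κ (params n) n n.sqrt.sqrt n.size where
  p0 := rfl
  p1 := rfl
  p2 := rfl
  p3 := rfl
  p4 := rfl
  p5 := rfl
  p6 := rfl
  le_two_pow := n.lt_size_self.le
  q_le := sqrt_sqrt_le n
  q_pos := fun hn => le_sqrt_sqrt_iff.2 (by omega)
  big := h

/-- The first parameters. -/
def paramsTo (n m j : ℕ) : ℕ := if j ≤ m then params n j else 0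

/-- The expression for a parameter in terms of the previous ones. -/
def paramEx : ℕ → Ex
  | 1 =>
    let s : Ex := .var 0 + .lit 1
    .sum 0 0 (.ite (.par 0) (s * s * (s * s)) (.lit 0) (.lit 1))
  | 2 => .par 0 / .par 1 + .lit 2
  | 3 => .par 2 * .par 0
  | 4 => .par 0 * (.par 1 + .lit 1)
  | 5 => .sum 0 0 (.ite (.lit 0) (.op .shr (.par 0) (.var 0)) (.lit 1) (.lit 0))
  | 6 => .par 0 + .lit 1
  | _ => .lit 0

theorem reads_paramEx (m : ℕ) (R : ℕ → Prop) : (paramEx m).Reads R := by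
  unfold paramEx
  split <;> simp

@[simp] theorem cost_add (P : ℕ → ℕ) (a b : Ex) : (a + b).cost P = a.cost P + b.cost P + 1 := rfl
@[simp] theorem cost_mul (P : ℕ → ℕ) (a b : Ex) : (a * b).cost P = a.cost P + b.cost P + 1 := rfl
@[simp] theorem cost_div (P : ℕ → ℕ) (a b : Ex) : (a / b).cost P = a.cost P + b.cost P + 1 := rfl

theorem cost_paramEx (n m j : ℕ) : (paramEx j).cost (paramsTo n m) ≤ 50 * n + 50 := by
  have h : paramsTo n m 0 = n := if_pos (Nat.zero_le _)
  unfold paramEx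
  split <;> simp [Ex.cost, h] <;> omega

theorem sum_range_ite_lt {n q : ℕ} (hq : q ≤ n) (p : ℕ → Prop) [DecidablePred p]
    (hp : ∀ r, p r ↔ r < q) : ∑ r ∈ range n, (if p r then 1 else 0) = q := by
  simp only [hp]
  rw [sum_boole, show {r ∈ range n | r < q} = range q from by ext r; simp; omega]
  simp

theorem eval_paramEx {w κ n m : ℕ} {A : ℕ → ℕ → ℕ} {V : ℕ → ℕ} (hw : (n + 2) ^ 4 < 2 ^ w)
    (hm : m < 6) :
    (paramEx (m + 1)).eval w κ (paramsTo n m) A V = params n (m + 1) := by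
  have hsq : (n + 2) ^ 2 ≤ (n + 2) ^ 4 := Nat.pow_le_pow_right (by omega) (by norm_num)
  have hn := le_sq n
  have hP : ∀ j, params n j < 2 ^ w := fun j => (params_le n j).trans_lt (hsq.trans_lt hw)
  have hl : ∀ c ≤ 2, (Ex.lit c).eval w κ (paramsTo n m) A V = c := fun c hc =>
    Ex.eval_lit (by omega)
  have hp : ∀ j ≤ m, (Ex.par j).eval w κ (paramsTo n m) A V = params n j := fun j hj => if_pos hj
  have h0 : paramsTo n m 0 = n := if_pos (Nat.zero_le _)
  match m, hm with
  | 0, _ =>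
    simp only [paramEx]
    rw [Ex.eval, h0, sum_congr rfl (g := fun r => if (r + 1) * (r + 1) * ((r + 1) * (r + 1)) ≤ n
      then 1 else 0) fun r hr => ?_, sum_range_ite_lt (sqrt_sqrt_le n) _ fun r =>
        le_sqrt_sqrt_iff.symm]
    · exact Nat.mod_eq_of_lt (hP 1)
    · have hr := mem_range.1 hr
      have hr' : (r + 1) * (r + 1) * ((r + 1) * (r + 1)) ≤ (n + 2) ^ 4 := by
        rw [show (n + 2) ^ 4 = (n + 2) * (n + 2) * ((n + 2) * (n + 2)) by ring]
        gcongr <;> omega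
      have hr'' : (r + 1) * (r + 1) ≤ (n + 2) ^ 2 := by
        rw [sq]
        gcongr <;> omega
      have e₁ : (Ex.var 0 + .lit 1).eval w κ (paramsTo n 0) A (Function.update V 0 r) = r + 1 := by
        rw [Ex.eval_add] <;> simp only [Ex.eval, Function.update_self,
          Nat.mod_eq_of_lt (show 1 < 2 ^ w by omega)]
        omega
      have e₂ : ((Ex.var 0 + .lit 1) * (Ex.var 0 + .lit 1)).eval w κ (paramsTo n 0) A
          (Function.update V 0 r) = (r + 1) * (r + 1) := by
        rw [Ex.eval_mul] <;> rw [e₁]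
        omega
      rw [Ex.eval, Ex.eval_mul] <;> rw [e₂]
      · rw [show (Ex.par 0).eval w κ (paramsTo n 0) A (Function.update V 0 r) = n from h0,
          Ex.eval_lit (by omega), Ex.eval_lit (by omega)]
        split_ifs <;> omega
      · omega
  | 1, _ =>
    have e := hp 0 (by norm_num)
    have e₁ : (Ex.par 0 / .par 1).eval w κ (paramsTo n 1) A V = n / n.sqrt.sqrt := by
      rw [Ex.eval_div] <;> rw [e]
      · rw [hp 1 le_rfl]; rfl
      · exact hP 0
    simp only [paramEx]
    rw [Ex.eval_add] <;> rw [e₁, hl 2 le_rfl]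
    · rfl
    · exact hP 2
  | 2, _ =>
    simp only [paramEx]
    rw [Ex.eval_mul] <;> rw [hp 2 le_rfl, hp 0 (by norm_num)]
    · rfl
    · exact hP 3
  | 3, _ =>
    have e₁ : (Ex.par 1 + .lit 1).eval w κ (paramsTo n 3) A V = n.sqrt.sqrt + 1 := by
      have := sqrt_sqrt_le n
      rw [Ex.eval_add] <;> rw [hp 1 (by norm_num), hl 1 (by norm_num)]
      · rfl
      · simp only [params]; omega
    simp only [paramEx]
    rw [Ex.eval_mul] <;> rw [e₁, hp 0 (by norm_num)]
    · rfl
    · exact hP 4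
  | 4, _ =>
    simp only [paramEx]
    rw [Ex.eval, h0, sum_congr rfl (g := fun r => if r < n.size then 1 else 0) fun r hr => ?_,
      sum_range_ite_lt (size_le_self n) _ fun r => Iff.rfl]
    · exact Nat.mod_eq_of_lt (hP 5)
    · have e₁ : (Ex.par 0).eval w κ (paramsTo n 4) A (Function.update V 0 r) = n := h0
      rw [Ex.eval, Ex.eval_shr] <;> rw [e₁]
      · rw [show (Ex.var 0).eval w κ (paramsTo n 4) A (Function.update V 0 r) = r from
          Function.update_self .., Ex.eval_lit (by omega), Ex.eval_lit (by omega)]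
        refine if_congr ?_ rfl rfl
        rw [Nat.lt_size, Nat.div_pos_iff]
        simp
      · exact hP 0
  | 5, _ =>
    simp only [paramEx]
    rw [Ex.eval_add] <;> rw [hp 0 (by norm_num), hl 1 (by norm_num)]
    · rfl
    · exact hP 6

/-- The program that computes a parameter. -/
def setParam (κ m : ℕ) : Program :=
  .seq ((paramEx m).compile κ 0) (.instr (.set (pReg m) (.reg (tReg 0))))

/-- The program that computes the first parameters. -/
def setParams (κ : ℕ) : ℕ → Program
  | 0 => .skip
  | m + 1 => .seq (setParams κ m) (setParam κ (m + 1))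

theorem setParams_halts {w κ n : ℕ} {A : ℕ → ℕ → ℕ} {V : ℕ → ℕ} {s : State} (hκ : κ ≤ w)
    (hw : (n + 2) ^ 4 < 2 ^ w) (hs : Rep w κ (paramsTo n 0) A V s) (m : ℕ) (hm : m ≤ 6) :
    Halts w (setParams κ m) s (m * (50 * n + 51) + 1) fun s' => Rep w κ (paramsTo n m) A V s' := by
  have hsq : (n + 2) ^ 2 ≤ (n + 2) ^ 4 := Nat.pow_le_pow_right (by omega) (by norm_num)
  induction m with
  | zero => exact ⟨1, s, by omega, .skip s, hs⟩
  | succ m ih =>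
    refine (Halts.seq (T₂ := 50 * n + 50 + 1) (ih (by omega)) fun s₁ h₁ => ?_).mono
      (by have := add_one_mul m (50 * n + 51); omega) fun _ h => h
    have hP : ∀ j, paramsTo n m j < 2 ^ w := fun j => by
      have := params_le n j
      rw [paramsTo]
      split_ifs <;> omega
    refine Halts.seq (((paramEx (m + 1)).compile_halts hκ hP A (reads_paramEx _ _) 0 V s₁ h₁).mono
      (cost_paramEx _ _ _) fun _ h => h) fun s₂ ⟨h₂, _, _, v₂⟩ => Halts.instr ?_
    rw [eval_paramEx hw (by omega)] at v₂
    refine ⟨h₂.mem, fun j => ?_, fun r => ?_⟩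
    · simp only [Instr.exec, Operand.eval, v₂]
      by_cases hj : j = m + 1
      · subst hj
        rw [Function.update_self, paramsTo, if_pos le_rfl]
      · rw [Function.update_of_ne (by simp only [pReg]; omega), h₂.par, paramsTo, paramsTo]
        exact if_congr (by omega) rfl rfl
    · simp only [Instr.exec]
      rw [Function.update_of_ne (by simp only [pReg, vReg]; omega), h₂.var]

theorem paramsTo_six (n : ℕ) : paramsTo n 6 = params n := by
  funext j
  match j with
  | 0 | 1 | 2 | 3 | 4 | 5 | 6 => rfl
  | j + 7 => exact if_neg (by omega)

/-! ### The input -/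

/-- The program that moves the input to array `0`. -/
def relocate (κ : ℕ) : Program :=
  .seq (.instr (.set (vReg 0) (.reg (pReg 0)))) <|
  .while (.lt (.const 0) (.reg (vReg 0))) <|
    .seq (.instr (.op .sub (vReg 0) (.reg (vReg 0)) (.const 1))) <|
    .seq (.instr (.load (tReg 0) (.reg (vReg 0)))) <|
    .seq (.instr (.op .mul (tReg 1) (.reg (vReg 0)) (.const (2 ^ κ)))) <|
    .instr (.store (.reg (tReg 1)) (.reg (tReg 0)))

theorem relocate_halts {w κ n : ℕ} (π : Equiv.Perm (Fin n)) (hκ : κ < w)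
    (hw : 2 ^ κ * n + 1 < 2 ^ w) :
    Halts w (relocate κ) (inputState π) (5 * n + 2) fun s => ∃ A V, Rep w κ (paramsTo n 0) A V s ∧
      ∀ x < n, A 0 x = oneLine π x := by
  have h1 : 1 ≤ 2 ^ κ := Nat.one_le_two_pow
  have hn : n ≤ 2 ^ κ * n := Nat.le_mul_of_pos_left n h1
  let I : ℕ → State → Prop := fun i s => (∀ j, s.reg (pReg j) = paramsTo n 0 j) ∧
    s.reg (vReg 0) = n - i ∧
    ∀ x < n, s.mem (if x < n - i then x else 2 ^ κ * x) = oneLine π x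
  have hc : 2 ^ κ % 2 ^ w = 2 ^ κ := Nat.mod_eq_of_lt (Nat.pow_lt_pow_right (by norm_num) hκ)
  refine (Halts.seq (T₂ := n * (4 + 1) + 1) (R := I 0) (Halts.instr ⟨fun j => ?_, ?_, fun x hx => ?_⟩)
    fun s hs => Halts.while_count n (I := I) (fun i hi s hI => ?_) (fun s hI => ?_) n 0
      (by omega) s hs).mono (by omega) fun s hI => ?_
  · simp only [Instr.exec, inputState, Operand.eval]
    rw [Function.update_of_ne (by simp only [pReg, vReg]; omega), paramsTo]
    rcases j with - | j
    · rfl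
    · simp [pReg]
  · simp [Instr.exec, inputState, Operand.eval]
  · simp only [Instr.exec, inputState]
    rw [if_pos (by omega), dif_pos hx, oneLine, dif_pos hx]
  · obtain ⟨h₁, h₂, h₃⟩ := hI
    refine ⟨?_, ?_⟩
    · simp only [Test.holds, Operand.eval, h₂, Nat.zero_mod]
      omega
    · refine Halts.mono (T := 1 + (1 + (1 + 1))) ?_ le_rfl fun _ h => h
      refine Halts.seq (R := fun s' => s' = _) (Halts.instr rfl) fun s₁ e₁ => ?_
      refine Halts.seq (R := fun s' => s' = _) (Halts.instr rfl) fun s₂ e₂ => ?_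
      refine Halts.seq (R := fun s' => s' = _) (Halts.instr rfl) fun s₃ e₃ => Halts.instr ?_
      have v₁ : s₁.reg (vReg 0) = n - (i + 1) := by
        subst e₁
        simp only [Instr.exec, Operand.eval, BinOp.eval, Function.update_self, h₂]
        rw [Nat.mod_eq_of_lt (by omega : 1 < 2 ^ w), Nat.sub_add_comm (by omega),
          Nat.add_mod_right, Nat.mod_eq_of_lt (by omega)]
        omega
      have m₁ : s₁.mem = s.mem := by subst e₁; rfl
      have v₂ : s₂.reg (vReg 0) = n - (i + 1) := by
        subst e₂
        simp only [Instr.exec]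
        rw [Function.update_of_ne (by simp [vReg, tReg]), v₁]
      have t₂ : s₂.reg (tReg 0) = oneLine π (n - (i + 1)) := by
        subst e₂
        simp only [Instr.exec, Operand.eval, Function.update_self, v₁, m₁]
        rw [← h₃ _ (by omega), if_pos (by omega)]
      have t₃ : s₃.reg (tReg 1) = 2 ^ κ * (n - (i + 1)) := by
        subst e₃
        simp only [Instr.exec, Operand.eval, BinOp.eval, Function.update_self, v₂, hc]
        rw [mul_comm, Nat.mod_eq_of_lt]
        exact (Nat.mul_le_mul_left _ (Nat.sub_le _ _)).trans_lt (by omega)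
      have t₃' : s₃.reg (tReg 0) = oneLine π (n - (i + 1)) := by
        subst e₃
        simp only [Instr.exec]
        rw [Function.update_of_ne (by simp [tReg]), t₂]
      have m₃ : s₃.mem = s.mem := by subst e₃ e₂; exact m₁
      simp only [Instr.exec, Operand.eval, t₃, t₃', m₃]
      refine ⟨fun j => ?_, ?_, fun x hx => ?_⟩
      · subst e₃ e₂ e₁
        simp only [Instr.exec]
        rw [Function.update_of_ne (by simp only [pReg, tReg]; omega),
          Function.update_of_ne (by simp only [pReg, tReg]; omega),
          Function.update_of_ne (by simp only [pReg, vReg]; omega), h₁]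
      · subst e₃
        simp only [Instr.exec]
        rw [Function.update_of_ne (by simp [vReg, tReg]), v₂]
      · dsimp only
        by_cases hx' : x = n - (i + 1)
        · rw [if_neg (by omega), ← hx', Function.update_self]
        · rw [Function.update_of_ne, ← h₃ x hx]
          · congr 1
            exact if_congr (by omega) rfl rfl
          · have hle := Nat.le_mul_of_pos_left (n - (i + 1)) h1
            split_ifs with h
            · omega
            · exact fun he => hx' (Nat.eq_of_mul_eq_mul_left h1 he)
  · simp [Test.holds, Operand.eval, hI.2.1]
  · obtain ⟨h₁, h₂, h₃⟩ := hI
    refine ⟨fun k i => s.mem (2 ^ κ * i + k), fun r => s.reg (vReg r),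
      ⟨fun _ _ _ _ => rfl, h₁, fun _ => rfl⟩, fun x hx => ?_⟩
    have := h₃ x hx
    rwa [if_neg (by omega)] at this

/-! ### Polynomial bounds for the running time -/

/-- The parameter `j` is bounded in terms of the power `weight j` of the fourth root. -/
def weight : ℕ → ℕ
  | 0 => 4
  | 1 => 1
  | 2 => 3
  | 3 => 7
  | 4 => 5
  | 6 => 4
  | _ => 0

/-- `F n` is bounded by the power `m` of the fourth root of `n`, up to logarithms. -/
def RootBound (m : ℕ) (F : ℕ → ℕ) : Prop :=
  ∃ K l : ℕ, ∀ n, F n ≤ K * ((n.sqrt.sqrt + 1) ^ m * (n.size + 1) ^ l)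

theorem RootBound.mono {m m' : ℕ} {F G : ℕ → ℕ} (hF : RootBound m F) (hm : m ≤ m')
    (h : ∀ n, G n ≤ F n) : RootBound m' G := by
  obtain ⟨K, l, hK⟩ := hF
  exact ⟨K, l, fun n => (h n).trans ((hK n).trans (Nat.mul_le_mul_left _ (Nat.mul_le_mul_right _
    (Nat.pow_le_pow_right (Nat.succ_pos _) hm))))⟩

theorem RootBound.const (m c : ℕ) : RootBound m fun _ => c :=
  ⟨c, 0, fun n => Nat.le_mul_of_pos_right _ (by positivity)⟩

theorem RootBound.add {m : ℕ} {F G : ℕ → ℕ} (hF : RootBound m F) (hG : RootBound m G) :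
    RootBound m fun n => F n + G n := by
  obtain ⟨K, l, hK⟩ := hF
  obtain ⟨K', l', hK'⟩ := hG
  refine ⟨K + K', l + l', fun n => (add_le_add (hK n) (hK' n)).trans ?_⟩
  rw [add_mul]
  gcongr <;> first | exact Nat.succ_pos _ | omega

theorem RootBound.mul {m m' : ℕ} {F G : ℕ → ℕ} (hF : RootBound m F) (hG : RootBound m' G) :
    RootBound (m + m') fun n => F n * G n := by
  obtain ⟨K, l, hK⟩ := hF
  obtain ⟨K', l', hK'⟩ := hG
  refine ⟨K * K', l + l', fun n => (Nat.mul_le_mul (hK n) (hK' n)).trans (le_of_eq ?_)⟩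
  ring

theorem lt_root_pow (n : ℕ) : n < (n.sqrt.sqrt + 1) ^ 4 := by
  have h : ¬ n.sqrt.sqrt + 1 ≤ n.sqrt.sqrt := by omega
  rw [le_sqrt_sqrt_iff, not_le] at h
  calc n < _ := h
    _ = _ := by ring

theorem rows_le (n : ℕ) : n / n.sqrt.sqrt + 2 ≤ 4 * (n.sqrt.sqrt + 1) ^ 3 := by
  have h := lt_root_pow n
  set q := n.sqrt.sqrt
  have h₁ : 1 ≤ (q + 1) ^ 3 := Nat.one_le_pow _ _ (Nat.succ_pos _)
  rcases q.eq_zero_or_pos with hq | hq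
  · rw [hq, Nat.div_zero]; omega
  · have : n / q ≤ 2 * (q + 1) ^ 3 := by
      refine Nat.div_le_of_le_mul (h.le.trans ?_)
      rw [pow_succ]
      nlinarith
    omega

theorem rootBound_params (j : ℕ) : RootBound (weight j) fun n => params n j := by
  have h₀ : RootBound 4 fun n => n := ⟨1, 0, fun n => by simpa using (lt_root_pow n).le⟩
  have h₁ : RootBound 1 fun n => n.sqrt.sqrt := ⟨1, 0, fun n => by simp⟩
  have h₂ : RootBound 3 fun n => n / n.sqrt.sqrt + 2 := ⟨4, 0, fun n => by simpa using rows_le n⟩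
  match j with
  | 0 => exact h₀
  | 1 => exact h₁
  | 2 => exact h₂
  | 3 => exact h₂.mul h₀
  | 4 => exact h₀.mul (h₁.add (.const _ 1))
  | 5 => exact ⟨1, 1, fun n => by simp [params, weight]⟩
  | 6 => exact h₀.add (.const _ 1)
  | j + 7 => exact .const _ 0

/-- The exponent in the bound for the running time. -/
def Ex.deg : Ex → ℕ
  | lit _ | var _ | par _ => 0
  | op _ a b => max a.deg b.deg
  | rd _ i => i.deg
  | ite a b x y => max (max a.deg b.deg) (max x.deg y.deg)
  | sum _ j e => weight j + e.deg

/-- The exponent in the bound for the running time. -/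
def St.deg : St → ℕ
  | skip => 0
  | store _ i e => max i.deg e.deg
  | seq a b => max a.deg b.deg
  | loop _ j b => weight j + b.deg

theorem Ex.rootBound_cost (e : Ex) : RootBound e.deg fun n => e.cost (params n) := by
  induction e with
  | lit _ | var _ | par _ => exact .const _ 1
  | op o a b iha ihb =>
    exact ((iha.mono (le_max_left _ _) fun _ => le_rfl).add
      (ihb.mono (le_max_right _ _) fun _ => le_rfl)).add (.const _ 1)
  | rd k i ih => exact ih.add (.const _ 3)
  | ite a b x y iha ihb ihx ihy =>
    have hl : ∀ {F G : ℕ → ℕ} {m m' : ℕ}, RootBound m F → RootBound m' G →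
        RootBound (max m m') fun n => F n + G n := fun hF hG =>
      (hF.mono (le_max_left _ _) fun _ => le_rfl).add (hG.mono (le_max_right _ _) fun _ => le_rfl)
    exact ((hl (hl iha ihb) (hl ihx ihy)).add (.const _ 1)).mono le_rfl fun n => by
      simp only [cost]; omega
  | sum r j e ih => exact ((rootBound_params j).mul (ih.add (.const _ 3))).add (.const _ 5)

theorem St.rootBound_cost (b : St) : RootBound b.deg fun n => b.cost (params n) := by
  induction b with
  | skip => exact .const _ 1
  | store k i e =>
    exact ((i.rootBound_cost.mono (le_max_left _ _) fun _ => le_rfl).add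
      (e.rootBound_cost.mono (le_max_right _ _) fun _ => le_rfl)).add (.const _ 3)
  | seq a b iha ihb =>
    exact (iha.mono (le_max_left _ _) fun _ => le_rfl).add
      (ihb.mono (le_max_right _ _) fun _ => le_rfl)
  | loop r j b ih => exact ((rootBound_params j).mul (ih.add (.const _ 2))).add (.const _ 4)

theorem deg_dom (l : Bool × Bool) (src dst : ℕ) : (dom l src dst).deg ≤ 7 := by
  obtain ⟨l₁, l₂⟩ := l
  cases l₁ <;> cases l₂ <;> exact Nat.le_of_ble_eq_true rfl

theorem deg_treeProg (T : List (ℕ × Bool × Bool)) : (treeProg T).deg ≤ 7 := by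
  induction T with
  | nil => exact Nat.zero_le _
  | cons t T ih =>
    exact max_le (deg_dom _ _ _) (max_le (Nat.le_of_ble_eq_true rfl)
      (max_le (Nat.le_of_ble_eq_true rfl) ih))

theorem deg_onesProg (m : ℕ) : (onesProg m).deg ≤ 7 := by
  induction m with
  | zero => exact Nat.le_of_ble_eq_true rfl
  | succ m ih => exact max_le ih (Nat.le_of_ble_eq_true rfl)

theorem deg_itemProg (i : Item) : i.prog.deg ≤ 7 := by
  cases i with
  | tree T => exact max_le (deg_onesProg _) (deg_treeProg T)
  | leafMid₂ l =>
    exact max_le (Nat.le_of_ble_eq_true rfl) (max_le (deg_dom _ _ _) (Nat.le_of_ble_eq_true rfl))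
  | mid₂ | mid₃ => exact Nat.le_of_ble_eq_true rfl

theorem deg_itemResult (i : Item) : i.result.deg ≤ 7 := by
  cases i <;> exact Nat.le_of_ble_eq_true rfl

theorem deg_imageProg (g : Bool × Bool × Bool) : (imageProg g).deg ≤ 7 := by
  obtain ⟨tr, fx, fy⟩ := g
  cases tr <;> cases fx <;> cases fy <;> exact Nat.le_of_ble_eq_true rfl

theorem deg_jobsProg (L : List (ℤ × Job)) : (jobsProg L).deg ≤ 7 := by
  induction L with
  | nil => exact Nat.zero_le _
  | cons p L ih =>
    exact max_le (max_le (deg_imageProg _) (max_le (Nat.le_of_ble_eq_true rfl)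
      (max_le (deg_itemProg _) (max_le (Nat.zero_le _) (max_le (Nat.zero_le _)
        (max_le (Nat.zero_le _) (deg_itemResult _))))))) ih

theorem deg_patternProg (L : List (ℤ × Job)) : (patternProg L).deg ≤ 7 :=
  max_le (Nat.le_of_ble_eq_true rfl) (deg_jobsProg L)

theorem RootBound.isSoftO {m : ℕ} {F : ℕ → ℕ} (hF : RootBound m F) :
    IsSoftO F fun n => (n : ℝ) ^ ((m : ℝ) / 4) := by
  obtain ⟨K, l, hK⟩ := hF
  refine ⟨l, .of_bound (K * (2 ^ m * 6 ^ l)) ?_⟩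
  filter_upwards [eventually_ge_atTop 2] with n hn
  set q := n.sqrt.sqrt with hq
  have hq₀ : 1 ≤ q := le_sqrt_sqrt_iff.2 (by omega)
  have hn₀ : (0 : ℝ) ≤ n := n.cast_nonneg
  have h₁ : ((q : ℝ) + 1) ^ m ≤ 2 ^ m * (n : ℝ) ^ ((m : ℝ) / 4) := by
    have h₂ : (q : ℝ) ^ 4 ≤ n := by
      have := le_sqrt_sqrt_iff.1 hq.le
      exact_mod_cast (by ring : q ^ 4 = q * q * (q * q)).trans_le this
    have h₃ : (q : ℝ) ≤ (n : ℝ) ^ (1 / 4 : ℝ) := by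
      refine le_of_pow_le_pow_left₀ (n := 4) (by norm_num) (by positivity) ?_
      rw [← Real.rpow_natCast ((n : ℝ) ^ (1 / 4 : ℝ)), ← Real.rpow_mul hn₀]
      norm_num
      exact h₂
    have h₄ : (q : ℝ) + 1 ≤ 2 * (n : ℝ) ^ (1 / 4 : ℝ) := by
      have : (1 : ℝ) ≤ q := by exact_mod_cast hq₀
      linarith
    calc ((q : ℝ) + 1) ^ m ≤ (2 * (n : ℝ) ^ (1 / 4 : ℝ)) ^ m := by gcongr
      _ = 2 ^ m * (n : ℝ) ^ ((m : ℝ) / 4) := by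
        rw [mul_pow, ← Real.rpow_natCast ((n : ℝ) ^ (1 / 4 : ℝ)), ← Real.rpow_mul hn₀]
        congr 2
        ring
  have h₅ : ((n.size : ℝ) + 1) ^ l ≤ 6 ^ l * Real.log n ^ l := by
    rw [← mul_pow]
    have hlog2 := Real.log_two_gt_d9
    have hlog : Real.log 2 ≤ Real.log n :=
      Real.log_le_log (by norm_num) (by exact_mod_cast hn)
    obtain ⟨s, hs⟩ : ∃ s, n.size = s + 1 := ⟨n.size - 1, by
      have := Nat.size_pos.2 (by omega : 0 < n)
      omega⟩
    have h₆ : 2 ^ s ≤ n := Nat.lt_size.1 (by omega)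
    have h₇ : s * Real.log 2 ≤ Real.log n := by
      rw [← Real.log_pow]
      exact Real.log_le_log (by positivity) (by exact_mod_cast h₆)
    have h₈ : (n.size : ℝ) + 1 ≤ 6 * Real.log n := by
      rw [hs]
      push_cast
      have : (0 : ℝ) ≤ s := s.cast_nonneg
      nlinarith
    gcongr
  have hlog : 0 ≤ Real.log n := Real.log_natCast_nonneg n
  rw [Real.norm_of_nonneg (by positivity), Real.norm_of_nonneg (by positivity)]
  calc (F n : ℝ) ≤ K * (((q : ℝ) + 1) ^ m * ((n.size : ℝ) + 1) ^ l) := by exact_mod_cast hK n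
    _ ≤ K * ((2 ^ m * (n : ℝ) ^ ((m : ℝ) / 4)) * (6 ^ l * Real.log n ^ l)) := by gcongr
    _ = _ := by ring

/-! ### The whole program -/

/-- The program that computes the counts of a list of patterns to the temporaries from `d` on. -/
def patternsProgram (D : Equiv.Perm (Fin 5) → ℕ) (L : Equiv.Perm (Fin 5) → List (ℤ × Job)) :
    ℕ → List (Equiv.Perm (Fin 5)) → Program
  | _, [] => .skip
  | d, σ :: l => .seq ((patternProg (L σ)).compile 5 d) <|
      .seq ((patternEx (D σ)).compile 5 d) (patternsProgram D L (d + 1) l)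

/-- The running time of `patternsProgram`. -/
def patternsCost (D : Equiv.Perm (Fin 5) → ℕ) (L : Equiv.Perm (Fin 5) → List (ℤ × Job))
    (n : ℕ) : List (Equiv.Perm (Fin 5)) → ℕ
  | [] => 1
  | σ :: l => (patternProg (L σ)).cost (params n) +
      ((patternEx (D σ)).cost (params n) + patternsCost D L n l)

/-- The program that writes the temporaries from `d` on to the output cells of a list of
patterns. -/
def outputProgram {k : ℕ} : ℕ → List (Equiv.Perm (Fin k)) → Program
  | _, [] => .skip
  | d, σ :: l => .seq (.instr (.store (.const (outputCell σ)) (.reg (tReg d))))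
      (outputProgram (d + 1) l)

theorem rootBound_patternsCost (D : Equiv.Perm (Fin 5) → ℕ)
    (L : Equiv.Perm (Fin 5) → List (ℤ × Job)) (l : List (Equiv.Perm (Fin 5))) :
    RootBound 7 fun n => patternsCost D L n l := by
  induction l with
  | nil => exact .const _ 1
  | cons σ l ih =>
    exact ((St.rootBound_cost _).mono (deg_patternProg _) fun _ => le_rfl).add
      (((Ex.rootBound_cost _).mono (Nat.zero_le _) fun _ => le_rfl).add ih)

theorem patternsProgram_halts {w n : ℕ} {D : Equiv.Perm (Fin 5) → ℕ}
    {L : Equiv.Perm (Fin 5) → List (ℤ × Job)} {π : Equiv.Perm (Fin n)} {V : ℕ → ℕ} (hκ : 5 ≤ w)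
    (hP : ∀ j, params n j < 2 ^ w) (hs : Sizes w 5 (params n) n n.sqrt.sqrt n.size)
    (hD : ∀ σ, 0 < D σ) (hL : ∀ σ, ∀ p ∈ L σ, p.2.2.Valid)
    (h : ∀ σ, (D σ * patternCount σ π : ℤ) =
      ((L σ).map fun p => p.1 * (homCount p.2.2.size p.2.2.con (image p.2.1 π) : ℤ)).sum)
    (hw : ∀ σ, D σ * (n ^ 5 + 1) < 2 ^ w) (l : List (Equiv.Perm (Fin 5))) :
    ∀ (d : ℕ) (A : ℕ → ℕ → ℕ) (s : State), Rep w 5 (params n) A V s →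
      (∀ x < n, A 0 x = oneLine π x) →
      Halts w (patternsProgram D L d l) s (patternsCost D L n l) fun s' => TempsEq d s s' ∧
        ∀ (i : ℕ) (hi : i < l.length), s'.reg (tReg (d + i)) = patternCount l[i] π := by
  induction l with
  | nil => exact fun d A s _ _ => ⟨1, s, le_rfl, .skip s, TempsEq.refl d s, fun i hi => by simp at hi⟩
  | cons σ l ih =>
    intro d A s hr hA
    obtain ⟨h₁, h₂⟩ := exec_patternProg (V := V) hs hA (hD σ) (hL σ) (h σ) (hw σ)
    refine Halts.seq (St.compile_halts hκ hP _ (uses_patternProg (hL σ)) d A V s hr)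
      fun s₁ ⟨r₁, t₁⟩ => ?_
    refine Halts.seq (Ex.compile_halts hκ hP _ _ (reads_patternEx (D σ)) d V s₁ r₁)
      fun s₂ ⟨r₂, _, t₂, v₂⟩ => ?_
    refine (ih (d + 1) _ s₂ r₂ (by rwa [h₁])).mono le_rfl fun s₃ ⟨t₃, v₃⟩ =>
      ⟨(t₁.trans t₂).trans (t₃.mono (Nat.le_succ d)), fun i hi => ?_⟩
    cases i with
    | zero => rw [add_zero, t₃ d (Nat.lt_succ_self d), v₂, h₂]; rfl
    | succ i =>
      rw [← add_assoc, add_right_comm]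
      exact v₃ i (by simpa using hi)

theorem outputProgram_halts {w k : ℕ} (hw : k ^ k ≤ 2 ^ w) (f : Equiv.Perm (Fin k) → ℕ)
    (l : List (Equiv.Perm (Fin k))) : ∀ (d : ℕ) (s : State),
      (∀ (i : ℕ) (hi : i < l.length), s.reg (tReg (d + i)) = f l[i]) →
      Halts w (outputProgram d l) s (l.length + 1) fun s' =>
        (∀ σ ∈ l, s'.mem (outputCell σ) = f σ) ∧
        ∀ σ ∉ l, s'.mem (outputCell σ) = s.mem (outputCell σ) := by
  induction l with
  | nil => exact fun d s _ => ⟨1, s, le_rfl, .skip s, by simp, fun _ _ => rfl⟩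
  | cons σ l ih =>
    intro d s hs
    refine Halts.mono (T := 1 + (l.length + 1)) (Halts.seq (R := fun s' => s' = _)
      (Halts.instr rfl) fun s₁ e₁ => (ih (d + 1) s₁ fun i hi => ?_).mono le_rfl
        fun s₂ ⟨h₁, h₂⟩ => ?_) (by rw [List.length_cons]; omega) fun _ h => h
    · subst e₁
      have := hs (i + 1) (by simpa using hi)
      rw [← add_assoc, add_right_comm] at this
      exact this
    · have hm : ∀ τ, s₁.mem (outputCell τ) =
          if τ = σ then f σ else s.mem (outputCell τ) := fun τ => by
        subst e₁
        have := hs 0 (by simp)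
        rw [add_zero] at this
        simp only [Instr.exec, Operand.eval, this, Function.update_apply,
          Nat.mod_eq_of_lt ((outputCell_lt σ).trans_le hw), outputCell_injective.eq_iff]
        rfl
      refine ⟨fun τ hτ => ?_, fun τ hτ => ?_⟩
      · by_cases hl : τ ∈ l
        · exact h₁ τ hl
        · rw [h₂ τ hl, hm]
          obtain rfl : τ = σ := by simpa [hl] using hτ
          exact if_pos rfl
      · rw [List.mem_cons, not_or] at hτ
        rw [h₂ τ hτ.2, hm, if_neg hτ.1]

theorem profileComputableInTime : ProfileComputableInTime 5 fun n : ℕ => (n : ℝ) ^ (7 / 4 : ℝ) := by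
  choose D L hD hL h using exists_jobs
  set l : List (Equiv.Perm (Fin 5)) := univ.toList with hl
  refine ⟨.seq (relocate 5) (.seq (setParams 5 6) (.seq (patternsProgram D L 0 l)
    (outputProgram 0 l))), ∑ σ, D σ + 13,
    fun n => 5 * n + 2 + ((6 * (50 * n + 51) + 1) + (patternsCost D L n l + (l.length + 1))),
    by omega, ?_, fun n π w hw => ?_⟩
  · have hn : RootBound 7 fun n => n := (rootBound_params 0).mono (by decide) fun _ => le_rfl
    have hlin : ∀ a b : ℕ, RootBound 7 fun n => a * n + b := fun a b =>
      (((RootBound.const 0 a).mul hn).mono (by norm_num) fun _ => le_rfl).add (.const _ b)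
    have := RootBound.isSoftO ((hlin 5 2).add ((((hlin 300 307)).mono le_rfl fun n =>
      (by omega : 6 * (50 * n + 51) + 1 ≤ 300 * n + 307)).add
        ((rootBound_patternsCost D L l).add (.const _ (l.length + 1)))))
    exact_mod_cast this
  · obtain ⟨m, hm, hm1, hnm⟩ : ∃ m, Nat.log 2 n + 1 = m ∧ 1 ≤ m ∧ n < 2 ^ m :=
      ⟨_, rfl, Nat.succ_pos _, Nat.lt_pow_succ_log_self one_lt_two n⟩
    rw [hm] at hw
    have hw₁ : 13 * m ≤ w := (Nat.mul_le_mul_right m (by omega)).trans hw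
    have hn₂ : n + 2 ≤ 2 ^ (m + 1) := by
      have : 2 ^ 1 ≤ 2 ^ m := Nat.pow_le_pow_right two_pos hm1
      rw [pow_succ]
      omega
    have h₄ : (n + 2) ^ 4 ≤ 2 ^ (w - 5) := by
      calc (n + 2) ^ 4 ≤ (2 ^ (m + 1)) ^ 4 := Nat.pow_le_pow_left hn₂ 4
        _ = 2 ^ ((m + 1) * 4) := (pow_mul _ _ _).symm
        _ ≤ 2 ^ (w - 5) := Nat.pow_le_pow_right two_pos (by omega)
    have hww : 2 ^ w = 2 ^ 5 * 2 ^ (w - 5) := by rw [← pow_add]; congr 1; omega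
    have h₂ : (n + 2) ^ 2 ≤ (n + 2) ^ 4 := Nat.pow_le_pow_right (by omega) (by norm_num)
    have h₃ : (n + 2) ^ 3 ≤ (n + 2) ^ 4 := Nat.pow_le_pow_right (by omega) (by norm_num)
    have h₀ := le_sq n
    have hP : ∀ j, params n j < 2 ^ w := fun j => by
      have := params_le n j
      omega
    have hDw : ∀ σ, D σ * (n ^ 5 + 1) < 2 ^ w := fun σ => by
      have hDs : D σ ≤ ∑ σ, D σ := single_le_sum (fun _ _ => Nat.zero_le _) (mem_univ σ)
      have hn5 : n ^ 5 + 1 ≤ 2 ^ (m * 5) := by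
        rw [pow_mul]
        exact Nat.pow_lt_pow_left hnm (by norm_num)
      calc D σ * (n ^ 5 + 1) < 2 ^ D σ * 2 ^ (m * 5) :=
            Nat.mul_lt_mul_of_lt_of_le (Nat.lt_two_pow_self) hn5 (by positivity)
        _ = 2 ^ (D σ + m * 5) := (pow_add _ _ _).symm
        _ ≤ 2 ^ w := Nat.pow_le_pow_right two_pos (by nlinarith)
    have hout : 5 ^ 5 ≤ 2 ^ w :=
      (by norm_num : 5 ^ 5 ≤ 2 ^ 13).trans (Nat.pow_le_pow_right two_pos (by omega))
    obtain ⟨t, s, ht, hr, hs⟩ := Halts.seq (relocate_halts π (κ := 5) (by omega) (by omega))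
      fun s₁ ⟨A, V, r₁, hA⟩ => Halts.seq (setParams_halts (by omega) (by omega) r₁ 6 le_rfl)
        fun s₂ r₂ => Halts.seq (patternsProgram_halts (by omega) hP
          (sizes_params (h₃.trans h₄)) hD hL (fun σ => h σ n π) hDw l 0 A s₂
          (by rwa [paramsTo_six] at r₂) hA) fun s₃ ⟨_, v₃⟩ =>
            (outputProgram_halts hout (fun σ => patternCount σ π) l 0 s₃ v₃).mono le_rfl
              fun _ h => h.1
    exact ⟨t, s, ht, hr, fun τ => hs τ (by simp [hl])⟩

end WordRAM

theorem mainTheorem2 :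
    ProfileComputableInTime 5 (fun n : ℕ => (n : ℝ) ^ (7 / 4 : ℝ)) :=
  WordRAM.profileComputableInTime
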